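/- **Setting.** Let $T>0$, $\phi,\varrho\ge 0$, $q>0$, and let $(\Omega,\mathcal F,(\mathcal F_t)_{0\le t\le T},\mathbb P)$ be a filtered probability space satisfying the usual conditions. Let $P=A+M$, where $A$ is a càdlàg predictable process of finite variation with $A_0$ integrable, $M$ is a càdlàg martingale independent of $A$ with $\mathbb E[M_0]=0$, and $\mathbb E[\langle M\rangle_T]+\mathbb E[(\int_0^T|dA_s|)^2]<\infty$. Let $\mathcal A$ be the set of progressively measurable $u$ with $\mathbb E\int_0^Tu_s^2\,ds<\infty$. For $\theta=(\lambda,G)\in\mathbb R\times L^2([0,T])$ and $u\in\mathcal A$ put $Q^u_t=q-\int_0^tu_s\,ds$ and $$J^{\theta}(u)=\mathbb E\Big[\int_0^T\Big(P_t-\lambda u_t-\int_0^tG(t-s)u_s\,ds\Big)u_t\,dt+Q^u_TP_T-\phi\int_0^T(Q^u_t)^2dt-\varrho (Q^u_T)^2\Big].$$ **Models.** Let $L>0$ and $\varepsilon\in(0,L^{-1}/2)$. The class $\Xi_\varepsilon$ consists of all $(\lambda,G)\in\mathbb R\times L^2([0,T])$ with $L^{-1}\le\lambda\le L$, $\|G\|_{L^2}\le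 L$ and $\int_0^T\!\int_0^TG(|t-s|)f(s)f(t)\,ds\,dt\ge-\varepsilon\|f\|_{L^2}^2$ for all $f\in L^2([0,T])$. The true model $\theta^\star=(\lambda^\star,G^\star)$ satisfies $L^{-1}<\lambda^\star<L$, $\|G^\star\|_{L^2}<L$ and $\int_0^T\!\int_0^TG^\star(|t-s|)f(s)f(t)\,ds\,dt\ge0$ for all $f\in L^2([0,T])$. **Greedy control.** For $\theta=(\lambda,G)$ put $\tilde G(t,s)=(2\varrho+G(t-s))\mathbf 1_{\{s<t\}}$ and $\mathbf 1_t(s)=\mathbf 1_{\{s\ge t\}}$. Let $\boldsymbol{\tilde G}_t$ and $\boldsymbol 1_t$ be the integral operators on $L^2([0,T])$ with kernels $(s,u)\mapsto\tilde G(s,u)\mathbf 1_{\{u\ge t\}}$ and $(u,s)\mapsto\mathbf 1_{\{u\ge s\}}\mathbf 1_{\{s\ge t\}}$, and set $$\boldsymbol D_t=2\lambda\,\mathrm{id}+\boldsymbol{\tilde G}_t+\boldsymbol{\tilde G}_t^*+2\phi\,\boldsymbol 1_t^*\boldsymbol 1_t,\qquad \boldsymbol\Gamma_t^{-1}=\begin{pmatrix}\boldsymbol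 D_t^{-1}&-2\phi\boldsymbol D_t^{-1}\boldsymbol 1_t^*\\-2\phi\boldsymbol 1_t\boldsymbol D_t^{-1}&-2\phi\,\mathrm{id}+4\phi^2\boldsymbol 1_t\boldsymbol D_t^{-1}\boldsymbol 1_t^*\end{pmatrix},$$ $K_t(s)=(\tilde G(s,t),-\mathbf 1_{\{s\ge t\}})^\top$ and $\Theta_t=-\boldsymbol\Gamma_t^{-1}\big(\mathbf 1_t\,\mathbb E[A_\cdot-A_T\mid\mathcal F_t]\,(1,0)^\top\big)$. A greedy control $u^\theta=\mathsf{Greedy}(A,\theta)$ is a $u\in\mathcal A$ such that $u_t=a_t+\int_0^tB(t,s)u_s\,ds$ holds $dt\otimes\mathbb P$-a.e., where $$a_t=\tfrac1{2\lambda}\Big(\mathbb E[A_t-A_T\mid\mathcal F_t]+2\varrho q+\langle\Theta_t,K_t\rangle_{L^2}+\langle\boldsymbol\Gamma_t^{-1}K_t,\mathbf 1_t(-2\varrho q,q)^\top\rangle_{L^2}\Big),$$ $$B(t,s)=\mathbf 1_{\{s<t\}}\tfrac1{2\lambda}\Big(\langle\boldsymbol\Gamma_t^{-1}K_t,\mathbf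 1_t(\tilde G(\cdot,s),-1)^\top\rangle_{L^2}-\tilde G(t,s)\Big).$$ **Theorem.** For every $\theta\in\Xi_\varepsilon$ the greedy control $u^\theta$ exists and is unique up to $dt\otimes\mathbb P$-null sets. Moreover there is a constant $C>0$, depending on $L$, $\varepsilon$, the problem data $T,\phi,\varrho,q$ and an upper bound for $\mathbb E[(\int_0^T|dA_s|)^2]$ only, such that for every true model $\theta^\star=(\lambda^\star,G^\star)$ as above and all $\theta=(\lambda,G)\in\Xi_\varepsilon$, $$\big|J^{\theta^\star}(u^{\theta^\star})-J^{\theta^\star}(u^{\theta})\big|\le C\Big(|\lambda^\star-\lambda|^2+\|G^\star-G\|_{L^2([0,T])}^2\Big).$$ -/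

import Mathlib

open MeasureTheory ProbabilityTheory Filter Topology
open scoped ENNReal NNReal

namespace Propagator

noncomputable section

/-! ### The time interval, `L²([0,T])` and integral operators -/

/-- The time interval `[0,T]`, with Lebesgue measure as its `volume`. -/
abbrev Time (T : ℝ) : Type := Set.Icc (0 : ℝ) T

instance instBoundedOrderTime {T : ℝ} [h : Fact (0 < T)] : BoundedOrder (Time T) where
  top := ⟨T, h.out.le, le_rfl⟩
  le_top t := t.2.2
  bot := ⟨0, le_rfl, h.out.le⟩
  bot_le t := t.2.1

instance instMeasureSpaceTime {T : ℝ} : MeasureSpace (Time T) := Measure.Subtype.measureSpace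

instance instIsFiniteMeasureTime {T : ℝ} : IsFiniteMeasure (volume : Measure (Time T)) := by
  refine ⟨?_⟩
  change Measure.comap Subtype.val (volume : Measure ℝ) Set.univ < ∞
  rw [comap_subtype_coe_apply measurableSet_Icc]
  exact (measure_mono (Subtype.coe_image_subset _ _)).trans_lt measure_Icc_lt_top

/-- The real Hilbert space `L²([0,T], ℝ)`. -/
abbrev L2 (T : ℝ) : Type := Lp ℝ 2 (volume : Measure (Time T))

/-- `|t - s|` as a point of `[0,T]`; it equals `t - s` when `s ≤ t`. -/
def gap {T : ℝ} (t s : Time T) : Time T :=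
  ⟨|(t : ℝ) - s|, abs_nonneg _, by
    rw [abs_le]; constructor <;> linarith [t.2.1, t.2.2, s.2.1, s.2.2]⟩

theorem measurable_gap {T : ℝ} : Measurable fun p : Time T × Time T => gap p.1 p.2 := by
  apply Measurable.subtype_mk
  fun_prop

/-- The class in `L²([0,T])` of a square integrable function (and `0` for other functions). -/
def toL2 {T : ℝ} (f : Time T → ℝ) : L2 T :=
  open Classical in if h : MemLp f 2 volume then h.toLp f else 0

theorem kernel_lintegral_le {T : ℝ} (k : Time T → Time T → ℝ) (s : Time T)
    (hk : Measurable (k s)) (f : L2 T) :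
    ‖∫ u, k s u * f u‖ₑ ^ (2 : ℝ)
      ≤ (∫⁻ u, ‖k s u‖ₑ ^ (2 : ℝ)) * ∫⁻ u, ‖f u‖ₑ ^ (2 : ℝ) := by
  have h1 : ‖∫ u, k s u * f u‖ₑ ≤ ∫⁻ u, ‖k s u‖ₑ * ‖f u‖ₑ := by
    refine (enorm_integral_le_lintegral_enorm _).trans (le_of_eq ?_)
    simp [enorm_mul]
  have h2 := ENNReal.lintegral_mul_le_Lp_mul_Lq (volume : Measure (Time T))
    (p := 2) (q := 2) (by constructor <;> norm_num) hk.enorm.aemeasurable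
    (Lp.stronglyMeasurable f).measurable.enorm.aemeasurable
  refine (ENNReal.rpow_le_rpow (h1.trans h2) (by norm_num)).trans (le_of_eq ?_)
  rw [ENNReal.mul_rpow_of_nonneg _ _ (by norm_num), ← ENNReal.rpow_mul, ← ENNReal.rpow_mul]
  norm_num

theorem memLp_two_iff {α : Type*} [MeasurableSpace α] {μ : Measure α} {f : α → ℝ} :
    MemLp f 2 μ ↔ AEStronglyMeasurable f μ ∧ ∫⁻ x, ‖f x‖ₑ ^ (2 : ℝ) ∂μ < ∞ := by
  unfold MemLp
  rw [eLpNorm_lt_top_iff_lintegral_rpow_enorm_lt_top (by norm_num) (by norm_num)]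
  norm_num

theorem memLp_kernel {T : ℝ} (k : Time T → Time T → ℝ)
    (hk : Measurable (Function.uncurry k))
    (hk2 : MemLp (Function.uncurry k) 2 (volume.prod volume)) (f : L2 T) :
    MemLp (fun s => ∫ u, k s u * f u) 2 volume := by
  have hf := (memLp_two_iff.1 (Lp.memLp f)).2
  have hK := (memLp_two_iff.1 hk2).2
  rw [lintegral_prod _ (by fun_prop)] at hK
  refine memLp_two_iff.2 ⟨?_, ?_⟩
  · have : Measurable (Function.uncurry fun s u => k s u * f u) :=
      hk.mul ((Lp.stronglyMeasurable f).measurable.comp measurable_snd)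
    exact this.stronglyMeasurable.integral_prod_right.aestronglyMeasurable
  · calc ∫⁻ s, ‖∫ u, k s u * f u‖ₑ ^ (2 : ℝ)
        ≤ ∫⁻ s, (∫⁻ u, ‖k s u‖ₑ ^ (2 : ℝ)) * ∫⁻ u, ‖f u‖ₑ ^ (2 : ℝ) :=
          lintegral_mono fun s => kernel_lintegral_le k s hk.of_uncurry_left f
      _ = (∫⁻ s, ∫⁻ u, ‖k s u‖ₑ ^ (2 : ℝ)) * ∫⁻ u, ‖f u‖ₑ ^ (2 : ℝ) :=
          lintegral_mul_const' _ _ hf.ne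
      _ < ∞ := ENNReal.mul_lt_top hK hf

theorem kernel_integrable {T : ℝ} (k : Time T → Time T → ℝ)
    (hk : Measurable (Function.uncurry k))
    (hk2 : MemLp (Function.uncurry k) 2 (volume.prod volume)) :
    ∀ᵐ s : Time T, ∀ f : L2 T, Integrable fun u => k s u * f u := by
  have hK := (memLp_two_iff.1 hk2).2
  rw [lintegral_prod _ (by fun_prop)] at hK
  have hm : Measurable fun s => ∫⁻ u, ‖Function.uncurry k (s, u)‖ₑ ^ (2 : ℝ) :=
    Measurable.lintegral_prod_right' (f := fun p => ‖Function.uncurry k p‖ₑ ^ (2 : ℝ))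
      (by fun_prop)
  filter_upwards [ae_lt_top hm hK.ne] with s hs f
  have h1 : MemLp (k s) 2 volume :=
    memLp_two_iff.2 ⟨hk.of_uncurry_left.aestronglyMeasurable, hs⟩
  exact h1.integrable_mul (Lp.memLp f)

/-- The bounded operator `f ↦ ∫ k(·,u) f(u) du` on `L²([0,T])` induced by a kernel
`k ∈ L²([0,T]²)`. -/
def integralOp {T : ℝ} (k : Time T → Time T → ℝ)
    (hk : Measurable (Function.uncurry k))
    (hk2 : MemLp (Function.uncurry k) 2 (volume.prod volume)) : L2 T →L[ℝ] L2 T :=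
  LinearMap.mkContinuous
    { toFun := fun f => (memLp_kernel k hk hk2 f).toLp
      map_add' := fun f g => by
        rw [← MemLp.toLp_add, MemLp.toLp_eq_toLp_iff]
        filter_upwards [kernel_integrable k hk hk2] with s hs
        rw [Pi.add_apply, ← integral_add (hs f) (hs g)]
        refine integral_congr_ae ?_
        filter_upwards [Lp.coeFn_add f g] with u hu
        rw [hu, Pi.add_apply, mul_add]
      map_smul' := fun c f => by
        rw [RingHom.id_apply, ← MemLp.toLp_const_smul, MemLp.toLp_eq_toLp_iff]
        refine Eventually.of_forall fun s => ?_
        rw [Pi.smul_apply, smul_eq_mul, ← integral_const_mul]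
        refine integral_congr_ae ?_
        filter_upwards [Lp.coeFn_smul c f] with u hu
        rw [hu, Pi.smul_apply, smul_eq_mul]
        ring }
    (eLpNorm (Function.uncurry k) 2 (volume.prod volume)).toReal
    (fun f => by
      have hf := (memLp_two_iff.1 (Lp.memLp f)).2
      change ‖(memLp_kernel k hk hk2 f).toLp‖ ≤ _ * ‖f‖
      rw [Lp.norm_toLp, Lp.norm_def, ← ENNReal.toReal_mul]
      refine ENNReal.toReal_mono (ENNReal.mul_lt_top hk2.2 (Lp.memLp f).2).ne ?_
      simp only [eLpNorm_eq_lintegral_rpow_enorm_toReal (p := 2) (by norm_num) (by norm_num)]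
      rw [← ENNReal.mul_rpow_of_nonneg _ _ (by norm_num)]
      refine ENNReal.rpow_le_rpow ?_ (by norm_num)
      rw [lintegral_prod _ (by fun_prop)]
      simp only [ENNReal.toReal_ofNat]
      rw [← lintegral_mul_const' _ _ hf.ne]
      exact lintegral_mono fun s => kernel_lintegral_le k s hk.of_uncurry_left f)

/-! ### The kernels of the problem -/

/-- `G̃(t,s) = (2ϱ + G(t-s)) 1_{s<t}`. -/
def tildeG {T : ℝ} (ϱ : ℝ) (G : L2 T) (t s : Time T) : ℝ :=
  if s < t then 2 * ϱ + G (gap t s) else 0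

theorem measurable_tildeG {T : ℝ} (ϱ : ℝ) (G : L2 T) :
    Measurable (Function.uncurry (tildeG ϱ G)) := by
  refine Measurable.ite (measurableSet_lt measurable_snd measurable_fst) ?_ measurable_const
  exact measurable_const.add ((Lp.stronglyMeasurable G).measurable.comp measurable_gap)

theorem lintegral_gap_le {T : ℝ} (g : Time T → ℝ≥0∞) (hg : Measurable g) (t : Time T) :
    ∫⁻ s in Set.Ioi t, g (gap s t) ≤ ∫⁻ s, g s := by
  classical
  let e : ℝ → ℝ≥0∞ := fun x => if h : x ∈ Set.Icc (0 : ℝ) T then g ⟨x, h⟩ else 0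
  have he : Measurable e := Measurable.dite (by exact hg) measurable_const measurableSet_Icc
  have h1 : ∫⁻ s, g s ∂(volume : Measure (Time T)) = ∫⁻ x, e x := by
    have : ∀ s : Time T, g s = e (s : ℝ) := fun s => by
      simp only [e, dif_pos s.2]
    simp_rw [this]
    rw [show (volume : Measure (Time T)) = Measure.comap Subtype.val volume from rfl,
      lintegral_subtype_comap measurableSet_Icc, ← lintegral_indicator measurableSet_Icc]
    refine lintegral_congr fun x => ?_
    by_cases hx : x ∈ Set.Icc (0 : ℝ) T
    · simp [hx]
    · simp only [Set.indicator_of_notMem hx, e, dif_neg hx]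
  have h2 : ∀ s ∈ Set.Ioi t, g (gap s t) = e ((s : ℝ) - t) := fun s hs => by
    have h : |(s : ℝ) - t| = s - t := abs_of_nonneg (sub_nonneg.2 (le_of_lt hs))
    have hm : (s : ℝ) - t ∈ Set.Icc (0 : ℝ) T := by rw [← h]; exact (gap s t).2
    simp only [e, dif_pos hm]
    exact congrArg g (Subtype.ext h)
  calc ∫⁻ s in Set.Ioi t, g (gap s t) = ∫⁻ s in Set.Ioi t, e ((s : ℝ) - t) :=
        setLIntegral_congr_fun measurableSet_Ioi h2
    _ ≤ ∫⁻ s : Time T, e ((s : ℝ) - t) := setLIntegral_le_lintegral _ _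
    _ = ∫⁻ x in Set.Icc (0 : ℝ) T, e (x - t) := by
        rw [show (volume : Measure (Time T)) = Measure.comap Subtype.val volume from rfl,
          lintegral_subtype_comap measurableSet_Icc (fun x => e (x - t))]
    _ ≤ ∫⁻ x, e (x - t) := setLIntegral_le_lintegral _ _
    _ = ∫⁻ x, e x := lintegral_sub_right_eq_self e _
    _ = ∫⁻ s, g s := h1.symm

theorem lintegral_tildeG_le {T : ℝ} (ϱ : ℝ) (G : L2 T) (t : Time T) :
    ∫⁻ s, ‖tildeG ϱ G s t‖ₑ ^ (2 : ℝ) ≤ ∫⁻ s : Time T, ‖2 * ϱ + G s‖ₑ ^ (2 : ℝ) := by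
  refine le_trans (le_of_eq ?_) (lintegral_gap_le (fun s => ‖2 * ϱ + G s‖ₑ ^ (2 : ℝ)) ?_ t)
  · rw [← lintegral_indicator measurableSet_Ioi]
    refine lintegral_congr fun s => ?_
    by_cases h : t < s
    · simp [tildeG, h]
    · simp [tildeG, h]
  · have := (Lp.stronglyMeasurable G).measurable
    fun_prop

theorem lintegral_const_add_lt_top {T : ℝ} (ϱ : ℝ) (G : L2 T) :
    ∫⁻ s : Time T, ‖2 * ϱ + G s‖ₑ ^ (2 : ℝ) < ∞ :=
  (memLp_two_iff.1 ((memLp_const (2 * ϱ)).add (Lp.memLp G))).2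

theorem memLp_tildeG_col {T : ℝ} (ϱ : ℝ) (G : L2 T) (t : Time T) :
    MemLp (fun s => tildeG ϱ G s t) 2 volume :=
  memLp_two_iff.2 ⟨((measurable_tildeG ϱ G).comp
    (measurable_id.prodMk measurable_const)).aestronglyMeasurable,
    (lintegral_tildeG_le ϱ G t).trans_lt (lintegral_const_add_lt_top ϱ G)⟩

/-- `G̃_t(s,u) = G̃(s,u) 1_{u ≥ t}`. -/
def tildeGFrom {T : ℝ} (ϱ : ℝ) (G : L2 T) (t s u : Time T) : ℝ :=
  if t ≤ u then tildeG ϱ G s u else 0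

theorem measurable_tildeGFrom {T : ℝ} (ϱ : ℝ) (G : L2 T) (t : Time T) :
    Measurable (Function.uncurry (tildeGFrom ϱ G t)) :=
  Measurable.ite (measurableSet_le measurable_const measurable_snd)
    (measurable_tildeG ϱ G) measurable_const

theorem memLp_tildeGFrom {T : ℝ} (ϱ : ℝ) (G : L2 T) (t : Time T) :
    MemLp (Function.uncurry (tildeGFrom ϱ G t)) 2 (volume.prod volume) := by
  have hm := measurable_tildeGFrom ϱ G t
  refine memLp_two_iff.2 ⟨hm.aestronglyMeasurable, ?_⟩
  rw [lintegral_prod_symm _ (by fun_prop)]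
  refine lt_of_le_of_lt (lintegral_mono (g := fun _ : Time T =>
    ∫⁻ s : Time T, ‖2 * ϱ + G s‖ₑ ^ (2 : ℝ)) fun u => ?_) ?_
  · refine le_trans (lintegral_mono fun s => ?_) (lintegral_tildeG_le ϱ G u)
    by_cases h : t ≤ u <;> simp [tildeGFrom, h]
  · rw [lintegral_const]
    exact ENNReal.mul_lt_top (lintegral_const_add_lt_top ϱ G) (measure_lt_top _ _)

/-- The kernel `1_t(u,s) = 1_{u ≥ s} 1_{s ≥ t}`. -/
def oneKer {T : ℝ} (t u s : Time T) : ℝ := if t ≤ s ∧ s ≤ u then 1 else 0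

theorem measurable_oneKer {T : ℝ} (t : Time T) : Measurable (Function.uncurry (oneKer t)) :=
  Measurable.ite
    ((measurableSet_le (α := Time T) (f := fun _ => t) measurable_const measurable_snd).inter
      (measurableSet_le (α := Time T) measurable_snd measurable_fst))
    measurable_const measurable_const

theorem memLp_oneKer {T : ℝ} (t : Time T) :
    MemLp (Function.uncurry (oneKer t)) 2 (volume.prod volume) :=
  MemLp.of_bound (measurable_oneKer t).aestronglyMeasurable 1
    (Eventually.of_forall fun p => by
      by_cases h : t ≤ p.2 ∧ p.2 ≤ p.1 <;> simp [Function.uncurry, oneKer, h])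

/-! ### The operators `D_t`, `Γ_t⁻¹` -/

/-- The integral operator with kernel `G̃_t`. -/
def opG {T : ℝ} (ϱ : ℝ) (G : L2 T) (t : Time T) : L2 T →L[ℝ] L2 T :=
  integralOp (tildeGFrom ϱ G t) (measurable_tildeGFrom ϱ G t) (memLp_tildeGFrom ϱ G t)

/-- The integral operator with kernel `1_t`. -/
def opOne {T : ℝ} (t : Time T) : L2 T →L[ℝ] L2 T :=
  integralOp (oneKer t) (measurable_oneKer t) (memLp_oneKer t)

/-- The adjoint `1_t^*`. -/
def opOneAdj {T : ℝ} (t : Time T) : L2 T →L[ℝ] L2 T :=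
  ContinuousLinearMap.adjoint (opOne t)

/-- `D_t = 2λ id + (G̃_t + G̃_t^*) + 2φ 1_t^* 1_t`, for the model `θ = (λ, G)`. -/
def opD {T : ℝ} (φ ϱ : ℝ) (θ : ℝ × L2 T) (t : Time T) : L2 T →L[ℝ] L2 T :=
  (2 * θ.1) • ContinuousLinearMap.id ℝ (L2 T)
    + (opG ϱ θ.2 t + ContinuousLinearMap.adjoint (opG ϱ θ.2 t))
    + (2 * φ) • (opOneAdj t ∘L opOne t)

/-- `D_t⁻¹` (the zero operator if `D_t` is not invertible). -/
def opDinv {T : ℝ} (φ ϱ : ℝ) (θ : ℝ × L2 T) (t : Time T) : L2 T →L[ℝ] L2 T :=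
  (opD φ ϱ θ t).inverse

/-- `Γ_t⁻¹` as a block operator; `L²([0,T], ℝ²)` is written as `L²([0,T]) × L²([0,T])`. -/
def gammaInv {T : ℝ} (φ ϱ : ℝ) (θ : ℝ × L2 T) (t : Time T) (f : L2 T × L2 T) : L2 T × L2 T :=
  (opDinv φ ϱ θ t f.1 - (2 * φ) • opDinv φ ϱ θ t (opOneAdj t f.2),
   -((2 * φ) • opOne t (opDinv φ ϱ θ t f.1)) - (2 * φ) • f.2
     + (4 * φ ^ 2) • opOne t (opDinv φ ϱ θ t (opOneAdj t f.2)))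

/-- The inner product of `L²([0,T], ℝ²)`. -/
def pairInner {T : ℝ} (f g : L2 T × L2 T) : ℝ := inner ℝ f.1 g.1 + inner ℝ f.2 g.2

/-- Multiplication of an element of `L²([0,T])` by `s ↦ 1_{s ≥ t}`. -/
def cut {T : ℝ} (t : Time T) (f : L2 T) : L2 T :=
  ((Lp.memLp f).indicator (measurableSet_Ici (a := t))).toLp

/-- The constant function `c` in `L²([0,T])`. -/
def constL2 {T : ℝ} (c : ℝ) : L2 T := (memLp_const c : MemLp (fun _ : Time T => c) 2 volume).toLp

/-- The function `s ↦ G̃(s,t)` in `L²([0,T])`. -/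
def tildeGCol {T : ℝ} (ϱ : ℝ) (G : L2 T) (t : Time T) : L2 T := (memLp_tildeG_col ϱ G t).toLp

/-- `K_t(s) = (G̃(s,t), -1_{s ≥ t})`. -/
def colK {T : ℝ} (ϱ : ℝ) (G : L2 T) (t : Time T) : L2 T × L2 T :=
  (tildeGCol ϱ G t, -cut t (constL2 1))

/-- The kernel
`B(t,s) = 1_{s<t} (2λ)⁻¹ (⟨Γ_t⁻¹ K_t, 1_t (G̃(·,s), -1)⟩ - G̃(t,s))`. -/
def kerB {T : ℝ} (φ ϱ : ℝ) (θ : ℝ × L2 T) (t s : Time T) : ℝ :=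
  if s < t then
    1 / (2 * θ.1) *
      (pairInner (gammaInv φ ϱ θ t (colK ϱ θ.2 t)) (cut t (tildeGCol ϱ θ.2 s), cut t (constL2 (-1)))
        - tildeG ϱ θ.2 t s)
  else 0

/-! ### The probabilistic setting -/

section Stochastic

variable {T : ℝ} {Ω : Type*} {mΩ : MeasurableSpace Ω}

/-- The usual conditions: right continuity, and every null set belongs to `𝓕 0`. -/
structure UsualConditions [Fact (0 < T)] (P : Measure Ω) (𝓕 : Filtration (Time T) mΩ) : Prop where
  rightContinuous : 𝓕.IsRightContinuous
  complete : ∀ N : Set Ω, P N = 0 → MeasurableSet[𝓕 ⊥] N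

/-- Right continuous with left limits. -/
def IsCadlagPath (x : Time T → ℝ) : Prop :=
  ∀ t, ContinuousWithinAt x (Set.Ici t) t ∧ ∃ l, Tendsto x (𝓝[<] t) (𝓝 l)

/-- `V` is the predictable quadratic variation `⟨M⟩` of the martingale `M`: the predictable càdlàg
increasing process with `V_0 = 0` such that `(M - M_0)² - V` is a martingale. -/
structure IsBracket [Fact (0 < T)] (P : Measure Ω) (𝓕 : Filtration (Time T) mΩ)
    (M V : Time T → Ω → ℝ) : Prop where
  predictable : IsStronglyPredictable 𝓕 V
  zero : ∀ᵐ ω ∂P, V ⊥ ω = 0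
  mono : ∀ᵐ ω ∂P, Monotone fun t => V t ω
  cadlag : ∀ᵐ ω ∂P, IsCadlagPath fun t => V t ω
  martingale : Martingale (fun t ω => (M t ω - M ⊥ ω) ^ 2 - V t ω) 𝓕 P

/-- The second moment `E[(∫_0^T |dA_s|)²]` of the total variation of `A`. -/
def totalVariationMoment (P : Measure Ω) (A : Time T → Ω → ℝ) : ℝ≥0∞ :=
  ∫⁻ ω, eVariationOn (fun t => A t ω) Set.univ ^ 2 ∂P

/-- The standing assumptions on the unaffected price `P = A + M`: `A` is a predictable signal of
finite variation, `M` is a martingale independent of `A` with `E[M_0] = 0`, and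
`E⟨M⟩_T + E[(∫|dA|)²] < ∞`. -/
structure IsPriceModel [Fact (0 < T)] (P : Measure Ω) (𝓕 : Filtration (Time T) mΩ)
    (A M : Time T → Ω → ℝ) : Prop where
  signal_predictable : IsStronglyPredictable 𝓕 A
  signal_cadlag : ∀ᵐ ω ∂P, IsCadlagPath fun t => A t ω
  signal_finiteVariation : ∀ᵐ ω ∂P, BoundedVariationOn (fun t => A t ω) Set.univ
  signal_initial : Integrable (A ⊥) P
  signal_moment : totalVariationMoment P A < ∞
  noise_martingale : Martingale M 𝓕 P
  noise_cadlag : ∀ᵐ ω ∂P, IsCadlagPath fun t => M t ω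
  noise_initial : ∫ ω, M ⊥ ω ∂P = 0
  noise_moment : ∃ V, IsBracket P 𝓕 M V ∧ Integrable (V ⊤) P
  independent : IndepFun (fun ω t => A t ω) (fun ω t => M t ω) P

/-- The admissible strategies: progressively measurable with `E[∫_0^T u_s² ds] < ∞`. -/
def Admissible (P : Measure Ω) (𝓕 : Filtration (Time T) mΩ) (u : Time T → Ω → ℝ) : Prop :=
  IsProgressive 𝓕 u ∧ ∫⁻ ω, (∫⁻ t, ‖u t ω‖ₑ ^ 2) ∂P < ∞

/-! ### The objective functional -/

/-- The inventory `Q_t = q - ∫_0^t u_s ds`. -/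
def inventory (q : ℝ) (u : Time T → Ω → ℝ) (t : Time T) (ω : Ω) : ℝ :=
  q - ∫ s in Set.Iic t, u s ω

/-- The transient impact `Z_t = ∫_0^t G(t-s) u_s ds`. -/
def transientImpact (G : L2 T) (u : Time T → Ω → ℝ) (t : Time T) (ω : Ω) : ℝ :=
  ∫ s in Set.Iic t, G (gap t s) * u s ω

/-- The execution price `S_t = A_t + M_t - λ u_t - Z_t`. -/
def executionPrice (A M : Time T → Ω → ℝ) (θ : ℝ × L2 T) (u : Time T → Ω → ℝ)
    (t : Time T) (ω : Ω) : ℝ :=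
  A t ω + M t ω - θ.1 * u t ω - transientImpact θ.2 u t ω

/-- The risk-revenue functional
`J^θ(u) = E[∫ S_t u_t dt + Q_T P_T - φ ∫ Q_t² dt - ϱ Q_T²]`. -/
def objective [Fact (0 < T)] (P : Measure Ω) (A M : Time T → Ω → ℝ) (φ ϱ q : ℝ)
    (θ : ℝ × L2 T) (u : Time T → Ω → ℝ) : ℝ :=
  ∫ ω, ((∫ t, executionPrice A M θ u t ω * u t ω)
    + inventory q u ⊤ ω * (A ⊤ ω + M ⊤ ω)
    - φ * (∫ t, inventory q u t ω ^ 2)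
    - ϱ * inventory q u ⊤ ω ^ 2) ∂P

/-! ### The greedy control -/

/-- `E[A_· - A_T | 𝓕_t]`, the conditional expectation of the `L²([0,T])`-valued random variable
`A_· - A_T`. -/
def condSignal [Fact (0 < T)] (P : Measure Ω) (𝓕 : Filtration (Time T) mΩ)
    (A : Time T → Ω → ℝ) (t : Time T) : Ω → L2 T :=
  P[fun ω => toL2 fun s => A s ω - A ⊤ ω | 𝓕 t]

/-- `Θ_t = -Γ_t⁻¹ (1_t E[A_· - A_T | 𝓕_t] e₁)`. -/
def processTheta [Fact (0 < T)] (P : Measure Ω) (𝓕 : Filtration (Time T) mΩ)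
    (A : Time T → Ω → ℝ) (φ ϱ : ℝ) (θ : ℝ × L2 T) (t : Time T) (ω : Ω) : L2 T × L2 T :=
  -gammaInv φ ϱ θ t (cut t (condSignal P 𝓕 A t ω), 0)

/-- `a_t = (2λ)⁻¹ (E[A_t - A_T | 𝓕_t] + 2ϱq + ⟨Θ_t, K_t⟩ + ⟨Γ_t⁻¹ K_t, 1_t (-2ϱq, q)⟩)`. -/
def processA [Fact (0 < T)] (P : Measure Ω) (𝓕 : Filtration (Time T) mΩ)
    (A : Time T → Ω → ℝ) (φ ϱ q : ℝ) (θ : ℝ × L2 T) (t : Time T) (ω : Ω) : ℝ :=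
  1 / (2 * θ.1) *
    ((P[fun ω' => A t ω' - A ⊤ ω' | 𝓕 t]) ω + 2 * ϱ * q
      + pairInner (processTheta P 𝓕 A φ ϱ θ t ω) (colK ϱ θ.2 t)
      + pairInner (gammaInv φ ϱ θ t (colK ϱ θ.2 t))
          (cut t (constL2 (-(2 * ϱ * q))), cut t (constL2 q)))

/-- `u` is (a version of) the greedy control `u^θ`: an admissible strategy that solves the Volterra
equation `u_t = a_t + ∫_0^t B(t,s) u_s ds`. -/
def IsGreedy [Fact (0 < T)] (P : Measure Ω) (𝓕 : Filtration (Time T) mΩ)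
    (A : Time T → Ω → ℝ) (φ ϱ q : ℝ) (θ : ℝ × L2 T) (u : Time T → Ω → ℝ) : Prop :=
  Admissible P 𝓕 u ∧ ∀ᵐ t : Time T, ∀ᵐ ω ∂P,
    u t ω = processA P 𝓕 A φ ϱ q θ t ω + ∫ s in Set.Iic t, kerB φ ϱ θ t s * u s ω

end Stochastic

/-! ### The class of admissible models -/

/-- The quadratic form `∫∫ G(|t-s|) f(s) f(t) ds dt`. -/
def kernelForm {T : ℝ} (G f : L2 T) : ℝ := ∫ t, ∫ s, G (gap t s) * f s * f t

/-- The class `Ξ_ε` of admissible models `(λ, G)`. -/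
def admissibleModels (T L ε : ℝ) : Set (ℝ × L2 T) :=
  {θ | L⁻¹ ≤ θ.1 ∧ θ.1 ≤ L ∧ ‖θ.2‖ ≤ L ∧ ∀ f : L2 T, -ε * ‖f‖ ^ 2 ≤ kernelForm θ.2 f}

/-- The assumptions on the true model `(λ⋆, G⋆)`: `L⁻¹ < λ⋆ < L`, `‖G⋆‖ < L`, and `G⋆` is a
non-negative definite kernel. -/
def IsTrueModel {T : ℝ} (L : ℝ) (θ : ℝ × L2 T) : Prop :=
  0 < θ.1 ∧ L⁻¹ < θ.1 ∧ θ.1 < L ∧ ‖θ.2‖ < L ∧ ∀ f : L2 T, 0 ≤ kernelForm θ.2 f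

end

end Propagator

namespace Propagator

noncomputable section

set_option linter.unusedSectionVars false

/-! ### Indicator truncation and integral operators on `L²([0,T])` -/

section Deterministic

variable {T : ℝ}

/-! For models in the class, the objective is a strictly concave quadratic functional on a Hilbert
space, and the greedy control is its maximizer in disguise. Pathwise (`path_objective_eq`) the
payoff of `u` is `⟨M - M_T, u⟩ + ⟨ℓ, u⟩ - ½⟨D_0 u, u⟩` plus a random variable free of `u` and `θ`,
where `ℓ = (A - A_T) + linGain`. The noise term has mean zero, because `E[M_t - M_T | 𝓕_t] = 0` and
`u_t` is known at time `t` (`exists_noise`). So the model enters only through `D_0`, which is affine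
in `(λ, G)`, and the lower bounds on `λ` and on the kernel form make every `D_t` at least `L⁻¹`
(`opD_coercive`).

By Lax–Milgram on the space of progressive strategies there is a strategy whose gradient `ℓ - D_0 u`
is orthogonal to all strategies (`exists_isWeakSol`). It is greedy: testing with strategies that
start at `t` on an event of `𝓕_t` shows that the gradient on `[t,T]` has zero conditional
expectation given `𝓕_t`. With `m = E[u | 𝓕_t]`, whose past is that of `u`, this is a linear equation
for the future of `m` with operator `D_t`. The gradient condition at the single time `t` involves
this future only through one linear functional; eliminating it with `D_t⁻¹` leaves exactly the
feedback formula (`greedy_of_firstOrder`). The single-time condition comes from forward averages,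
which are again tests that start at `t` (`ae_setIntegral_eq_zero`).

Conversely, the feedback equation is a Volterra equation whose functional is bounded by the `L²`
norm of the past, uniformly in `t`, so a Gronwall argument gives uniqueness (`IsGreedy.unique`).
Every greedy control therefore satisfies the weak first order condition (`IsGreedy.isWeakSol`).

The regret bound is then a fact about two quadratic problems with the same linear term
(`abs_quadratic_regret_le`). At a maximizer the gradient vanishes, so the loss is half the quadratic
form at the difference of the two solutions. That difference is linear in the perturbation `D_0^{θ⋆}
- D_0^θ`, whose norm is controlled by `|λ⋆ - λ|` and `‖G⋆ - G‖`. Hence the loss is of second order.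
-/

theorem inner_L2 (f g : L2 T) : inner ℝ f g = ∫ s, f s * g s := by
  rw [L2.inner_def]
  refine integral_congr_ae (Eventually.of_forall fun s => ?_)
  simp [mul_comm]

theorem integrable_mul_L2 (f g : L2 T) : Integrable fun s => f s * g s :=
  (Lp.memLp f).integrable_mul (Lp.memLp g)

theorem norm_sq_L2 (f : L2 T) : ‖f‖ ^ 2 = ∫ s, f s ^ 2 := by
  rw [← real_inner_self_eq_norm_sq, inner_L2]
  simp only [sq]

theorem coeFn_cut (t : Time T) (f : L2 T) : cut t f =ᵐ[volume] (Set.Ici t).indicator f :=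
  MemLp.coeFn_toLp _

/-- `cut t` as a continuous linear map. -/
def cutL (t : Time T) : L2 T →L[ℝ] L2 T :=
  LinearMap.mkContinuous
    { toFun := cut t
      map_add' := fun f g => by
        refine Lp.ext ?_
        filter_upwards [coeFn_cut t (f + g), coeFn_cut t f, coeFn_cut t g, Lp.coeFn_add f g,
          Lp.coeFn_add (cut t f) (cut t g)] with s h1 h2 h3 h4 h5
        rw [h1, h5, Pi.add_apply, h2, h3]
        by_cases hs : s ∈ Set.Ici t
        · simp only [Set.indicator_of_mem hs, h4, Pi.add_apply]
        · simp only [Set.indicator_of_notMem hs, add_zero]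
      map_smul' := fun c f => by
        refine Lp.ext ?_
        filter_upwards [coeFn_cut t (c • f), coeFn_cut t f, Lp.coeFn_smul c f,
          Lp.coeFn_smul c (cut t f)] with s h1 h2 h3 h4
        rw [RingHom.id_apply, h1, h4, Pi.smul_apply, h2]
        by_cases hs : s ∈ Set.Ici t
        · simp only [Set.indicator_of_mem hs, h3, Pi.smul_apply]
        · simp only [Set.indicator_of_notMem hs, smul_zero] }
    1 fun f => by
      rw [one_mul]
      refine Lp.norm_le_norm_of_ae_le ?_
      filter_upwards [coeFn_cut t f] with s hs
      exact (congrArg norm hs).trans_le (norm_indicator_le_norm_self _ _)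

@[simp] theorem cutL_apply (t : Time T) (f : L2 T) : cutL t f = cut t f := rfl

theorem norm_cut_le (t : Time T) (f : L2 T) : ‖cut t f‖ ≤ ‖f‖ := by
  have h := (cutL t).le_of_opNorm_le (LinearMap.mkContinuous_norm_le _ zero_le_one _) f
  simpa using h

theorem cut_cut (t : Time T) (f : L2 T) : cut t (cut t f) = cut t f := by
  refine Lp.ext ?_
  filter_upwards [coeFn_cut t (cut t f), coeFn_cut t f] with s h1 h2
  rw [h1, h2]
  by_cases hs : s ∈ Set.Ici t
  · simp only [Set.indicator_of_mem hs, h2]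
  · simp only [Set.indicator_of_notMem hs]

theorem inner_cut_left (t : Time T) (f g : L2 T) : inner ℝ (cut t f) g = inner ℝ f (cut t g) := by
  rw [inner_L2, inner_L2]
  refine integral_congr_ae ?_
  filter_upwards [coeFn_cut t f, coeFn_cut t g] with s h1 h2
  rw [h1, h2]
  by_cases hs : s ∈ Set.Ici t
  · simp only [Set.indicator_of_mem hs]
  · simp only [Set.indicator_of_notMem hs, zero_mul, mul_zero]

/-! #### Integral operators -/

theorem coeFn_integralOp (k : Time T → Time T → ℝ) (hk : Measurable (Function.uncurry k))
    (hk2 : MemLp (Function.uncurry k) 2 (volume.prod volume)) (f : L2 T) :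
    integralOp k hk hk2 f =ᵐ[volume] fun s => ∫ u, k s u * f u :=
  MemLp.coeFn_toLp (memLp_kernel k hk hk2 f)

theorem memLp_tensor (f g : L2 T) :
    MemLp (fun p : Time T × Time T => f p.1 * g p.2) 2 (volume.prod volume) := by
  have hm : AEStronglyMeasurable (fun p : Time T × Time T => f p.1 * g p.2)
      (volume.prod volume) :=
    ((Lp.stronglyMeasurable f).measurable.comp measurable_fst).mul
      ((Lp.stronglyMeasurable g).measurable.comp measurable_snd) |>.aestronglyMeasurable
  rw [memLp_two_iff_integrable_sq hm]
  have := (Lp.memLp f).integrable_sq.mul_prod (Lp.memLp g).integrable_sq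
  simpa only [mul_pow] using this

theorem integrable_kernel_tensor (k : Time T → Time T → ℝ)
    (hk2 : MemLp (Function.uncurry k) 2 (volume.prod volume)) (f g : L2 T) :
    Integrable (fun p : Time T × Time T => k p.1 p.2 * g p.2 * f p.1) (volume.prod volume) := by
  have := hk2.integrable_mul (memLp_tensor f g)
  refine this.congr (Eventually.of_forall fun p => ?_)
  simp only [Pi.mul_apply, Function.uncurry]
  ring

theorem inner_integralOp (k : Time T → Time T → ℝ) (hk : Measurable (Function.uncurry k))
    (hk2 : MemLp (Function.uncurry k) 2 (volume.prod volume)) (f g : L2 T) :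
    inner ℝ (integralOp k hk hk2 f) g = ∫ p : Time T × Time T, k p.1 p.2 * f p.2 * g p.1
      ∂(volume.prod volume) := by
  rw [inner_L2, integral_prod _ (integrable_kernel_tensor k hk2 g f)]
  refine integral_congr_ae ?_
  filter_upwards [coeFn_integralOp k hk hk2 f] with s hs
  rw [hs, integral_mul_const]

theorem measurable_swap_kernel (k : Time T → Time T → ℝ)
    (hk : Measurable (Function.uncurry k)) : Measurable (Function.uncurry fun s u => k u s) :=
  hk.comp measurable_swap

theorem memLp_swap_kernel (k : Time T → Time T → ℝ)
    (hk2 : MemLp (Function.uncurry k) 2 (volume.prod volume)) :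
    MemLp (Function.uncurry fun s u => k u s) 2 (volume.prod volume) :=
  hk2.comp_measurePreserving Measure.measurePreserving_swap

theorem adjoint_integralOp (k : Time T → Time T → ℝ) (hk : Measurable (Function.uncurry k))
    (hk2 : MemLp (Function.uncurry k) 2 (volume.prod volume)) :
    ContinuousLinearMap.adjoint (integralOp k hk hk2)
      = integralOp (fun s u => k u s) (measurable_swap_kernel k hk) (memLp_swap_kernel k hk2) := by
  refine ((ContinuousLinearMap.eq_adjoint_iff _ _).2 fun f g => ?_).symm
  rw [real_inner_comm (integralOp k hk hk2 g), inner_integralOp, inner_integralOp,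
    ← integral_prod_swap]
  refine integral_congr_ae (Eventually.of_forall fun p => ?_)
  simp only [Prod.fst_swap, Prod.snd_swap]
  ring

end Deterministic

/-! ### Rows and columns of the impact kernel; reduction to the initial time -/

section Deterministic

variable {T : ℝ}

instance instNullSingletonTime : NullSingletonClass (volume : Measure (Time T)) := by
  refine ⟨fun x => ?_⟩
  change Measure.comap Subtype.val (volume : Measure ℝ) {x} = 0
  rw [comap_subtype_coe_apply measurableSet_Icc]
  simp

/-- Needed because `tildeG` vanishes on the diagonal in both orders of its arguments, so its
symmetrisation is `2ϱ + G(|t-s|)` only off the diagonal. -/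
theorem ae_ne_diagonal : ∀ᵐ p : Time T × Time T ∂(volume.prod volume), p.1 ≠ p.2 := by
  have hm : MeasurableSet {p : Time T × Time T | p.1 = p.2} :=
    measurableSet_eq_fun measurable_fst measurable_snd
  rw [ae_iff]
  simp only [not_not]
  rw [Measure.measure_prod_null hm]
  refine Eventually.of_forall fun x => ?_
  have : Prod.mk x ⁻¹' {p : Time T × Time T | p.1 = p.2} = {x} := by
    ext y; simp [eq_comm]
  simp [this]

theorem gap_comm (t s : Time T) : gap t s = gap s t := Subtype.ext (abs_sub_comm _ _)

theorem coeFn_constL2 (c : ℝ) : (constL2 c : L2 T) =ᵐ[volume] fun _ => c :=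
  MemLp.coeFn_toLp _

theorem constL2_eq (c : ℝ) : (constL2 c : L2 T) = c • constL2 1 := by
  refine Lp.ext ?_
  filter_upwards [coeFn_constL2 (T := T) c, coeFn_constL2 (T := T) 1,
    Lp.coeFn_smul c (constL2 1 : L2 T)] with s h1 h2 h3
  rw [h1, h3, Pi.smul_apply, h2, smul_eq_mul, mul_one]

theorem coeFn_tildeGCol (ϱ : ℝ) (G : L2 T) (t : Time T) :
    tildeGCol ϱ G t =ᵐ[volume] fun s => tildeG ϱ G s t := MemLp.coeFn_toLp _

/-- After extension by zero to the real line, `s ↦ t - s` is a reflection and preserves Lebesgue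
measure. This serves the rows of the kernel as `lintegral_gap_le` serves its columns. -/
theorem lintegral_gap_Iio_le (g : Time T → ℝ≥0∞) (hg : Measurable g) (t : Time T) :
    ∫⁻ s in Set.Iio t, g (gap t s) ≤ ∫⁻ s, g s := by
  classical
  let e : ℝ → ℝ≥0∞ := fun x => if h : x ∈ Set.Icc (0 : ℝ) T then g ⟨x, h⟩ else 0
  have he : Measurable e := Measurable.dite (by exact hg) measurable_const measurableSet_Icc
  have h1 : ∫⁻ s, g s ∂(volume : Measure (Time T)) = ∫⁻ x, e x := by
    have : ∀ s : Time T, g s = e (s : ℝ) := fun s => by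
      simp only [e, dif_pos s.2]
    simp_rw [this]
    rw [show (volume : Measure (Time T)) = Measure.comap Subtype.val volume from rfl,
      lintegral_subtype_comap measurableSet_Icc, ← lintegral_indicator measurableSet_Icc]
    refine lintegral_congr fun x => ?_
    by_cases hx : x ∈ Set.Icc (0 : ℝ) T
    · simp [hx]
    · simp only [Set.indicator_of_notMem hx, e, dif_neg hx]
  have h2 : ∀ s ∈ Set.Iio t, g (gap t s) = e ((t : ℝ) - s) := fun s hs => by
    have h : |(t : ℝ) - s| = t - s := abs_of_nonneg (sub_nonneg.2 (le_of_lt hs))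
    have hm : (t : ℝ) - s ∈ Set.Icc (0 : ℝ) T := by rw [← h]; exact (gap t s).2
    simp only [e, dif_pos hm]
    exact congrArg g (Subtype.ext h)
  calc ∫⁻ s in Set.Iio t, g (gap t s) = ∫⁻ s in Set.Iio t, e ((t : ℝ) - s) :=
        setLIntegral_congr_fun measurableSet_Iio h2
    _ ≤ ∫⁻ s : Time T, e ((t : ℝ) - s) := setLIntegral_le_lintegral _ _
    _ = ∫⁻ x in Set.Icc (0 : ℝ) T, e (t - x) := by
        rw [show (volume : Measure (Time T)) = Measure.comap Subtype.val volume from rfl,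
          lintegral_subtype_comap measurableSet_Icc (fun x => e (t - x))]
    _ ≤ ∫⁻ x, e (t - x) := setLIntegral_le_lintegral _ _
    _ = ∫⁻ x, e x := lintegral_sub_left_eq_self e _
    _ = ∫⁻ s, g s := h1.symm

theorem lintegral_tildeG_row_le (ϱ : ℝ) (G : L2 T) (t : Time T) :
    ∫⁻ s, ‖tildeG ϱ G t s‖ₑ ^ (2 : ℝ) ≤ ∫⁻ s : Time T, ‖2 * ϱ + G s‖ₑ ^ (2 : ℝ) := by
  refine le_trans (le_of_eq ?_)
    (lintegral_gap_Iio_le (fun s => ‖2 * ϱ + G s‖ₑ ^ (2 : ℝ)) ?_ t)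
  · rw [← lintegral_indicator measurableSet_Iio]
    refine lintegral_congr fun s => ?_
    by_cases h : s < t
    · simp [tildeG, h]
    · simp [tildeG, h]
  · have := (Lp.stronglyMeasurable G).measurable
    fun_prop

theorem memLp_tildeG_row (ϱ : ℝ) (G : L2 T) (t : Time T) :
    MemLp (fun s => tildeG ϱ G t s) 2 volume :=
  memLp_two_iff.2 ⟨(measurable_tildeG ϱ G).of_uncurry_left.aestronglyMeasurable,
    (lintegral_tildeG_row_le ϱ G t).trans_lt (lintegral_const_add_lt_top ϱ G)⟩

/-- The function `s ↦ G̃(t,s)` in `L²([0,T])`. -/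
def tildeGRow (ϱ : ℝ) (G : L2 T) (t : Time T) : L2 T := (memLp_tildeG_row ϱ G t).toLp

theorem coeFn_tildeGRow (ϱ : ℝ) (G : L2 T) (t : Time T) :
    tildeGRow ϱ G t =ᵐ[volume] fun s => tildeG ϱ G t s := MemLp.coeFn_toLp _

theorem norm_toLp_le_of_lintegral_le {f g : Time T → ℝ} (hf : MemLp f 2 volume)
    (hg : MemLp g 2 volume)
    (h : ∫⁻ s, ‖f s‖ₑ ^ (2 : ℝ) ≤ ∫⁻ s, ‖g s‖ₑ ^ (2 : ℝ)) : ‖hf.toLp‖ ≤ ‖hg.toLp‖ := by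
  rw [Lp.norm_toLp, Lp.norm_toLp]
  refine ENNReal.toReal_mono hg.2.ne ?_
  simp only [eLpNorm_eq_lintegral_rpow_enorm_toReal (p := 2) (by norm_num) (by norm_num),
    ENNReal.toReal_ofNat]
  exact ENNReal.rpow_le_rpow h (by norm_num)

theorem const_add_toLp (ϱ : ℝ) (G : L2 T) :
    ((memLp_const (2 * ϱ)).add (Lp.memLp G) : MemLp _ 2 (volume : Measure (Time T))).toLp
      = (2 * ϱ) • constL2 1 + G := by
  rw [MemLp.toLp_add (memLp_const _) (Lp.memLp G), Lp.toLp_coeFn G (Lp.memLp G), ← constL2_eq,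
    constL2]

theorem norm_tildeGCol_le (ϱ : ℝ) (G : L2 T) (t : Time T) :
    ‖tildeGCol ϱ G t‖ ≤ ‖(2 * ϱ) • constL2 1 + G‖ := by
  rw [← const_add_toLp]
  exact norm_toLp_le_of_lintegral_le _ _ (lintegral_tildeG_le ϱ G t)

/-- The point is uniformity in `t`: it gives the Volterra functional one bound for all times. -/
theorem norm_tildeGRow_le (ϱ : ℝ) (G : L2 T) (t : Time T) :
    ‖tildeGRow ϱ G t‖ ≤ ‖(2 * ϱ) • constL2 1 + G‖ := by
  rw [← const_add_toLp]
  exact norm_toLp_le_of_lintegral_le _ _ (lintegral_tildeG_row_le ϱ G t)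

theorem cut_tildeGCol (ϱ : ℝ) (G : L2 T) (t : Time T) :
    cut t (tildeGCol ϱ G t) = tildeGCol ϱ G t := by
  refine Lp.ext ?_
  filter_upwards [coeFn_cut t (tildeGCol ϱ G t), coeFn_tildeGCol ϱ G t] with s h1 h2
  rw [h1, Set.indicator_apply]
  split_ifs with h
  · rfl
  · have : ¬ t < s := fun h' => h h'.le
    rw [h2, tildeG, if_neg this]

/-- A row of the kernel is supported before `t`, so pairing with it only sees the part of a path
known at time `t`. -/
theorem cut_tildeGRow (ϱ : ℝ) (G : L2 T) (t : Time T) :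
    cut t (tildeGRow ϱ G t) = 0 := by
  refine Lp.ext ?_
  filter_upwards [coeFn_cut t (tildeGRow ϱ G t), coeFn_tildeGRow ϱ G t,
    Lp.coeFn_zero ℝ 2 (volume : Measure (Time T))] with s h1 h2 h3
  rw [h1, h3, Set.indicator_apply]
  split_ifs with h
  · have : ¬ s < t := not_lt.2 h
    rw [h2, tildeG, if_neg this]; rfl
  · rfl

/-! #### The operators `G̃_t` and `1_t` -/

theorem coeFn_opG (ϱ : ℝ) (G : L2 T) (t : Time T) (f : L2 T) :
    opG ϱ G t f =ᵐ[volume] fun s => ∫ u, tildeGFrom ϱ G t s u * f u :=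
  coeFn_integralOp _ _ _ f

theorem coeFn_opOne (t : Time T) (f : L2 T) :
    opOne t f =ᵐ[volume] fun s => ∫ u, oneKer t s u * f u :=
  coeFn_integralOp _ _ _ f

theorem cut_opG (ϱ : ℝ) (G : L2 T) (t : Time T) (f : L2 T) :
    cut t (opG ϱ G t f) = opG ϱ G t f := by
  refine Lp.ext ?_
  filter_upwards [coeFn_cut t (opG ϱ G t f), coeFn_opG ϱ G t f] with s h1 h2
  rw [h1, Set.indicator_apply]
  split_ifs with h
  · rfl
  · rw [h2, eq_comm]
    refine integral_eq_zero_of_ae (Eventually.of_forall fun u => ?_)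
    have hs : s < t := not_le.1 h
    simp only [tildeGFrom, tildeG, Pi.zero_apply]
    split_ifs with h3 h4
    · exact absurd (hs.trans_le h3) h4.not_gt
    · simp
    · simp

theorem cut_opOne (t : Time T) (f : L2 T) : cut t (opOne t f) = opOne t f := by
  refine Lp.ext ?_
  filter_upwards [coeFn_cut t (opOne t f), coeFn_opOne t f] with s h1 h2
  rw [h1, Set.indicator_apply]
  split_ifs with h
  · rfl
  · rw [h2, eq_comm]
    refine integral_eq_zero_of_ae (Eventually.of_forall fun u => ?_)
    have hs : s < t := not_le.1 h
    simp only [oneKer, Pi.zero_apply]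
    rw [if_neg, zero_mul]
    exact fun h3 => (h3.1.trans h3.2).not_gt hs

section Bot

variable [Fact (0 < T)]

@[simp] theorem tildeGFrom_bot (ϱ : ℝ) (G : L2 T) (s u : Time T) :
    tildeGFrom ϱ G ⊥ s u = tildeG ϱ G s u := by simp [tildeGFrom]

theorem oneKer_bot (s u : Time T) : oneKer ⊥ s u = if u ≤ s then 1 else 0 := by simp [oneKer]

/-- Restricting the kernel to `u ≥ t` amounts to erasing the past of the argument. With this all
operators at time `t` are expressed through those at time zero. -/
theorem opG_eq_opG_bot_cut (ϱ : ℝ) (G : L2 T) (t : Time T) (f : L2 T) :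
    opG ϱ G t f = opG ϱ G ⊥ (cut t f) := by
  refine Lp.ext ?_
  filter_upwards [coeFn_opG ϱ G t f, coeFn_opG ϱ G ⊥ (cut t f)] with s h1 h2
  rw [h1, h2]
  refine integral_congr_ae ?_
  filter_upwards [coeFn_cut t f] with u hu
  rw [hu, tildeGFrom_bot, tildeGFrom, Set.indicator_apply]
  by_cases h : t ≤ u <;> simp [h]

theorem opOne_eq_opOne_bot_cut (t : Time T) (f : L2 T) :
    opOne t f = opOne ⊥ (cut t f) := by
  refine Lp.ext ?_
  filter_upwards [coeFn_opOne t f, coeFn_opOne ⊥ (cut t f)] with s h1 h2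
  rw [h1, h2]
  refine integral_congr_ae ?_
  filter_upwards [coeFn_cut t f] with u hu
  rw [hu, oneKer_bot, oneKer, Set.indicator_apply]
  by_cases h : t ≤ u <;> simp [h]

/-- The contribution of the strategy before `t` to the inventory after `t`. -/
theorem cut_opOne_bot_of_cut_eq_zero (t : Time T) (y : L2 T) (hy : cut t y = 0) :
    cut t (opOne ⊥ y) = (inner ℝ y (constL2 1)) • cut t (constL2 1) := by
  refine Lp.ext ?_
  have h0 : ∀ᵐ u : Time T, (Set.Ici t).indicator y u = 0 := by
    filter_upwards [coeFn_cut t y, Lp.coeFn_zero ℝ 2 (volume : Measure (Time T))] with u h1 h2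
    rw [← h1, hy, h2]; rfl
  filter_upwards [coeFn_cut t (opOne ⊥ y), coeFn_opOne ⊥ y,
    Lp.coeFn_smul (inner ℝ y (constL2 1)) (cut t (constL2 1)), coeFn_cut t (constL2 1),
    coeFn_constL2 (T := T) 1] with s h1 h2 h3 h4 h5
  rw [h1, h3, Pi.smul_apply, h4, Set.indicator_apply, Set.indicator_apply, h2, h5]
  split_ifs with h
  · rw [inner_L2, smul_eq_mul, mul_one]
    refine integral_congr_ae ?_
    filter_upwards [h0, coeFn_constL2 (T := T) 1] with u hu hu1
    rw [oneKer_bot, hu1, mul_one]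
    split_ifs with hus
    · rw [one_mul]
    · rw [Set.indicator_of_mem (show u ∈ Set.Ici t from le_trans h (not_le.1 hus).le)] at hu
      rw [hu, mul_zero]
  · simp

theorem adjoint_opG_bot_coeFn (ϱ : ℝ) (G : L2 T) (f : L2 T) :
    ContinuousLinearMap.adjoint (opG ϱ G ⊥) f =ᵐ[volume] fun s => inner ℝ (tildeGCol ϱ G s) f := by
  rw [opG, adjoint_integralOp]
  filter_upwards [coeFn_integralOp _ (measurable_swap_kernel _ (measurable_tildeGFrom ϱ G ⊥))
    (memLp_swap_kernel _ (memLp_tildeGFrom ϱ G ⊥)) f] with s hs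
  rw [hs, inner_L2]
  refine integral_congr_ae ?_
  filter_upwards [coeFn_tildeGCol ϱ G s] with u hu
  rw [hu, tildeGFrom_bot]

theorem opG_bot_coeFn (ϱ : ℝ) (G : L2 T) (f : L2 T) :
    opG ϱ G ⊥ f =ᵐ[volume] fun s => inner ℝ (tildeGRow ϱ G s) f := by
  filter_upwards [coeFn_opG ϱ G ⊥ f] with s hs
  rw [hs, inner_L2]
  refine integral_congr_ae ?_
  filter_upwards [coeFn_tildeGRow ϱ G s] with u hu
  rw [hu, tildeGFrom_bot]

theorem opOneAdj_bot_coeFn (f : L2 T) :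
    opOneAdj ⊥ f =ᵐ[volume] fun s => inner ℝ (cut s (constL2 1)) f := by
  rw [opOneAdj, opOne, adjoint_integralOp]
  filter_upwards [coeFn_integralOp _ (measurable_swap_kernel _ (measurable_oneKer ⊥))
    (memLp_swap_kernel _ (memLp_oneKer ⊥)) f] with s hs
  rw [hs, inner_L2]
  refine integral_congr_ae ?_
  filter_upwards [coeFn_cut s (constL2 1), coeFn_constL2 (T := T) 1] with u h1 h2
  rw [h1, oneKer_bot, Set.indicator_apply, h2]
  rfl

end Bot

end Deterministic

/-! ### Symmetrisation, coercivity, inversion and causality of `D_t` -/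

section Deterministic

variable {T : ℝ} [Fact (0 < T)]

/-! #### Symmetrisation and coercivity -/

theorem integrable_tildeG_tensor (ϱ : ℝ) (G f : L2 T) :
    Integrable (fun p : Time T × Time T => tildeG ϱ G p.1 p.2 * f p.2 * f p.1)
      (volume.prod volume) := by
  have h := integrable_kernel_tensor _ (memLp_tildeGFrom ϱ G ⊥) f f
  simpa only [tildeGFrom_bot] using h

theorem tildeG_add_swap (ϱ : ℝ) (G : L2 T) {t s : Time T} (h : t ≠ s) :
    tildeG ϱ G t s + tildeG ϱ G s t = 2 * ϱ + G (gap t s) := by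
  rcases lt_or_gt_of_ne h with h | h
  · rw [tildeG, tildeG, if_neg h.not_gt, if_pos h, zero_add, gap_comm]
  · rw [tildeG, tildeG, if_neg h.not_gt, if_pos h, add_zero]

theorem ae_tildeG_tensor_swap (ϱ : ℝ) (G f : L2 T) :
    (fun p : Time T × Time T => tildeG ϱ G p.1 p.2 * f p.2 * f p.1
        + tildeG ϱ G p.2 p.1 * f p.1 * f p.2)
      =ᵐ[volume.prod volume]
        fun p => (2 * ϱ) * (f p.1 * f p.2) + G (gap p.1 p.2) * f p.2 * f p.1 := by
  filter_upwards [ae_ne_diagonal (T := T)] with p hp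
  linear_combination (f p.1 * f p.2) * tildeG_add_swap ϱ G hp

theorem integrable_gap_tensor (G f : L2 T) :
    Integrable (fun p : Time T × Time T => G (gap p.1 p.2) * f p.2 * f p.1)
      (volume.prod volume) := by
  refine ((integrable_tildeG_tensor 0 G f).add (integrable_tildeG_tensor 0 G f).swap).congr
    ((ae_tildeG_tensor_swap 0 G f).trans (Eventually.of_forall fun p => ?_))
  simp

/-- The quadratic form does not change when the kernel is replaced by its transpose; adding the two
gives the symmetric kernel `2ϱ + G(|t-s|)`, whose constant part is a squared mean. -/
theorem two_inner_opG_bot (ϱ : ℝ) (G f : L2 T) :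
    2 * inner ℝ (opG ϱ G ⊥ f) f = 2 * ϱ * (inner ℝ f (constL2 1)) ^ 2 + kernelForm G f := by
  have h1 : inner ℝ (opG ϱ G ⊥ f) f = ∫ p : Time T × Time T, tildeG ϱ G p.1 p.2 * f p.2 * f p.1
      ∂(volume.prod volume) := by
    rw [opG, inner_integralOp]
    simp only [tildeGFrom_bot]
  have h2 := integral_prod_swap (μ := (volume : Measure (Time T))) (ν := volume)
    (fun p : Time T × Time T => tildeG ϱ G p.1 p.2 * f p.2 * f p.1)
  have hi := integrable_tildeG_tensor ϱ G f
  have hff : Integrable (fun p : Time T × Time T => f p.1 * f p.2) (volume.prod volume) :=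
    ((Lp.memLp f).integrable (by norm_num)).mul_prod ((Lp.memLp f).integrable (by norm_num))
  have hone : inner ℝ f (constL2 1) = ∫ s, f s := by
    rw [inner_L2]
    refine integral_congr_ae ?_
    filter_upwards [coeFn_constL2 (T := T) 1] with s hs
    rw [hs, mul_one]
  rw [two_mul, h1]
  nth_rewrite 2 [← h2]
  refine (integral_add hi hi.swap).symm.trans ((integral_congr_ae (ae_tildeG_tensor_swap ϱ G f)).trans ?_)
  rw [integral_add (hff.const_mul _) (integrable_gap_tensor G f), integral_const_mul,
    integral_prod_mul, integral_prod _ (integrable_gap_tensor G f), hone, sq, kernelForm]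

/-- Both the input and the output of `opG` at time `t` live on `[t,T]`, so its form is the time-zero
form evaluated at the truncated function. -/
theorem inner_opD (φ ϱ : ℝ) (θ : ℝ × L2 T) (t : Time T) (f : L2 T) :
    inner ℝ (opD φ ϱ θ t f) f = 2 * θ.1 * ‖f‖ ^ 2
      + (2 * ϱ * (inner ℝ (cut t f) (constL2 1)) ^ 2 + kernelForm θ.2 (cut t f))
      + 2 * φ * ‖opOne t f‖ ^ 2 := by
  have h : inner ℝ (opG ϱ θ.2 t f) f = inner ℝ (opG ϱ θ.2 ⊥ (cut t f)) (cut t f) := by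
    rw [← cut_opG, inner_cut_left, opG_eq_opG_bot_cut]
  rw [← two_inner_opG_bot, ← h]
  simp only [opD, opOneAdj, add_apply, smul_apply,
    ContinuousLinearMap.id_apply, ContinuousLinearMap.comp_apply, inner_add_left,
    inner_smul_left, ContinuousLinearMap.adjoint_inner_left, real_inner_self_eq_norm_sq,
    RCLike.conj_to_real]
  rw [real_inner_comm]
  ring

/-- Terms with `ϱ` and `φ` are squares, and truncation does not increase norms, so at least `2λ - ε`
remains. Since `2λ ≥ 2L⁻¹` and `ε < L⁻¹/2`, this exceeds `L⁻¹`. -/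
theorem opD_coercive {φ ϱ L ε : ℝ} (hφ : 0 ≤ φ) (hϱ : 0 ≤ ϱ) (hε0 : 0 < ε) (hε : ε < L⁻¹ / 2)
    {θ : ℝ × L2 T} (hθ : θ ∈ admissibleModels T L ε) (t : Time T) (f : L2 T) :
    L⁻¹ * ‖f‖ ^ 2 ≤ inner ℝ (opD φ ϱ θ t f) f := by
  obtain ⟨h1, -, -, h4⟩ := hθ
  have h5 := h4 (cut t f)
  have h6 : ‖cut t f‖ ^ 2 ≤ ‖f‖ ^ 2 := pow_le_pow_left₀ (norm_nonneg _) (norm_cut_le t f) 2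
  rw [inner_opD]
  have h7 : 0 ≤ 2 * ϱ * (inner ℝ (cut t f) (constL2 1)) ^ 2 := by positivity
  have h8 : 0 ≤ 2 * φ * ‖opOne t f‖ ^ 2 := by positivity
  have h9 : ε * ‖cut t f‖ ^ 2 ≤ ε * ‖f‖ ^ 2 := mul_le_mul_of_nonneg_left h6 hε0.le
  have h10 : 0 ≤ (2 * θ.1 - ε - L⁻¹) * ‖f‖ ^ 2 := mul_nonneg (by linarith) (sq_nonneg _)
  linarith

theorem opD_isSymm (φ ϱ : ℝ) (θ : ℝ × L2 T) (t : Time T) (f g : L2 T) :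
    inner ℝ (opD φ ϱ θ t f) g = inner ℝ f (opD φ ϱ θ t g) := by
  simp only [opD, opOneAdj, add_apply, smul_apply,
    ContinuousLinearMap.id_apply, ContinuousLinearMap.comp_apply, inner_add_left, inner_add_right,
    inner_smul_left, inner_smul_right, ContinuousLinearMap.adjoint_inner_left,
    ContinuousLinearMap.adjoint_inner_right, RCLike.conj_to_real]
  ring

/-- Lax–Milgram, used twice: on `L²([0,T])` to invert `D_t`, and on the space of strategies to solve
the first order condition. -/
theorem exists_equiv_of_coercive {E : Type*} [NormedAddCommGroup E] [InnerProductSpace ℝ E]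
    [CompleteSpace E] (D : E →L[ℝ] E) {c : ℝ} (hc : 0 < c)
    (h : ∀ f, c * ‖f‖ ^ 2 ≤ inner ℝ (D f) f) : ∃ e : E ≃L[ℝ] E, (e : E →L[ℝ] E) = D := by
  let B : E →L[ℝ] E →L[ℝ] ℝ := (innerSL ℝ).comp D
  have hB : IsCoercive B := ⟨c, hc, fun u => by
    have := h u
    rw [sq, ← mul_assoc] at this
    exact this⟩
  refine ⟨hB.continuousLinearEquivOfBilin, ?_⟩
  ext v
  refine ext_inner_right ℝ fun w => ?_
  exact hB.continuousLinearEquivOfBilin_apply v w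

theorem norm_le_of_coercive {E : Type*} [NormedAddCommGroup E] [InnerProductSpace ℝ E]
    {x y : E} {c : ℝ} (hc : 0 < c) (h : c * ‖x‖ ^ 2 ≤ inner ℝ y x) : ‖x‖ ≤ c⁻¹ * ‖y‖ := by
  rcases (norm_nonneg x).eq_or_lt with h0 | h0
  · rw [← h0]; positivity
  · have h1 := h.trans (real_inner_le_norm y x)
    rw [sq, ← mul_assoc] at h1
    have h2 := le_of_mul_le_mul_right h1 h0
    rw [le_inv_mul_iff₀ hc]
    exact h2

section Inverse

variable {φ ϱ L ε : ℝ} {θ : ℝ × L2 T}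

/-- The operator `D_t` is boundedly invertible with inverse `opDinv`. -/
structure IsCoerciveModel (φ ϱ L : ℝ) (θ : ℝ × L2 T) : Prop where
  pos : 0 < L
  lambda_le : L⁻¹ ≤ θ.1
  coercive : ∀ (t : Time T) (f : L2 T), L⁻¹ * ‖f‖ ^ 2 ≤ inner ℝ (opD φ ϱ θ t f) f

theorem IsCoerciveModel.lambda_pos (h : IsCoerciveModel φ ϱ L θ) : 0 < θ.1 :=
  (inv_pos.2 h.pos).trans_le h.lambda_le

/-- Coercivity makes `opD` an equivalence, so `ContinuousLinearMap.inverse` does not return its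
default value zero. -/
theorem IsCoerciveModel.opDinv_opD (h : IsCoerciveModel φ ϱ L θ) (t : Time T) (f : L2 T) :
    opDinv φ ϱ θ t (opD φ ϱ θ t f) = f := by
  obtain ⟨e, he⟩ := exists_equiv_of_coercive _ (inv_pos.2 h.pos) (h.coercive t)
  rw [opDinv, ← he, ContinuousLinearMap.inverse_equiv]
  exact e.symm_apply_apply f

theorem IsCoerciveModel.opD_opDinv (h : IsCoerciveModel φ ϱ L θ) (t : Time T) (f : L2 T) :
    opD φ ϱ θ t (opDinv φ ϱ θ t f) = f := by
  obtain ⟨e, he⟩ := exists_equiv_of_coercive _ (inv_pos.2 h.pos) (h.coercive t)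
  rw [opDinv, ← he, ContinuousLinearMap.inverse_equiv]
  exact e.apply_symm_apply f

theorem IsCoerciveModel.norm_opDinv_le (h : IsCoerciveModel φ ϱ L θ) (t : Time T) (f : L2 T) :
    ‖opDinv φ ϱ θ t f‖ ≤ L * ‖f‖ := by
  have h1 := norm_le_of_coercive (inv_pos.2 h.pos) (h.coercive t (opDinv φ ϱ θ t f))
  rwa [h.opD_opDinv, inv_inv] at h1

theorem IsCoerciveModel.opDinv_isSymm (h : IsCoerciveModel φ ϱ L θ) (t : Time T) (f g : L2 T) :
    inner ℝ (opDinv φ ϱ θ t f) g = inner ℝ f (opDinv φ ϱ θ t g) := by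
  nth_rewrite 1 [← h.opD_opDinv t g]
  rw [← opD_isSymm, h.opD_opDinv]

end Inverse

/-! #### Causality -/

theorem opOneAdj_eq (t : Time T) (f : L2 T) : opOneAdj t f = cut t (opOneAdj ⊥ f) := by
  refine ext_inner_right ℝ fun g => ?_
  rw [inner_cut_left, opOneAdj, opOneAdj, ContinuousLinearMap.adjoint_inner_left,
    ContinuousLinearMap.adjoint_inner_left, opOne_eq_opOne_bot_cut]

theorem opOneAdj_cut (t : Time T) (f : L2 T) : opOneAdj t (cut t f) = opOneAdj t f := by
  refine ext_inner_right ℝ fun g => ?_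
  rw [opOneAdj, ContinuousLinearMap.adjoint_inner_left, ContinuousLinearMap.adjoint_inner_left,
    inner_cut_left, cut_opOne]

/-- Dual to `opG_eq_opG_bot_cut`: erasing the past before the operator becomes erasing it after the
adjoint. -/
theorem adjoint_opG_eq (ϱ : ℝ) (G : L2 T) (t : Time T) (f : L2 T) :
    ContinuousLinearMap.adjoint (opG ϱ G t) f
      = cut t (ContinuousLinearMap.adjoint (opG ϱ G ⊥) f) := by
  refine ext_inner_right ℝ fun g => ?_
  rw [inner_cut_left, ContinuousLinearMap.adjoint_inner_left,
    ContinuousLinearMap.adjoint_inner_left, opG_eq_opG_bot_cut]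

theorem adjoint_opG_cut (ϱ : ℝ) (G : L2 T) (t : Time T) (f : L2 T) :
    ContinuousLinearMap.adjoint (opG ϱ G t) (cut t f)
      = ContinuousLinearMap.adjoint (opG ϱ G t) f := by
  refine ext_inner_right ℝ fun g => ?_
  rw [ContinuousLinearMap.adjoint_inner_left, ContinuousLinearMap.adjoint_inner_left,
    inner_cut_left, cut_opG]

theorem opD_bot_apply (φ ϱ : ℝ) (θ : ℝ × L2 T) (f : L2 T) :
    opD φ ϱ θ ⊥ f = (2 * θ.1) • f
      + (opG ϱ θ.2 ⊥ f + ContinuousLinearMap.adjoint (opG ϱ θ.2 ⊥) f)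
      + (2 * φ) • opOneAdj ⊥ (opOne ⊥ f) := rfl

theorem opD_apply (φ ϱ : ℝ) (θ : ℝ × L2 T) (t : Time T) (f : L2 T) :
    opD φ ϱ θ t f = (2 * θ.1) • f
      + (opG ϱ θ.2 t f + ContinuousLinearMap.adjoint (opG ϱ θ.2 t) f)
      + (2 * φ) • opOneAdj t (opOne t f) := rfl

theorem cut_add (t : Time T) (f g : L2 T) : cut t (f + g) = cut t f + cut t g :=
  map_add (cutL t) f g

theorem cut_sub (t : Time T) (f g : L2 T) : cut t (f - g) = cut t f - cut t g :=
  map_sub (cutL t) f g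

theorem cut_smul (t : Time T) (c : ℝ) (f : L2 T) : cut t (c • f) = c • cut t f :=
  map_smul (cutL t) c f

theorem cut_sub_cut (t : Time T) (f : L2 T) : cut t (f - cut t f) = 0 := by
  rw [cut_sub, cut_cut, sub_self]

/-- The future part of `D_0` applied to a future strategy is `D_t`. -/
theorem cut_opD_bot_cut (φ ϱ : ℝ) (θ : ℝ × L2 T) (t : Time T) (f : L2 T) :
    cut t (opD φ ϱ θ ⊥ (cut t f)) = opD φ ϱ θ t (cut t f) := by
  rw [opD_bot_apply, opD_apply, cut_add, cut_add, cut_add, cut_smul, cut_smul, cut_cut,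
    ← adjoint_opG_eq, ← opG_eq_opG_bot_cut, cut_opG, ← opOneAdj_eq, ← opOne_eq_opOne_bot_cut,
    opG_eq_opG_bot_cut ϱ θ.2 t (cut t f), opOne_eq_opOne_bot_cut t (cut t f), cut_cut,
    ← opG_eq_opG_bot_cut, ← opOne_eq_opOne_bot_cut]

/-- The future part of `D_0` applied to a past strategy. -/
theorem cut_opD_bot_of_cut_eq_zero (φ ϱ : ℝ) (θ : ℝ × L2 T) (t : Time T) (y : L2 T)
    (hy : cut t y = 0) :
    cut t (opD φ ϱ θ ⊥ y) = cut t (opG ϱ θ.2 ⊥ y)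
      + (2 * φ * inner ℝ y (constL2 1)) • opOneAdj t (cut t (constL2 1)) := by
  -- The adjoint integrates over later times only, so a strategy that vanishes after `t` produces
  -- nothing after `t`.
  have h1 : cut t (ContinuousLinearMap.adjoint (opG ϱ θ.2 ⊥) y) = 0 := by
    rw [← adjoint_opG_eq, ← adjoint_opG_cut, hy, map_zero]
  have h2 : cut t (opOneAdj ⊥ (opOne ⊥ y))
      = (inner ℝ y (constL2 1)) • opOneAdj t (cut t (constL2 1)) := by
    rw [← opOneAdj_eq, ← opOneAdj_cut, cut_opOne_bot_of_cut_eq_zero t y hy, map_smul]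
  rw [opD_bot_apply, cut_add, cut_add, cut_add, cut_smul, cut_smul, hy, h1, h2, smul_zero,
    add_zero, zero_add, smul_smul]

end Deterministic

/-! ### The Volterra functional and the derivation of the feedback formula -/

section Deterministic

variable {T : ℝ} [Fact (0 < T)]

/-! #### The Volterra functional -/

/-- `κ_t = Γ_t⁻¹ K_t`. -/
def gain (φ ϱ : ℝ) (θ : ℝ × L2 T) (t : Time T) : L2 T × L2 T :=
  gammaInv φ ϱ θ t (colK ϱ θ.2 t)

/-- The functional `x ↦ ∫_0^t B(t,s) x_s ds`, written with bounded operators. -/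
def volterraFun (φ ϱ : ℝ) (θ : ℝ × L2 T) (t : Time T) (x : L2 T) : ℝ :=
  1 / (2 * θ.1) * (inner ℝ (gain φ ϱ θ t).1 (cut t (opG ϱ θ.2 ⊥ (x - cut t x)))
    - inner ℝ (gain φ ϱ θ t).2 (cut t (constL2 1)) * inner ℝ (x - cut t x) (constL2 1)
    - inner ℝ (tildeGRow ϱ θ.2 t) (x - cut t x))

/-- The pairing of the gain with the column `G̃(·,s)` is the value at `s` of the adjoint operator
applied to the gain. This turns the kernel `B(t,·)`, given entry by entry, into a bounded functional
of the past. -/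
theorem ae_kerB_mul (φ ϱ : ℝ) (θ : ℝ × L2 T) (t : Time T) (x : L2 T) :
    (fun s => kerB φ ϱ θ t s * x s) =ᵐ[volume] fun s => 1 / (2 * θ.1) *
      ((ContinuousLinearMap.adjoint (opG ϱ θ.2 ⊥) (cut t (gain φ ϱ θ t).1) s * (x - cut t x) s
        - inner ℝ (gain φ ϱ θ t).2 (cut t (constL2 1)) * ((x - cut t x) s * (constL2 1 : L2 T) s))
        - tildeGRow ϱ θ.2 t s * (x - cut t x) s) := by
  filter_upwards [adjoint_opG_bot_coeFn ϱ θ.2 (cut t (gain φ ϱ θ t).1), coeFn_cut t x,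
    Lp.coeFn_sub x (cut t x), coeFn_constL2 (T := T) 1, coeFn_tildeGRow ϱ θ.2 t]
    with s h1 h2 h3 h4 h5
  rw [h1, h3, Pi.sub_apply, h2, h4, h5, kerB, Set.indicator_apply]
  by_cases hs : s < t
  · have : s ∉ Set.Ici t := not_le.2 hs
    rw [if_pos hs, if_neg this, pairInner, gain, constL2_eq (-1), cut_smul, inner_smul_right,
      ← inner_cut_left, real_inner_comm (tildeGCol ϱ θ.2 s)]
    ring
  · have : s ∈ Set.Ici t := not_lt.1 hs
    rw [if_neg hs, if_pos this]
    ring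

theorem setIntegral_kerB (φ ϱ : ℝ) (θ : ℝ × L2 T) (t : Time T) (x : L2 T) :
    ∫ s in Set.Iic t, kerB φ ϱ θ t s * x s = volterraFun φ ϱ θ t x := by
  rw [setIntegral_eq_integral_of_forall_compl_eq_zero, integral_congr_ae (ae_kerB_mul φ ϱ θ t x),
    integral_const_mul, integral_sub, integral_sub, integral_const_mul, ← inner_L2, ← inner_L2,
    ← inner_L2, ContinuousLinearMap.adjoint_inner_left, inner_cut_left, volterraFun]
  · exact integrable_mul_L2 _ _
  · exact (integrable_mul_L2 _ _).const_mul _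
  · exact (integrable_mul_L2 _ _).sub ((integrable_mul_L2 _ _).const_mul _)
  · exact integrable_mul_L2 _ _
  · intro s hs
    have : ¬ s < t := fun h => hs h.le
    rw [kerB, if_neg this, zero_mul]

theorem toL2_of_memLp {f : Time T → ℝ} (hf : MemLp f 2 volume) : toL2 f = hf.toLp := by
  rw [toL2, dif_pos hf]

theorem coeFn_toL2 {f : Time T → ℝ} (hf : MemLp f 2 volume) : toL2 f =ᵐ[volume] f := by
  rw [toL2_of_memLp hf]
  exact hf.coeFn_toLp

theorem setIntegral_kerB_of_memLp (φ ϱ : ℝ) (θ : ℝ × L2 T) (t : Time T) {f : Time T → ℝ}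
    (hf : MemLp f 2 volume) :
    ∫ s in Set.Iic t, kerB φ ϱ θ t s * f s = volterraFun φ ϱ θ t (toL2 f) := by
  rw [← setIntegral_kerB]
  refine integral_congr_ae (ae_restrict_of_ae ?_)
  filter_upwards [coeFn_toL2 hf] with s hs
  rw [hs]

theorem volterraFun_sub (φ ϱ : ℝ) (θ : ℝ × L2 T) (t : Time T) (x y : L2 T) :
    volterraFun φ ϱ θ t (x - y) = volterraFun φ ϱ θ t x - volterraFun φ ϱ θ t y := by
  have h : x - y - cut t (x - y) = (x - cut t x) - (y - cut t y) := by
    rw [cut_sub]; abel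
  rw [volterraFun, h, volterraFun, volterraFun]
  simp only [map_sub, cut_sub, inner_sub_left, inner_sub_right]
  ring

/-! #### From the first order condition to the greedy feedback formula -/

variable {φ ϱ L : ℝ} {θ : ℝ × L2 T}

theorem gain_fst (φ ϱ : ℝ) (θ : ℝ × L2 T) (t : Time T) :
    (gain φ ϱ θ t).1 = opDinv φ ϱ θ t
      (tildeGCol ϱ θ.2 t + (2 * φ) • opOneAdj t (cut t (constL2 1))) := by
  simp only [gain, gammaInv, colK, map_neg, map_add, map_smul, smul_neg, sub_neg_eq_add]

/-- Expressing the second component through the first means that only the operator `D_t⁻¹`, applied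
to one vector, ever has to be estimated or eliminated. -/
theorem gain_snd (φ ϱ : ℝ) (θ : ℝ × L2 T) (t : Time T) :
    (gain φ ϱ θ t).2 = (2 * φ) • (cut t (constL2 1) - opOne t (gain φ ϱ θ t).1) := by
  rw [gain_fst]
  simp only [gain, gammaInv, colK, map_neg, map_add, map_smul, smul_neg, smul_add,
    smul_sub, smul_smul, sub_neg_eq_add]
  rw [show 2 * φ * (2 * φ) = 4 * φ ^ 2 by ring]
  abel

/-- Symmetry of `Γ_t⁻¹`, inherited from `D_t⁻¹`, moves it from the signal onto `K_t`. -/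
theorem pairInner_gammaInv_signal (h : IsCoerciveModel φ ϱ L θ) (t : Time T) (x : L2 T) :
    pairInner (-gammaInv φ ϱ θ t (cut t x, 0)) (colK ϱ θ.2 t)
      = -inner ℝ (gain φ ϱ θ t).1 (cut t x) := by
  rw [gain_fst, h.opDinv_isSymm]
  simp only [pairInner, gammaInv, colK, map_zero, smul_zero, sub_zero, add_zero, Prod.fst_neg,
    Prod.snd_neg, inner_neg_left, inner_neg_right, inner_add_left, inner_smul_left,
    RCLike.conj_to_real, opOneAdj, ContinuousLinearMap.adjoint_inner_left]
  rw [real_inner_comm (tildeGCol ϱ θ.2 t), real_inner_comm (cut t (constL2 1))]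
  ring

/-- Split `m` into its past, which is that of `x`, and its future. The past contributes known impact
and a known displacement of the inventory; what remains is an equation for the future of `m`
governed by `D_t`. -/
theorem opD_future_eq {t : Time T} {m x s : L2 T} {q : ℝ}
    (hpast : m - cut t m = x - cut t x)
    (hfoc : cut t (opD φ ϱ θ ⊥ m)
      = cut t (s + (2 * ϱ * q) • constL2 1 + (2 * φ * q) • opOneAdj ⊥ (constL2 1))) :
    opD φ ϱ θ t (cut t m)
      = cut t s + (2 * ϱ * q) • cut t (constL2 1) - cut t (opG ϱ θ.2 ⊥ (x - cut t x))
        + (2 * φ * (q - inner ℝ (x - cut t x) (constL2 1))) • opOneAdj t (cut t (constL2 1)) := by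
  have h1 : cut t m = m - (x - cut t x) := by rw [← hpast]; abel
  rw [← cut_opD_bot_cut]
  rw [h1]
  rw [map_sub, cut_sub, hfoc, cut_opD_bot_of_cut_eq_zero _ _ _ _ _ (cut_sub_cut t x), cut_add,
    cut_add, cut_smul, cut_smul, ← opOneAdj_eq, ← opOneAdj_cut t (constL2 1)]
  module

/-- The algebraic core. In the application `x` is the path of the strategy, `m` its conditional
expectation given `𝓕_t`, `s` the conditional signal, `v` the trading rate at `t` and `α` the
conditional expectation of `A_t - A_T`. The condition `hv` at time `t` contains the unknown future
`cut t m` only through its pairing with `D_t κ₁`, where `κ₁` is the first component of the gain. By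
symmetry this equals the pairing of `κ₁` with `D_t (cut t m)`, which `opD_future_eq` makes explicit.
-/
theorem greedy_of_firstOrder (h : IsCoerciveModel φ ϱ L θ) {t : Time T} {m x s : L2 T}
    {q α v : ℝ} (hpast : m - cut t m = x - cut t x)
    (hfoc : cut t (opD φ ϱ θ ⊥ m)
      = cut t (s + (2 * ϱ * q) • constL2 1 + (2 * φ * q) • opOneAdj ⊥ (constL2 1)))
    (hv : 2 * θ.1 * v = α + 2 * ϱ * q
      + 2 * φ * q * inner ℝ (cut t (constL2 1)) (constL2 1 : L2 T)
      - inner ℝ (tildeGRow ϱ θ.2 t) x - inner ℝ (tildeGCol ϱ θ.2 t) m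
      - 2 * φ * inner ℝ (cut t (constL2 1)) (opOne ⊥ m)) :
    v = 1 / (2 * θ.1) * (α + 2 * ϱ * q
        + pairInner (-gammaInv φ ϱ θ t (cut t s, 0)) (colK ϱ θ.2 t)
        + pairInner (gammaInv φ ϱ θ t (colK ϱ θ.2 t))
          (cut t (constL2 (-(2 * ϱ * q))), cut t (constL2 q))) + volterraFun φ ϱ θ t x := by
  have hl := h.lambda_pos
  set one : L2 T := constL2 1 with hone
  set y := x - cut t x with hy
  set z := inner ℝ y one with hz
  set κ := gain φ ϱ θ t with hκ
  set p := tildeGCol ϱ θ.2 t + (2 * φ) • opOneAdj t (cut t one) with hp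
  have hfut := opD_future_eq hpast hfoc
  -- pairing the future equation with the gain
  have e1 : inner ℝ κ.1 (opD φ ϱ θ t (cut t m)) = inner ℝ p (cut t m) := by
    rw [hκ, gain_fst, h.opDinv_isSymm, h.opDinv_opD]
  rw [hfut] at e1
  simp only [hp, inner_add_right, inner_sub_right, inner_smul_right, inner_add_left,
    inner_smul_left, RCLike.conj_to_real, opOneAdj, ContinuousLinearMap.adjoint_inner_left,
    ContinuousLinearMap.adjoint_inner_right] at e1
  have e2 : inner ℝ (tildeGCol ϱ θ.2 t) (cut t m) = inner ℝ (tildeGCol ϱ θ.2 t) m := by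
    rw [← inner_cut_left, cut_tildeGCol]
  have e3 : inner ℝ (tildeGRow ϱ θ.2 t) y = inner ℝ (tildeGRow ϱ θ.2 t) x := by
    rw [hy, inner_sub_right, ← inner_cut_left, cut_tildeGRow, inner_zero_left, sub_zero]
  -- Cumulative trading after `t` splits into future trades and the constant `z`, the amount traded
  -- before `t`.
  have e4 : inner ℝ (cut t one) (opOne ⊥ m)
      = inner ℝ (cut t one) (opOne t (cut t m)) + z * inner ℝ (cut t one) (cut t one) := by
    have : m = cut t m + y := by rw [← hpast]; abel
    nth_rewrite 1 [this]
    rw [map_add, inner_add_right, opOne_eq_opOne_bot_cut t (cut t m), cut_cut]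
    rw [← inner_smul_right _ _ z, ← cut_opOne_bot_of_cut_eq_zero t y (cut_sub_cut t x),
      ← inner_cut_left t (cut t one), cut_cut]
  have e5 : inner ℝ κ.2 (cut t one)
      = 2 * φ * (inner ℝ (cut t one) (cut t one) - inner ℝ (opOne t κ.1) (cut t one)) := by
    rw [hκ, gain_snd, inner_smul_left, inner_sub_left, RCLike.conj_to_real]
  have e6 : inner ℝ (cut t one) one = inner ℝ (cut t one) (cut t one) := by
    rw [← inner_cut_left, cut_cut]
  rw [pairInner_gammaInv_signal h, volterraFun, ← mul_add]
  change v = 1 / (2 * θ.1) * (_ + pairInner κ _ + _)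
  rw [pairInner, constL2_eq (-(2 * ϱ * q)), constL2_eq q, cut_smul, cut_smul, inner_smul_right,
    inner_smul_right, ← hone, ← hκ, ← hy, ← hz, eq_comm, one_div, inv_mul_eq_iff_eq_mul₀ (by positivity),
    hv, e5, e3, e4, e6, ← e2]
  simp only [← hy] at e1
  linear_combination -e1

end Deterministic

/-! ### Bounds uniform in time and dependence of the operators on the model -/

section Deterministic

variable {T : ℝ} [Fact (0 < T)]

/-! #### Norm bounds -/

theorem norm_opOne_le (t : Time T) (f : L2 T) : ‖opOne t f‖ ≤ ‖(opOne ⊥ : L2 T →L[ℝ] L2 T)‖ * ‖f‖ := by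
  rw [opOne_eq_opOne_bot_cut]
  exact (ContinuousLinearMap.le_opNorm _ _).trans
    (mul_le_mul_of_nonneg_left (norm_cut_le t f) (norm_nonneg _))

theorem norm_opOneAdj_le (t : Time T) (f : L2 T) :
    ‖opOneAdj t f‖ ≤ ‖(opOneAdj ⊥ : L2 T →L[ℝ] L2 T)‖ * ‖f‖ := by
  rw [opOneAdj_eq]
  exact (norm_cut_le t _).trans (ContinuousLinearMap.le_opNorm _ _)

theorem exists_norm_gain_le {φ ϱ L : ℝ} {θ : ℝ × L2 T} (hφ : 0 ≤ φ) (h : IsCoerciveModel φ ϱ L θ) :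
    ∃ β, ∀ t, ‖(gain φ ϱ θ t).1‖ ≤ β ∧ ‖(gain φ ϱ θ t).2‖ ≤ β := by
  set one : L2 T := constL2 1
  set b1 := L * (‖(2 * ϱ) • one + θ.2‖ + 2 * φ * (‖(opOneAdj ⊥ : L2 T →L[ℝ] L2 T)‖ * ‖one‖))
  set b2 := 2 * φ * (‖one‖ + ‖(opOne ⊥ : L2 T →L[ℝ] L2 T)‖ * b1)
  have h1 : ∀ t, ‖(gain φ ϱ θ t).1‖ ≤ b1 := fun t => by
    rw [gain_fst]
    refine (h.norm_opDinv_le t _).trans (mul_le_mul_of_nonneg_left ?_ h.pos.le)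
    refine (norm_add_le _ _).trans (add_le_add (norm_tildeGCol_le ϱ θ.2 t) ?_)
    rw [norm_smul, Real.norm_of_nonneg (by positivity : (0 : ℝ) ≤ 2 * φ)]
    refine mul_le_mul_of_nonneg_left ?_ (by positivity)
    rw [opOneAdj_cut]
    exact norm_opOneAdj_le t one
  have h2 : ∀ t, ‖(gain φ ϱ θ t).2‖ ≤ b2 := fun t => by
    rw [gain_snd, norm_smul, Real.norm_of_nonneg (by positivity : (0 : ℝ) ≤ 2 * φ)]
    refine mul_le_mul_of_nonneg_left ?_ (by positivity)
    refine (norm_sub_le _ _).trans (add_le_add (norm_cut_le t one) ?_)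
    exact (norm_opOne_le t _).trans (mul_le_mul_of_nonneg_left (h1 t) (norm_nonneg _))
  exact ⟨max b1 b2, fun t => ⟨(h1 t).trans (le_max_left _ _), (h2 t).trans (le_max_right _ _)⟩⟩

/-- The norm of the past alone on the right makes the feedback equation accessible to Gronwall; the
constant does not depend on `t`. -/
theorem exists_abs_volterraFun_le {φ ϱ L : ℝ} {θ : ℝ × L2 T} (hφ : 0 ≤ φ)
    (h : IsCoerciveModel φ ϱ L θ) :
    ∃ β, 0 ≤ β ∧ ∀ t x, |volterraFun φ ϱ θ t x| ≤ β * ‖x - cut t x‖ := by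
  obtain ⟨b, hb⟩ := exists_norm_gain_le hφ h
  have hb0 : 0 ≤ b := (norm_nonneg _).trans (hb ⊥).1
  have hl := h.lambda_pos
  set one : L2 T := constL2 1
  refine ⟨1 / (2 * θ.1) * (b * ‖opG ϱ θ.2 ⊥‖ + b * ‖one‖ * ‖one‖ + ‖(2 * ϱ) • one + θ.2‖),
    by positivity, fun t x => ?_⟩
  set y := x - cut t x
  rw [volterraFun, abs_mul, abs_of_pos (by positivity : (0 : ℝ) < 1 / (2 * θ.1)), mul_assoc]
  refine mul_le_mul_of_nonneg_left ?_ (by positivity)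
  have a1 : |inner ℝ (gain φ ϱ θ t).1 (cut t (opG ϱ θ.2 ⊥ y))| ≤ b * (‖opG ϱ θ.2 ⊥‖ * ‖y‖) :=
    (abs_real_inner_le_norm _ _).trans (mul_le_mul (hb t).1
      ((norm_cut_le t _).trans (ContinuousLinearMap.le_opNorm _ _)) (norm_nonneg _) hb0)
  have a2 : |inner ℝ (gain φ ϱ θ t).2 (cut t one) * inner ℝ y one|
      ≤ (b * ‖one‖) * (‖y‖ * ‖one‖) := by
    rw [abs_mul]
    exact mul_le_mul ((abs_real_inner_le_norm _ _).trans
      (mul_le_mul (hb t).2 (norm_cut_le t _) (norm_nonneg _) hb0))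
      (abs_real_inner_le_norm _ _) (abs_nonneg _) (by positivity)
  have a3 : |inner ℝ (tildeGRow ϱ θ.2 t) y| ≤ ‖(2 * ϱ) • one + θ.2‖ * ‖y‖ :=
    (abs_real_inner_le_norm _ _).trans
      (mul_le_mul_of_nonneg_right (norm_tildeGRow_le ϱ θ.2 t) (norm_nonneg _))
  refine ((abs_sub _ _).trans (add_le_add ((abs_sub _ _).trans (add_le_add a1 a2)) a3)).trans
    (le_of_eq ?_)
  ring

theorem norm_tildeGRow_sub_le (ϱ : ℝ) (G G' : L2 T) (t : Time T) :
    ‖tildeGRow ϱ G t - tildeGRow ϱ G' t‖ ≤ ‖G - G'‖ := by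
  have e : ‖G - G'‖ = ‖((Lp.memLp G).sub (Lp.memLp G')).toLp‖ := by
    rw [MemLp.toLp_sub (Lp.memLp G) (Lp.memLp G'), Lp.toLp_coeFn G (Lp.memLp G),
      Lp.toLp_coeFn G' (Lp.memLp G')]
  rw [tildeGRow, tildeGRow, ← MemLp.toLp_sub, e]
  refine norm_toLp_le_of_lintegral_le _ _ (le_trans (le_of_eq ?_)
    (lintegral_gap_Iio_le (fun s => ‖G s - G' s‖ₑ ^ (2 : ℝ)) ?_ t))
  · rw [← lintegral_indicator measurableSet_Iio]
    refine lintegral_congr fun s => ?_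
    by_cases h : s < t
    · simp [tildeG, h]
    · simp [tildeG, h]
  · have := (Lp.stronglyMeasurable G).measurable
    have := (Lp.stronglyMeasurable G').measurable
    fun_prop

/-- Cauchy–Schwarz in each row bounds the difference pointwise by the constant function `‖G - G'‖
‖f‖`; its norm brings in the factor `‖1‖`. The constant `2ϱ` of the kernel cancels. -/
theorem norm_opG_bot_sub_le (ϱ : ℝ) (G G' : L2 T) :
    ‖opG ϱ G ⊥ - opG ϱ G' ⊥‖ ≤ ‖(constL2 1 : L2 T)‖ * ‖G - G'‖ := by
  refine ContinuousLinearMap.opNorm_le_bound _ (by positivity) fun f => ?_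
  have h : ‖(opG ϱ G ⊥ - opG ϱ G' ⊥) f‖ ≤ ‖(‖G - G'‖ * ‖f‖) • (constL2 1 : L2 T)‖ := by
    refine Lp.norm_le_norm_of_ae_le ?_
    filter_upwards [opG_bot_coeFn ϱ G f, opG_bot_coeFn ϱ G' f,
      Lp.coeFn_sub (opG ϱ G ⊥ f) (opG ϱ G' ⊥ f),
      Lp.coeFn_smul (‖G - G'‖ * ‖f‖) (constL2 1 : L2 T), coeFn_constL2 (T := T) 1]
      with s h1 h2 h3 h4 h5
    rw [h4, Pi.smul_apply, h5, sub_apply, h3, Pi.sub_apply, h1, h2, ← inner_sub_left, smul_eq_mul,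
      mul_one, Real.norm_of_nonneg (by positivity : 0 ≤ ‖G - G'‖ * ‖f‖)]
    exact (norm_inner_le_norm _ _).trans
      (mul_le_mul_of_nonneg_right (norm_tildeGRow_sub_le ϱ G G' s) (norm_nonneg _))
  rw [norm_smul, Real.norm_of_nonneg (by positivity)] at h
  linarith

/-- The inventory term `2φ 1^* 1` is common to both models and cancels, and the adjoint has the same
norm as the operator. -/
theorem norm_opD_bot_sub_le (φ ϱ : ℝ) (θ θ' : ℝ × L2 T) :
    ‖opD φ ϱ θ ⊥ - opD φ ϱ θ' ⊥‖
      ≤ 2 * |θ.1 - θ'.1| + 2 * (‖(constL2 1 : L2 T)‖ * ‖θ.2 - θ'.2‖) := by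
  have e : opD φ ϱ θ ⊥ - opD φ ϱ θ' ⊥ = (2 * (θ.1 - θ'.1)) • ContinuousLinearMap.id ℝ (L2 T)
      + ((opG ϱ θ.2 ⊥ - opG ϱ θ'.2 ⊥)
        + ContinuousLinearMap.adjoint (opG ϱ θ.2 ⊥ - opG ϱ θ'.2 ⊥)) := by
    rw [map_sub, opD, opD]
    module
  have hG := norm_opG_bot_sub_le ϱ θ.2 θ'.2
  rw [e]
  refine (norm_add_le _ _).trans (add_le_add ?_ ((norm_add_le _ _).trans ?_))
  · rw [norm_smul, norm_mul, Real.norm_eq_abs, Real.norm_eq_abs, abs_two]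
    exact mul_le_of_le_one_right (by positivity) ContinuousLinearMap.norm_id_le
  · rw [LinearIsometryEquiv.norm_map, two_mul]
    exact add_le_add hG hG

end Deterministic

/-! ### Processes as random elements of `L²([0,T])`; the Hilbert space of strategies -/

section Paths

variable {T : ℝ} [Fact (0 < T)] {Ω : Type*}

/-! #### Processes as `L²([0,T])`-valued random variables -/

/-- The random path of `X`, as a random variable with values in `L²([0,T])`. -/
def pathL2 (X : Time T → Ω → ℝ) (ω : Ω) : L2 T := toL2 fun s => X s ω

theorem enorm_toL2_sq {f : Time T → ℝ} (hf : MemLp f 2 volume) :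
    ‖toL2 f‖ₑ ^ 2 = ∫⁻ t, ‖f t‖ₑ ^ 2 := by
  rw [toL2_of_memLp hf, Lp.enorm_toLp,
    eLpNorm_eq_lintegral_rpow_enorm_toReal (by norm_num) (by norm_num), ← ENNReal.rpow_natCast,
    ← ENNReal.rpow_mul]
  norm_num

theorem edist_toL2_sq {f : Time T → ℝ} (hf : MemLp f 2 volume) (g : L2 T) :
    edist (toL2 f) g ^ 2 = ∫⁻ t, ‖f t - g t‖ₑ ^ 2 := by
  have h : toL2 f - g = toL2 (fun t => f t - g t) := by
    have h3 : MemLp (fun t => f t - g t) 2 volume := hf.sub (Lp.memLp g)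
    rw [toL2_of_memLp hf, toL2_of_memLp h3]
    exact ((MemLp.toLp_sub hf (Lp.memLp g)).trans (by rw [Lp.toLp_coeFn g (Lp.memLp g)])).symm
  rw [edist_eq_enorm_sub, h]
  exact enorm_toL2_sq (hf.sub (Lp.memLp g))

theorem toL2_of_not_memLp {f : Time T → ℝ} (hf : ¬ MemLp f 2 volume) : toL2 f = 0 := by
  rw [toL2, dif_neg hf]

theorem memLp_two_iff' {α : Type*} [MeasurableSpace α] {μ : Measure α} {f : α → ℝ} :
    MemLp f 2 μ ↔ AEStronglyMeasurable f μ ∧ ∫⁻ x, ‖f x‖ₑ ^ 2 ∂μ < ∞ := by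
  rw [memLp_two_iff]
  simp only [ENNReal.rpow_ofNat]

/-- In a second countable metric space every open set is a countable union of balls, and the
preimage of a ball is a sublevel set of a distance function. -/
theorem stronglyMeasurable_of_edist {E : Type*} [MetricSpace E] [SecondCountableTopology E]
    [MeasurableSpace Ω] {F : Ω → E} (h : ∀ g, Measurable fun ω => edist (F ω) g) :
    StronglyMeasurable F := by
  borelize E
  refine Measurable.stronglyMeasurable (measurable_of_isOpen fun U hU => ?_)
  have hr : ∀ x : U, ∃ r > 0, Metric.ball (x : E) r ⊆ U := fun x => Metric.isOpen_iff.1 hU x x.2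
  choose r hr0 hr using hr
  obtain ⟨S, hS, hSU⟩ := TopologicalSpace.isOpen_iUnion_countable
    (fun x : U => Metric.ball (x : E) (r x)) fun x => Metric.isOpen_ball
  have hU' : U = ⋃ x ∈ S, Metric.ball (x : E) (r x) := by
    rw [hSU]
    refine Set.Subset.antisymm (fun x hx => ?_) (Set.iUnion_subset hr)
    exact Set.mem_iUnion.2 ⟨⟨x, hx⟩, Metric.mem_ball_self (hr0 _)⟩
  rw [hU', Set.preimage_iUnion₂]
  refine MeasurableSet.biUnion hS fun x _ => ?_
  have : F ⁻¹' Metric.ball (x : E) (r x) = {ω | (edist (F ω) x).toReal < r x} := by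
    ext ω
    simp [Metric.mem_ball, dist_edist]
  rw [this]
  exact measurableSet_lt (h x).ennreal_toReal measurable_const

theorem stronglyMeasurable_pathL2 [MeasurableSpace Ω] {X : Time T → Ω → ℝ}
    (hX : Measurable (Function.uncurry X)) : StronglyMeasurable (pathL2 X) := by
  have hm : ∀ ω, AEStronglyMeasurable (fun s => X s ω) (volume : Measure (Time T)) := fun ω =>
    (hX.comp (measurable_id.prodMk measurable_const)).aestronglyMeasurable
  have hN : MeasurableSet {ω | ∫⁻ t, ‖X t ω‖ₑ ^ 2 < ∞} := by
    refine measurableSet_lt (Measurable.lintegral_prod_left' (f := fun p => ‖X p.1 p.2‖ₑ ^ 2) ?_)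
      measurable_const
    exact hX.enorm.pow_const 2
  have : Fact ((2 : ℝ≥0∞) ≠ ∞) := ⟨by norm_num⟩
  refine stronglyMeasurable_of_edist fun g => ?_
  have hg : Measurable fun ω => ∫⁻ t, ‖X t ω - g t‖ₑ ^ 2 := by
    refine Measurable.lintegral_prod_left' (f := fun p => ‖X p.1 p.2 - g p.1‖ₑ ^ 2) ?_
    exact (hX.sub ((Lp.stronglyMeasurable g).measurable.comp measurable_fst)).enorm.pow_const 2
  classical
  -- Where the path is not square integrable `toL2` returns zero, hence the second branch. Elsewhere
  -- the distance is an integral, measurable by Tonelli.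
  have e : (fun ω => edist (pathL2 X ω) g) = fun ω => if ω ∈ {ω | ∫⁻ t, ‖X t ω‖ₑ ^ 2 < ∞} then
      (∫⁻ t, ‖X t ω - g t‖ₑ ^ 2) ^ (1 / 2 : ℝ) else edist 0 g := by
    ext ω
    split_ifs with h
    · rw [← edist_toL2_sq (memLp_two_iff'.2 ⟨hm ω, h⟩), ← ENNReal.rpow_natCast,
        ← ENNReal.rpow_mul]
      norm_num [pathL2]
    · rw [pathL2, toL2_of_not_memLp fun h' => h (memLp_two_iff'.1 h').2]
  rw [e]
  exact Measurable.ite hN (hg.pow_const _) measurable_const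

/-- Jointly measurable processes with `E[∫_0^T X_s² ds] < ∞`. -/
structure IsSqIntegrable [MeasurableSpace Ω] (P : Measure Ω) (X : Time T → Ω → ℝ) : Prop where
  measurable : Measurable (Function.uncurry X)
  lintegral_lt_top : ∫⁻ ω, (∫⁻ t, ‖X t ω‖ₑ ^ 2) ∂P < ∞

section

variable {mΩ : MeasurableSpace Ω} {P : Measure Ω} [IsProbabilityMeasure P] {X Y : Time T → Ω → ℝ}

theorem IsSqIntegrable.measurable_lintegral (h : IsSqIntegrable P X) :
    Measurable fun ω => ∫⁻ t, ‖X t ω‖ₑ ^ 2 :=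
  Measurable.lintegral_prod_left' (f := fun p => ‖X p.1 p.2‖ₑ ^ 2) (h.measurable.enorm.pow_const 2)

theorem IsSqIntegrable.ae_memLp (h : IsSqIntegrable P X) :
    ∀ᵐ ω ∂P, MemLp (fun t => X t ω) 2 volume := by
  filter_upwards [ae_lt_top h.measurable_lintegral h.lintegral_lt_top.ne] with ω hω
  exact memLp_two_iff'.2 ⟨(h.measurable.comp
    (measurable_id.prodMk measurable_const)).aestronglyMeasurable, hω⟩

theorem IsSqIntegrable.lintegral_enorm_pathL2 (h : IsSqIntegrable P X) :
    ∫⁻ ω, ‖pathL2 X ω‖ₑ ^ 2 ∂P = ∫⁻ ω, (∫⁻ t, ‖X t ω‖ₑ ^ 2) ∂P := by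
  refine lintegral_congr_ae ?_
  filter_upwards [h.ae_memLp] with ω hω
  exact enorm_toL2_sq hω

theorem IsSqIntegrable.memLp_pathL2 (h : IsSqIntegrable P X) : MemLp (pathL2 X) 2 P := by
  refine ⟨(stronglyMeasurable_pathL2 h.measurable).aestronglyMeasurable, ?_⟩
  rw [eLpNorm_lt_top_iff_lintegral_rpow_enorm_lt_top (by norm_num) (by norm_num)]
  simp only [ENNReal.toReal_ofNat, ENNReal.rpow_ofNat]
  rw [h.lintegral_enorm_pathL2]
  exact h.lintegral_lt_top

theorem isSqIntegrable_iff_memLp (hX : Measurable (Function.uncurry X)) :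
    IsSqIntegrable P X ↔ MemLp (Function.uncurry X) 2 (volume.prod P) := by
  have e : ∫⁻ p, ‖Function.uncurry X p‖ₑ ^ 2 ∂(volume.prod P)
      = ∫⁻ ω, (∫⁻ t, ‖X t ω‖ₑ ^ 2) ∂P :=
    lintegral_prod_symm _ (hX.enorm.pow_const 2).aemeasurable
  rw [memLp_two_iff', e]
  exact ⟨fun h => ⟨hX.aestronglyMeasurable, h.2⟩, fun h => ⟨hX, h.2⟩⟩

theorem IsSqIntegrable.eLpNorm_pathL2 (h : IsSqIntegrable P X) :
    eLpNorm (pathL2 X) 2 P = eLpNorm (Function.uncurry X) 2 (volume.prod P) := by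
  rw [eLpNorm_eq_lintegral_rpow_enorm_toReal (by norm_num) (by norm_num),
    eLpNorm_eq_lintegral_rpow_enorm_toReal (by norm_num) (by norm_num)]
  simp only [ENNReal.toReal_ofNat, ENNReal.rpow_ofNat]
  rw [h.lintegral_enorm_pathL2,
    lintegral_prod_symm _ (h.measurable.enorm.pow_const 2).aemeasurable]
  rfl

theorem ae_ae_of_ae_prod {p : Time T × Ω → Prop} (h : ∀ᵐ x ∂(volume.prod P), p x) :
    ∀ᵐ ω ∂P, ∀ᵐ t, p (t, ω) := by
  have h' : ∀ᵐ x ∂(P.prod volume), p (Prod.swap x) :=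
    Measure.measurePreserving_swap.quasiMeasurePreserving.ae h
  exact Measure.ae_ae_of_ae_prod h'

theorem ae_prod_of_ae_ae (hX : Measurable (Function.uncurry X)) (hY : Measurable (Function.uncurry Y))
    (h : ∀ᵐ t, ∀ᵐ ω ∂P, X t ω = Y t ω) :
    Function.uncurry X =ᵐ[volume.prod P] Function.uncurry Y :=
  (Measure.ae_prod_iff_ae_ae (measurableSet_eq_fun hX hY)).2 h

theorem pathL2_ae_eq (h : Function.uncurry X =ᵐ[volume.prod P] Function.uncurry Y) :
    pathL2 X =ᵐ[P] pathL2 Y := by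
  filter_upwards [ae_ae_of_ae_prod h] with ω hω
  have e : (fun t => X t ω) =ᵐ[volume] fun t => Y t ω := hω
  by_cases hX : MemLp (fun t => X t ω) 2 volume
  · have hY := (memLp_congr_ae e).1 hX
    rw [pathL2, pathL2, toL2_of_memLp hX, toL2_of_memLp hY]
    exact MemLp.toLp_congr _ _ e
  · have hY := fun h' => hX ((memLp_congr_ae e).2 h')
    rw [pathL2, pathL2, toL2_of_not_memLp hX, toL2_of_not_memLp hY]

theorem IsSqIntegrable.pathL2_add (hX : IsSqIntegrable P X) (hY : IsSqIntegrable P Y) :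
    pathL2 (fun t ω => X t ω + Y t ω) =ᵐ[P] fun ω => pathL2 X ω + pathL2 Y ω := by
  filter_upwards [hX.ae_memLp, hY.ae_memLp] with ω h1 h2
  have h3 : MemLp (fun t => X t ω + Y t ω) 2 volume := h1.add h2
  rw [pathL2, pathL2, pathL2, toL2_of_memLp h1, toL2_of_memLp h2, toL2_of_memLp h3]
  exact MemLp.toLp_add h1 h2

theorem IsSqIntegrable.pathL2_sub (hX : IsSqIntegrable P X) (hY : IsSqIntegrable P Y) :
    pathL2 (fun t ω => X t ω - Y t ω) =ᵐ[P] fun ω => pathL2 X ω - pathL2 Y ω := by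
  filter_upwards [hX.ae_memLp, hY.ae_memLp] with ω h1 h2
  have h3 : MemLp (fun t => X t ω - Y t ω) 2 volume := h1.sub h2
  rw [pathL2, pathL2, pathL2, toL2_of_memLp h1, toL2_of_memLp h2, toL2_of_memLp h3]
  exact MemLp.toLp_sub h1 h2

theorem IsSqIntegrable.pathL2_const_mul (hX : IsSqIntegrable P X) (c : ℝ) :
    pathL2 (fun t ω => c * X t ω) =ᵐ[P] fun ω => c • pathL2 X ω := by
  filter_upwards [hX.ae_memLp] with ω h1
  have h3 : MemLp (fun t => c * X t ω) 2 volume := h1.const_mul c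
  rw [pathL2, pathL2, toL2_of_memLp h1, toL2_of_memLp h3]
  exact MemLp.toLp_const_smul c h1

theorem IsSqIntegrable.sub (hX : IsSqIntegrable P X) (hY : IsSqIntegrable P Y) :
    IsSqIntegrable P fun t ω => X t ω - Y t ω := by
  have hm : Measurable (Function.uncurry fun t ω => X t ω - Y t ω) :=
    hX.measurable.sub hY.measurable
  exact (isSqIntegrable_iff_memLp hm).2 (((isSqIntegrable_iff_memLp hX.measurable).1 hX).sub
    ((isSqIntegrable_iff_memLp hY.measurable).1 hY))

/-! #### The progressive σ-algebra -/

/-- The σ-algebra on `[0,T] × Ω` generated by the progressively measurable processes. -/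
@[reducible] def progSigma (𝓕 : Filtration (Time T) mΩ) : MeasurableSpace (Time T × Ω) :=
  ⨅ i : Time T, MeasurableSpace.map (fun p : Set.Iic i × Ω => ((p.1 : Time T), p.2))
    (Subtype.instMeasurableSpace.prod (𝓕 i))

/-- Turning progressive measurability into measurability for one σ-algebra makes the strategies an
`L²` space of a trimmed measure, hence complete. -/
theorem isProgressive_iff (𝓕 : Filtration (Time T) mΩ) (u : Time T → Ω → ℝ) :
    IsProgressive 𝓕 u ↔ Measurable[progSigma 𝓕] (Function.uncurry u) := by
  constructor
  · intro h s hs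
    refine MeasurableSpace.measurableSet_iInf.2 fun i => ?_
    exact h i hs
  · intro h i s hs
    exact MeasurableSpace.measurableSet_iInf.1 (h hs) i

theorem progSigma_le (𝓕 : Filtration (Time T) mΩ) : progSigma 𝓕 ≤ Prod.instMeasurableSpace := by
  intro s hs
  -- At the terminal time the strip `Set.Iic ⊤` is the whole interval.
  have h := MeasurableSpace.measurableSet_iInf.1 hs ⊤
  have hφ : Measurable[Prod.instMeasurableSpace, Subtype.instMeasurableSpace.prod (𝓕 ⊤)]
      (fun p : Time T × Ω => ((⟨p.1, Set.mem_Iic.2 le_top⟩ : Set.Iic (⊤ : Time T)), p.2)) := by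
    refine @Measurable.prodMk _ _ _ _ _ (𝓕 ⊤) _ _ ?_ ?_
    · exact measurable_fst.subtype_mk
    · exact measurable_snd.mono le_rfl (𝓕.le ⊤)
  exact hφ h

theorem _root_.MeasureTheory.IsProgressive.measurable_uncurry {𝓕 : Filtration (Time T) mΩ}
    {u : Time T → Ω → ℝ} (h : IsProgressive 𝓕 u) : Measurable (Function.uncurry u) :=
  ((isProgressive_iff 𝓕 u).1 h).mono (progSigma_le 𝓕) le_rfl

theorem Admissible.isSqIntegrable {𝓕 : Filtration (Time T) mΩ} {u : Time T → Ω → ℝ}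
    (h : Admissible P 𝓕 u) : IsSqIntegrable P u :=
  ⟨h.1.measurable_uncurry, h.2⟩

/-- The Hilbert space of admissible strategies. -/
abbrev Strategies (P : Measure Ω) (𝓕 : Filtration (Time T) mΩ) : Type _ :=
  Lp ℝ 2 ((volume.prod P).trim (progSigma_le 𝓕))

/-- A progressively measurable representative of an element of `Strategies`. -/
def strategyRep {𝓕 : Filtration (Time T) mΩ} (x : Strategies P 𝓕) (t : Time T) (ω : Ω) : ℝ :=
  x (t, ω)

theorem admissible_strategyRep {𝓕 : Filtration (Time T) mΩ} (x : Strategies P 𝓕) :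
    Admissible P 𝓕 (strategyRep x) := by
  have h1 : Measurable[progSigma 𝓕] (Function.uncurry (strategyRep x)) :=
    (Lp.stronglyMeasurable x).measurable
  have h2 : MemLp (Function.uncurry (strategyRep x)) 2 (volume.prod P) :=
    memLp_of_memLp_trim (progSigma_le 𝓕) (Lp.memLp x)
  exact ⟨(isProgressive_iff 𝓕 _).2 h1,
    ((isSqIntegrable_iff_memLp (h1.mono (progSigma_le 𝓕) le_rfl)).2 h2).lintegral_lt_top⟩

theorem ae_prod_of_ae_trim {𝓕 : Filtration (Time T) mΩ} {f g : Time T × Ω → ℝ}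
    (h : f =ᵐ[(volume.prod P).trim (progSigma_le 𝓕)] g) : f =ᵐ[volume.prod P] g :=
  ae_eq_of_ae_eq_trim h

/-- The isometric embedding of the strategies into `L²(Ω; L²([0,T]))`. -/
def strategyPath (P : Measure Ω) [IsProbabilityMeasure P] (𝓕 : Filtration (Time T) mΩ) :
    Strategies P 𝓕 →ₗᵢ[ℝ] Lp (L2 T) 2 P where
  toFun x := (admissible_strategyRep x).isSqIntegrable.memLp_pathL2.toLp
  map_add' x y := by
    have hx := (admissible_strategyRep x).isSqIntegrable
    have hy := (admissible_strategyRep y).isSqIntegrable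
    rw [← MemLp.toLp_add, MemLp.toLp_eq_toLp_iff]
    refine (pathL2_ae_eq ?_).trans (hx.pathL2_add hy)
    exact ae_prod_of_ae_trim (Lp.coeFn_add x y)
  map_smul' c x := by
    have hx := (admissible_strategyRep x).isSqIntegrable
    rw [RingHom.id_apply, ← MemLp.toLp_const_smul, MemLp.toLp_eq_toLp_iff]
    refine (pathL2_ae_eq ?_).trans (hx.pathL2_const_mul c)
    exact ae_prod_of_ae_trim (Lp.coeFn_smul c x)
  norm_map' x := by
    have hx := (admissible_strategyRep x).isSqIntegrable
    change ‖hx.memLp_pathL2.toLp‖ = ‖x‖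
    rw [Lp.norm_toLp, hx.eLpNorm_pathL2, Lp.norm_def]
    congr 1
    exact (eLpNorm_trim (progSigma_le 𝓕) (Lp.stronglyMeasurable x)).symm

theorem coeFn_strategyPath {𝓕 : Filtration (Time T) mΩ} (x : Strategies P 𝓕) :
    strategyPath P 𝓕 x =ᵐ[P] pathL2 (strategyRep x) :=
  MemLp.coeFn_toLp (admissible_strategyRep x).isSqIntegrable.memLp_pathL2

theorem exists_strategyPath_eq {𝓕 : Filtration (Time T) mΩ} {u : Time T → Ω → ℝ}
    (h : Admissible P 𝓕 u) :
    ∃ x : Strategies P 𝓕, strategyPath P 𝓕 x =ᵐ[P] pathL2 u := by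
  have h1 : Measurable[progSigma 𝓕] (Function.uncurry u) := (isProgressive_iff 𝓕 u).1 h.1
  have h2 := (isSqIntegrable_iff_memLp h.isSqIntegrable.measurable).1 h.isSqIntegrable
  have h3 : MemLp (Function.uncurry u) 2 ((volume.prod P).trim (progSigma_le 𝓕)) :=
    ⟨h1.stronglyMeasurable.aestronglyMeasurable,
      (eLpNorm_trim (progSigma_le 𝓕) h1.stronglyMeasurable).trans_lt h2.2⟩
  refine ⟨h3.toLp, (coeFn_strategyPath _).trans (pathL2_ae_eq ?_)⟩
  exact ae_prod_of_ae_trim h3.coeFn_toLp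

end

end Paths

/-! ### Convergence of forward averages in `L¹([0,T])` -/

section Averages

variable {T : ℝ} [Fact (0 < T)]

/-! #### Forward averages -/

/-- The kernel of the average over `[t, t + 1/(n+1)]`. -/
def avgKer (n : ℕ) (t r : Time T) : ℝ :=
  if t ≤ r ∧ (r : ℝ) ≤ t + 1 / ((n : ℝ) + 1) then (n : ℝ) + 1 else 0

theorem measurable_avgKer (n : ℕ) :
    Measurable (Function.uncurry (avgKer n : Time T → Time T → ℝ)) := by
  refine Measurable.ite ((measurableSet_le measurable_fst measurable_snd).inter
    (measurableSet_le (α := ℝ) ?_ ?_)) measurable_const measurable_const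
  · exact measurable_subtype_coe.comp measurable_snd
  · exact (measurable_subtype_coe.comp measurable_fst).add_const _

theorem avgKer_nonneg (n : ℕ) (t r : Time T) : 0 ≤ avgKer n t r := by
  unfold avgKer; split_ifs <;> positivity

theorem avgKer_le (n : ℕ) (t r : Time T) : avgKer n t r ≤ (n : ℝ) + 1 := by
  unfold avgKer; split_ifs
  · exact le_rfl
  · positivity

theorem norm_avgKer_le (n : ℕ) (t r : Time T) : ‖avgKer n t r‖ ≤ (n : ℝ) + 1 := by
  rw [Real.norm_of_nonneg (avgKer_nonneg n t r)]
  exact avgKer_le n t r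

theorem lintegral_Time (g : ℝ → ℝ≥0∞) :
    ∫⁻ t : Time T, g t = ∫⁻ x in Set.Icc (0 : ℝ) T, g x := by
  rw [show (volume : Measure (Time T)) = Measure.comap Subtype.val volume from rfl,
    lintegral_subtype_comap measurableSet_Icc]

/-- For fixed `r` the times whose window contains `r` lie in an interval of length `1/(n+1)`. By
Tonelli this makes averaging a contraction of `L¹`. -/
theorem lintegral_avgKer_left_le (n : ℕ) (r : Time T) : ∫⁻ t, ‖avgKer n t r‖ₑ ≤ 1 := by
  have h : ∀ t : Time T, ‖avgKer n t r‖ₑ ≤ (Set.Icc ((r : ℝ) - 1 / ((n : ℝ) + 1)) r).indicator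
      (fun _ => ENNReal.ofReal ((n : ℝ) + 1)) (t : ℝ) := fun t => by
    rw [Real.enorm_of_nonneg (avgKer_nonneg n t r), avgKer]
    split_ifs with h
    · rw [Set.indicator_of_mem]
      exact ⟨by linarith [h.2], h.1⟩
    · simp
  refine (lintegral_mono h).trans ?_
  rw [lintegral_Time (fun x => (Set.Icc ((r : ℝ) - 1 / ((n : ℝ) + 1)) r).indicator
      (fun _ => ENNReal.ofReal ((n : ℝ) + 1)) x)]
  refine (setLIntegral_le_lintegral _ _).trans ?_
  rw [lintegral_indicator_const measurableSet_Icc, Real.volume_Icc,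
    ← ENNReal.ofReal_mul (by positivity)]
  refine ENNReal.ofReal_le_one.2 (le_of_eq ?_)
  field_simp
  ring

theorem integral_avgKer_right {n : ℕ} {t : Time T} (h : (t : ℝ) + 1 / ((n : ℝ) + 1) ≤ T) :
    ∫ r, avgKer n t r = 1 := by
  have e : ∀ r : Time T, avgKer n t r = (Set.Icc (t : ℝ) (t + 1 / ((n : ℝ) + 1))).indicator
      (fun _ => (n : ℝ) + 1) (r : ℝ) := fun r => by
    rw [avgKer, Set.indicator_apply]
    rfl
  simp_rw [e]
  rw [show (volume : Measure (Time T)) = Measure.comap Subtype.val volume from rfl,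
    integral_subtype_comap measurableSet_Icc (fun x => (Set.Icc (t : ℝ)
      (t + 1 / ((n : ℝ) + 1))).indicator (fun _ => (n : ℝ) + 1) x),
    setIntegral_indicator measurableSet_Icc, Set.inter_eq_right.2
      (Set.Icc_subset_Icc t.2.1 h), setIntegral_const, Measure.real, Real.volume_Icc,
    ENNReal.toReal_ofReal (by rw [add_sub_cancel_left]; positivity)]
  simp only [smul_eq_mul]
  field_simp
  ring

/-- The forward average of `f` over `[t, t + 1/(n+1)]`. -/
def fwdAvg (n : ℕ) (f : Time T → ℝ) (t : Time T) : ℝ := ∫ r, avgKer n t r * f r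

theorem integrable_avgKer_mul (n : ℕ) (t : Time T) {f : Time T → ℝ} (hf : Integrable f) :
    Integrable fun r => avgKer n t r * f r :=
  hf.bdd_mul (c := (n : ℝ) + 1) (measurable_avgKer n).of_uncurry_left.aestronglyMeasurable
    (Eventually.of_forall fun r => norm_avgKer_le n t r)

theorem lintegral_fwdAvg_le (n : ℕ) {f : Time T → ℝ} (hf : Measurable f) :
    ∫⁻ t, ‖fwdAvg n f t‖ₑ ≤ ∫⁻ t, ‖f t‖ₑ := by
  have hm : Measurable fun p : Time T × Time T => ‖avgKer n p.1 p.2‖ₑ * ‖f p.2‖ₑ :=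
    (measurable_avgKer n).enorm.mul (hf.comp measurable_snd).enorm
  calc ∫⁻ t, ‖fwdAvg n f t‖ₑ ≤ ∫⁻ t, ∫⁻ r, ‖avgKer n t r‖ₑ * ‖f r‖ₑ := by
        refine lintegral_mono fun t => (enorm_integral_le_lintegral_enorm _).trans (le_of_eq ?_)
        simp only [enorm_mul]
    _ = ∫⁻ r, ∫⁻ t, ‖avgKer n t r‖ₑ * ‖f r‖ₑ := lintegral_lintegral_swap hm.aemeasurable
    _ ≤ ∫⁻ r, 1 * ‖f r‖ₑ := by
        refine lintegral_mono fun r => ?_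
        simp only
        rw [lintegral_mul_const' _ _ enorm_ne_top]
        gcongr
        exact lintegral_avgKer_left_le n r
    _ = ∫⁻ t, ‖f t‖ₑ := by simp only [one_mul]

theorem tendsto_fwdAvg_of_continuous {h : Time T → ℝ} (hh : Continuous h) {t : Time T}
    (ht : (t : ℝ) < T) : Tendsto (fun n => fwdAvg n h t) atTop (𝓝 (h t)) := by
  obtain ⟨b, hb⟩ := (isCompact_univ (X := Time T)).exists_bound_of_continuousOn hh.continuousOn
  have hi : Integrable h :=
    Integrable.of_bound hh.aestronglyMeasurable b (Eventually.of_forall fun x => hb x trivial)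
  rw [Metric.tendsto_atTop]
  intro ε hε
  obtain ⟨δ, hδ, hδ'⟩ := Metric.continuousAt_iff.1 (hh.continuousAt (x := t)) (ε / 2) (half_pos hε)
  -- The window must stay within `δ` of `t` for continuity and inside `[0,T]` for the kernel to have
  -- mass one.
  have hδ2 : 0 < min δ (T - t) := lt_min hδ (sub_pos.2 ht)
  obtain ⟨N, hN⟩ := exists_nat_one_div_lt hδ2
  refine ⟨N, fun n hn => ?_⟩
  have hn' : 1 / ((n : ℝ) + 1) < min δ (T - t) :=
    lt_of_le_of_lt (one_div_le_one_div_of_le (by positivity) (by gcongr)) hN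
  have h1 : ∫ r, avgKer n t r = 1 :=
    integral_avgKer_right (by linarith [hn'.trans_le (min_le_right _ _)])
  have hk : Integrable fun r => avgKer n t r := by
    simpa using integrable_avgKer_mul n t (f := fun _ => (1 : ℝ)) (integrable_const _)
  have h2 : fwdAvg n h t - h t = ∫ r, avgKer n t r * (h r - h t) := by
    simp only [mul_sub]
    rw [integral_sub (integrable_avgKer_mul n t hi) (hk.mul_const _), integral_mul_const, h1,
      one_mul, fwdAvg]
  have h3 : ‖∫ r, avgKer n t r * (h r - h t)‖ ≤ ∫ r, avgKer n t r * (ε / 2) := by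
    refine norm_integral_le_of_norm_le (hk.mul_const _) (Eventually.of_forall fun r => ?_)
    rw [norm_mul, Real.norm_of_nonneg (avgKer_nonneg n t r)]
    by_cases hr : t ≤ r ∧ (r : ℝ) ≤ t + 1 / ((n : ℝ) + 1)
    · refine mul_le_mul_of_nonneg_left (le_of_lt ?_) (avgKer_nonneg n t r)
      rw [← dist_eq_norm]
      refine hδ' ?_
      rw [Subtype.dist_eq, Real.dist_eq, abs_of_nonneg (sub_nonneg.2 (show (t : ℝ) ≤ r from hr.1))]
      linarith [hn'.trans_le (min_le_left _ _)]
    · rw [avgKer, if_neg hr, zero_mul, zero_mul]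
  rw [integral_mul_const, h1, one_mul] at h3
  rw [Real.dist_eq, h2, ← Real.norm_eq_abs]
  linarith

theorem measurable_fwdAvg (n : ℕ) {f : Time T → ℝ} (hf : Measurable f) : Measurable (fwdAvg n f) := by
  have : Measurable (Function.uncurry fun t r => avgKer n t r * f r) :=
    (measurable_avgKer n).mul (hf.comp measurable_snd)
  exact this.stronglyMeasurable.integral_prod_right.measurable

theorem ae_lt_top_Time : ∀ᵐ t : Time T, (t : ℝ) < T := by
  have : ∀ᵐ t : Time T, t ≠ ⊤ := by
    rw [ae_iff]
    simp
  filter_upwards [this] with t ht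
  exact lt_of_le_of_ne t.2.2 fun h => ht (Subtype.ext h)

theorem tendsto_lintegral_fwdAvg_of_continuous {h : Time T → ℝ} (hh : Continuous h) :
    Tendsto (fun n => ∫⁻ t, ‖fwdAvg n h t - h t‖ₑ) atTop (𝓝 0) := by
  obtain ⟨b, hb⟩ := (isCompact_univ (X := Time T)).exists_bound_of_continuousOn hh.continuousOn
  have hb0 : 0 ≤ b := (norm_nonneg _).trans (hb ⊤ trivial)
  have hle : ∀ n t, ‖fwdAvg n h t‖ ≤ b := fun n t => by
    have hk : Integrable fun r => avgKer n t r := by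
      simpa using integrable_avgKer_mul n t (f := fun _ => (1 : ℝ)) (integrable_const _)
    have h1 : ‖fwdAvg n h t‖ ≤ ∫ r, avgKer n t r * b := by
      refine norm_integral_le_of_norm_le (hk.mul_const _) (Eventually.of_forall fun r => ?_)
      rw [norm_mul, Real.norm_of_nonneg (avgKer_nonneg n t r)]
      exact mul_le_mul_of_nonneg_left (hb r trivial) (avgKer_nonneg n t r)
    rw [integral_mul_const] at h1
    have h2 : ∫ r, avgKer n t r ≤ 1 := by
      have e : ∀ r : Time T, avgKer n t r = (Set.Icc (t : ℝ) (t + 1 / ((n : ℝ) + 1))).indicator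
          (fun _ => (n : ℝ) + 1) (r : ℝ) := fun r => by
        rw [avgKer, Set.indicator_apply]
        rfl
      simp_rw [e]
      rw [show (volume : Measure (Time T)) = Measure.comap Subtype.val volume from rfl,
        integral_subtype_comap measurableSet_Icc (fun x => (Set.Icc (t : ℝ)
          (t + 1 / ((n : ℝ) + 1))).indicator (fun _ => (n : ℝ) + 1) x)]
      have hi : Integrable ((Set.Icc (t : ℝ) (t + 1 / ((n : ℝ) + 1))).indicator
          fun _ => (n : ℝ) + 1) :=
        (integrable_indicator_iff measurableSet_Icc).2
          (integrableOn_const (by simp))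
      refine (setIntegral_le_integral hi (Eventually.of_forall fun x =>
        Set.indicator_nonneg (fun _ _ => by positivity) x)).trans (le_of_eq ?_)
      rw [integral_indicator measurableSet_Icc, setIntegral_const, Measure.real, Real.volume_Icc,
        ENNReal.toReal_ofReal (by rw [add_sub_cancel_left]; positivity)]
      simp only [smul_eq_mul]
      field_simp
      ring
    exact h1.trans (mul_le_of_le_one_left hb0 h2)
  have := tendsto_lintegral_of_dominated_convergence (μ := (volume : Measure (Time T)))
    (F := fun n t => ‖fwdAvg n h t - h t‖ₑ) (f := fun _ => 0)
    (fun _ => ENNReal.ofReal (b + b))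
    (fun n => ((measurable_fwdAvg n hh.measurable).sub hh.measurable).enorm)
    (fun n => Eventually.of_forall fun t => by
      change ‖fwdAvg n h t - h t‖ₑ ≤ ENNReal.ofReal (b + b)
      rw [← ofReal_norm]
      exact ENNReal.ofReal_le_ofReal
        ((norm_sub_le _ _).trans (add_le_add (hle n t) (hb t trivial))))
    (by rw [lintegral_const]; exact ENNReal.mul_ne_top ENNReal.ofReal_ne_top (measure_ne_top _ _))
    (by
      filter_upwards [ae_lt_top_Time (T := T)] with t ht
      have h1 := (tendsto_fwdAvg_of_continuous hh ht).sub_const (h t)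
      rw [sub_self] at h1
      simpa using h1.enorm)
  simpa using this

/-- Approximation by a continuous function `h`: the average of `f - h`, the averaging error of `h`
and `h - f` each cost one third of the tolerance, the first by the contraction property. -/
theorem tendsto_lintegral_fwdAvg {f : Time T → ℝ} (hfm : Measurable f) (hf : Integrable f) :
    Tendsto (fun n => ∫⁻ t, ‖fwdAvg n f t - f t‖ₑ) atTop (𝓝 0) := by
  rw [ENNReal.tendsto_atTop_zero]
  intro ε hε
  have hε3 : ε / 3 ≠ 0 := (ENNReal.div_pos hε.ne' (by norm_num)).ne'
  obtain ⟨h, hh, hhi⟩ := hf.exists_boundedContinuous_lintegral_sub_le hε3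
  obtain ⟨N, hN⟩ := ENNReal.tendsto_atTop_zero.1
    (tendsto_lintegral_fwdAvg_of_continuous h.continuous) (ε / 3) (pos_iff_ne_zero.2 hε3)
  refine ⟨N, fun n hn => ?_⟩
  have hm := h.continuous.measurable
  have e : ∀ t, fwdAvg n f t - f t
      = fwdAvg n (fun r => f r - h r) t + (fwdAvg n h t - h t) + (h t - f t) := fun t => by
    have : fwdAvg n (fun r => f r - h r) t = fwdAvg n f t - fwdAvg n h t := by
      simp only [fwdAvg, mul_sub]
      exact integral_sub (integrable_avgKer_mul n t hf) (integrable_avgKer_mul n t hhi)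
    rw [this]; ring
  calc ∫⁻ t, ‖fwdAvg n f t - f t‖ₑ
      ≤ ∫⁻ t, (‖fwdAvg n (fun r => f r - h r) t‖ₑ + ‖fwdAvg n h t - h t‖ₑ + ‖f t - h t‖ₑ) := by
        refine lintegral_mono fun t => ?_
        rw [e, enorm_sub_rev (f t)]
        exact (enorm_add_le _ _).trans (add_le_add_left (enorm_add_le _ _) _)
    _ = (∫⁻ t, ‖fwdAvg n (fun r => f r - h r) t‖ₑ) + (∫⁻ t, ‖fwdAvg n h t - h t‖ₑ)
          + ∫⁻ t, ‖f t - h t‖ₑ := by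
        have m1 : Measurable fun t => ‖f t - h t‖ₑ := (hfm.sub hm).enorm
        have m2 : Measurable fun t => ‖fwdAvg n h t - h t‖ₑ :=
          ((measurable_fwdAvg n hm).sub hm).enorm
        rw [lintegral_add_right _ m1, lintegral_add_right _ m2]
    _ ≤ ε / 3 + ε / 3 + ε / 3 :=
        add_le_add (add_le_add ((lintegral_fwdAvg_le n (hfm.sub hm)).trans hh) (hN n hn)) hh
    _ = ε := ENNReal.add_thirds ε

end Averages

/-! ### From tests on the future to almost every single time -/

section FirstOrder

variable {T : ℝ} [Fact (0 < T)] {Ω : Type*} {mΩ : MeasurableSpace Ω} {P : Measure Ω}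
  [IsProbabilityMeasure P] {𝓕 : Filtration (Time T) mΩ}

theorem IsSqIntegrable.integrable_uncurry {g : Time T → Ω → ℝ} (hg : IsSqIntegrable P g) :
    Integrable (Function.uncurry g) (volume.prod P) :=
  ((isSqIntegrable_iff_memLp hg.measurable).1 hg).integrable (by norm_num)

theorem measurable_uncurry_fwdAvg (n : ℕ) {g : Time T → Ω → ℝ}
    (hg : Measurable (Function.uncurry g)) :
    Measurable (Function.uncurry fun t ω => fwdAvg n (fun r => g r ω) t) := by
  have : Measurable (Function.uncurry fun (p : Time T × Ω) (r : Time T) =>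
      avgKer n p.1 r * g r p.2) := by
    refine ((measurable_avgKer n).comp
      ((measurable_fst.comp measurable_fst).prodMk measurable_snd)).mul ?_
    exact hg.comp (measurable_snd.prodMk (measurable_snd.comp measurable_fst))
  exact this.stronglyMeasurable.integral_prod_right.measurable

/-- Pathwise convergence is integrated over `Ω` by dominated convergence; contraction supplies the
majorant `2 ∫|g|`. -/
theorem tendsto_lintegral_lintegral_fwdAvg {g : Time T → Ω → ℝ} (hg : IsSqIntegrable P g) :
    Tendsto (fun n => ∫⁻ t, ∫⁻ ω, ‖fwdAvg n (fun r => g r ω) t - g t ω‖ₑ ∂P) atTop (𝓝 0) := by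
  have hgm := hg.measurable
  have hm : ∀ n, Measurable (Function.uncurry fun t ω =>
      ‖fwdAvg n (fun r => g r ω) t - g t ω‖ₑ) := fun n =>
    ((measurable_uncurry_fwdAvg n hgm).sub hgm).enorm
  have hpath : ∀ ω, Measurable fun t => g t ω := fun ω =>
    hgm.comp (measurable_id.prodMk measurable_const)
  have hswap : ∀ n, ∫⁻ t, ∫⁻ ω, ‖fwdAvg n (fun r => g r ω) t - g t ω‖ₑ ∂P
      = ∫⁻ ω, (∫⁻ t, ‖fwdAvg n (fun r => g r ω) t - g t ω‖ₑ) ∂P := fun n =>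
    lintegral_lintegral_swap (hm n).aemeasurable
  simp_rw [hswap]
  have hfin : ∫⁻ ω, ((∫⁻ t, ‖g t ω‖ₑ) + ∫⁻ t, ‖g t ω‖ₑ) ∂P ≠ ∞ := by
    have h1 : ∫⁻ ω, (∫⁻ t, ‖g t ω‖ₑ) ∂P < ∞ := by
      have h2 := hg.integrable_uncurry.2
      rw [HasFiniteIntegral, lintegral_prod_symm _ hgm.enorm.aemeasurable] at h2
      exact h2
    have hm1 : Measurable fun ω => ∫⁻ t, ‖g t ω‖ₑ :=
      Measurable.lintegral_prod_left' (f := fun p => ‖g p.1 p.2‖ₑ) hgm.enorm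
    rw [lintegral_add_left hm1]
    exact (ENNReal.add_lt_top.2 ⟨h1, h1⟩).ne
  have := tendsto_lintegral_of_dominated_convergence (μ := P)
    (F := fun n ω => ∫⁻ t, ‖fwdAvg n (fun r => g r ω) t - g t ω‖ₑ) (f := fun _ => 0)
    (fun ω => (∫⁻ t, ‖g t ω‖ₑ) + ∫⁻ t, ‖g t ω‖ₑ)
    (fun n => Measurable.lintegral_prod_left' (hm n))
    (fun n => Eventually.of_forall fun ω => by
      change ∫⁻ t, ‖fwdAvg n (fun r => g r ω) t - g t ω‖ₑ ≤ _
      calc ∫⁻ t, ‖fwdAvg n (fun r => g r ω) t - g t ω‖ₑ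
          ≤ ∫⁻ t, (‖fwdAvg n (fun r => g r ω) t‖ₑ + ‖g t ω‖ₑ) :=
            lintegral_mono fun t => enorm_sub_le
        _ = (∫⁻ t, ‖fwdAvg n (fun r => g r ω) t‖ₑ) + ∫⁻ t, ‖g t ω‖ₑ :=
            lintegral_add_right _ (hpath ω).enorm
        _ ≤ _ := add_le_add (lintegral_fwdAvg_le n (hpath ω)) le_rfl)
    hfin
    (by
      filter_upwards [hg.ae_memLp] with ω hω
      exact tendsto_lintegral_fwdAvg (hpath ω) (hω.integrable (by norm_num)))
  simpa using this

theorem memLp_avgKer (n : ℕ) (t : Time T) : MemLp (fun r => avgKer n t r) 2 volume :=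
  MemLp.of_bound (measurable_avgKer n).of_uncurry_left.aestronglyMeasurable _
    (Eventually.of_forall fun r => norm_avgKer_le n t r)

theorem inner_cut_avgKer (n : ℕ) (t : Time T) {f : Time T → ℝ} (hf : MemLp f 2 volume) :
    inner ℝ (toL2 f) (cut t (toL2 fun r => avgKer n t r)) = fwdAvg n f t := by
  rw [inner_L2, fwdAvg]
  refine integral_congr_ae ?_
  filter_upwards [coeFn_toL2 hf, coeFn_cut t (toL2 fun r => avgKer n t r),
    coeFn_toL2 (memLp_avgKer n t)] with r h1 h2 h3
  rw [h1, h2, Set.indicator_apply]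
  split_ifs with h
  · rw [h3, mul_comm]
  · rw [avgKer, if_neg fun h' => h h'.1, mul_zero, zero_mul]

/-- A forward average at `t` is a pairing with a function supported on `[t,T]`, so its integral over
`F ∈ 𝓕_t` is zero. The error made on replacing `g_t` by its average is at most `E n t`, the same
bound for all `F`; thus the exceptional set of times does not depend on the event. -/
theorem ae_setIntegral_eq_zero {g : Time T → Ω → ℝ} (hg : IsSqIntegrable P g)
    (h0 : ∀ t F, MeasurableSet[𝓕 t] F → ∀ w : L2 T,
      ∫ ω in F, inner ℝ (pathL2 g ω) (cut t w) ∂P = 0) :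
    ∀ᵐ t, Integrable (g t) P ∧ ∀ F, MeasurableSet[𝓕 t] F → ∫ ω in F, g t ω ∂P = 0 := by
  set E : ℕ → Time T → ℝ≥0∞ := fun n t => ∫⁻ ω, ‖fwdAvg n (fun r => g r ω) t - g t ω‖ₑ ∂P
  have hE : ∀ n, Measurable (E n) := fun n =>
    Measurable.lintegral_prod_right'
      (f := fun p : Time T × Ω => ‖fwdAvg n (fun r => g r p.2) p.1 - g p.1 p.2‖ₑ)
      ((measurable_uncurry_fwdAvg n hg.measurable).sub hg.measurable).enorm
  -- Convergence in mean only gives almost everywhere convergence along a subsequence; the infimum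
  -- over `n` suffices and needs no such choice.
  have hinf : ∫⁻ t, ⨅ n, E n t = 0 := by
    refine le_antisymm (ge_of_tendsto (tendsto_lintegral_lintegral_fwdAvg hg)
      (Eventually.of_forall fun n => lintegral_mono fun t => iInf_le _ n)) zero_le
  rw [lintegral_eq_zero_iff (Measurable.iInf hE)] at hinf
  filter_upwards [hinf, hg.integrable_uncurry.prod_right_ae] with t ht hgt
  replace hgt : Integrable (g t) P := hgt
  refine ⟨hgt, fun F hF => ?_⟩
  have hF' : MeasurableSet F := 𝓕.le t F hF
  have hle : ∀ n, ‖∫ ω in F, g t ω ∂P‖ₑ ≤ E n t := fun n => by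
    have hae : (fun ω => fwdAvg n (fun r => g r ω) t)
        =ᵐ[P] fun ω => inner ℝ (pathL2 g ω) (cut t (toL2 fun r => avgKer n t r)) := by
      filter_upwards [hg.ae_memLp] with ω hω
      exact (inner_cut_avgKer n t hω).symm
    have hi : Integrable (fun ω => fwdAvg n (fun r => g r ω) t) P :=
      ((hg.memLp_pathL2.integrable (by norm_num)).inner_const _).congr hae.symm
    have hz : ∫ ω in F, fwdAvg n (fun r => g r ω) t ∂P = 0 := by
      rw [← h0 t F hF (toL2 fun r => avgKer n t r)]
      exact integral_congr_ae (ae_restrict_of_ae hae)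
    have hs : ∫ ω in F, g t ω ∂P = -∫ ω in F, (fwdAvg n (fun r => g r ω) t - g t ω) ∂P := by
      rw [integral_sub hi.integrableOn hgt.integrableOn, hz, zero_sub, neg_neg]
    rw [hs, enorm_neg]
    exact (enorm_integral_le_lintegral_enorm _).trans (setLIntegral_le_lintegral _ _)
  have h1 : ‖∫ ω in F, g t ω ∂P‖ₑ ≤ 0 := (le_iInf hle).trans (le_of_eq ht)
  exact enorm_eq_zero.1 (le_antisymm h1 zero_le)

/-! #### Test strategies -/

/-- The strategy that trades `w` after time `t` on the event `F`. -/
def testStrategy (t : Time T) (F : Set Ω) (w : L2 T) (r : Time T) (ω : Ω) : ℝ :=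
  open Classical in if t ≤ r ∧ ω ∈ F then w r else 0

theorem pathL2_testStrategy (t : Time T) (F : Set Ω) (w : L2 T) (ω : Ω) :
    pathL2 (testStrategy t F w) ω = F.indicator (fun _ => cut t w) ω := by
  by_cases hω : ω ∈ F
  · have h : (fun r => testStrategy t F w r ω) = (Set.Ici t).indicator w := by
      ext r
      simp [testStrategy, hω, Set.indicator_apply]
    rw [Set.indicator_of_mem hω, pathL2, h, cut,
      toL2_of_memLp ((Lp.memLp w).indicator measurableSet_Ici)]
  · have h : (fun r => testStrategy t F w r ω) = fun _ => 0 := by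
      ext r
      simp [testStrategy, hω]
    rw [Set.indicator_of_notMem hω, pathL2, h, toL2_of_memLp MemLp.zero']
    exact MemLp.toLp_zero _

/-- Nothing is traded before `t`, and from `t` on the event `F` is known, so no information is
anticipated. -/
theorem admissible_testStrategy {t : Time T} {F : Set Ω} (hF : MeasurableSet[𝓕 t] F) (w : L2 T) :
    Admissible P 𝓕 (testStrategy t F w) := by
  classical
  refine ⟨fun i => ?_, ?_⟩
  · by_cases hti : t ≤ i
    · have hs : MeasurableSet[Subtype.instMeasurableSpace.prod (𝓕 i)]
          {p : Set.Iic i × Ω | t ≤ (p.1 : Time T) ∧ p.2 ∈ F} := by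
        have h1 : MeasurableSet {s : Set.Iic i | t ≤ (s : Time T)} :=
          measurableSet_le measurable_const measurable_subtype_coe
        exact @MeasurableSet.prod _ _ _ (𝓕 i) _ _ h1 (𝓕.mono hti F hF)
      have hw : Measurable[Subtype.instMeasurableSpace.prod (𝓕 i)]
          fun p : Set.Iic i × Ω => w (p.1 : Time T) :=
        ((Lp.stronglyMeasurable w).measurable.comp measurable_subtype_coe).comp
          (@measurable_fst _ _ _ (𝓕 i))
      have e : (fun p : Set.Iic i × Ω => testStrategy t F w p.1 p.2)
          = {p : Set.Iic i × Ω | t ≤ (p.1 : Time T) ∧ p.2 ∈ F}.indicator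
            fun p => w (p.1 : Time T) := by
        ext p
        simp [testStrategy, Set.indicator_apply]
      rw [e]
      exact hw.indicator hs
    · have : (fun p : Set.Iic i × Ω => testStrategy t F w p.1 p.2) = fun _ => 0 := by
        ext p
        have : ¬ t ≤ (p.1 : Time T) := fun h => hti (h.trans p.1.2)
        simp [testStrategy, this]
      rw [this]
      exact @measurable_const _ _ _ (Subtype.instMeasurableSpace.prod (𝓕 i)) _
  · have hw := (memLp_two_iff'.1 (Lp.memLp w)).2
    calc ∫⁻ ω, (∫⁻ r, ‖testStrategy t F w r ω‖ₑ ^ 2) ∂P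
        ≤ ∫⁻ _, (∫⁻ r, ‖w r‖ₑ ^ 2) ∂P := by
          refine lintegral_mono fun ω => lintegral_mono fun r => ?_
          simp only [testStrategy]
          split_ifs
          · exact le_rfl
          · simp
      _ < ∞ := by rw [lintegral_const, measure_univ, mul_one]; exact hw

end FirstOrder

/-! ### The weak first order condition and its conditional form -/

section WeakSolution

variable {T : ℝ} [Fact (0 < T)] {Ω : Type*} {mΩ : MeasurableSpace Ω} {P : Measure Ω}
  [IsProbabilityMeasure P] {𝓕 : Filtration (Time T) mΩ} {A : Time T → Ω → ℝ}
  {φ ϱ q L : ℝ} {θ : ℝ × L2 T}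

/-- The signal `A_t - A_T`. -/
def signal (A : Time T → Ω → ℝ) (t : Time T) (ω : Ω) : ℝ := A t ω - A ⊤ ω

/-- At every time `|A_t - A_T|` is at most the total variation of the path. -/
theorem lintegral_signal_le (A : Time T → Ω → ℝ) :
    ∫⁻ ω, (∫⁻ t, ‖signal A t ω‖ₑ ^ 2) ∂P
      ≤ totalVariationMoment P A * volume (Set.univ : Set (Time T)) := by
  rw [totalVariationMoment, ← lintegral_mul_const' _ _ (measure_ne_top _ _)]
  refine lintegral_mono fun ω => ?_
  rw [← lintegral_const]
  refine lintegral_mono fun t => ?_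
  gcongr
  rw [signal, ← edist_eq_enorm_sub]
  exact eVariationOn.edist_le (fun t => A t ω) (Set.mem_univ t) (Set.mem_univ ⊤)

theorem isSqIntegrable_signal (hA : IsStronglyPredictable 𝓕 A)
    (hV : totalVariationMoment P A < ∞) : IsSqIntegrable P (signal A) := by
  have hm : Measurable (Function.uncurry A) :=
    hA.isStronglyProgressive.isProgressive.measurable_uncurry
  exact ⟨hm.sub (hm.comp (measurable_const.prodMk measurable_snd)),
    (lintegral_signal_le A).trans_lt (ENNReal.mul_lt_top hV (measure_lt_top _ _))⟩

/-- The linear part `2ϱq + 2φq 1^* 1` of the gradient of the objective. -/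
def linGain (φ ϱ q : ℝ) : L2 T :=
  (2 * ϱ * q) • constL2 1 + (2 * φ * q) • opOneAdj ⊥ (constL2 1)

/-- The pathwise gradient of the objective at the strategy `u`. -/
def gradPath (A : Time T → Ω → ℝ) (φ ϱ q : ℝ) (θ : ℝ × L2 T) (u : Time T → Ω → ℝ) (ω : Ω) : L2 T :=
  pathL2 (signal A) ω + linGain φ ϱ q - opD φ ϱ θ ⊥ (pathL2 u ω)

/-- The first order condition in weak form. -/
def IsWeakSol (P : Measure Ω) (𝓕 : Filtration (Time T) mΩ) (A : Time T → Ω → ℝ) (φ ϱ q : ℝ)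
    (θ : ℝ × L2 T) (u : Time T → Ω → ℝ) : Prop :=
  ∀ v, Admissible P 𝓕 v → ∫ ω, inner ℝ (gradPath A φ ϱ q θ u ω) (pathL2 v ω) ∂P = 0

theorem memLp_gradPath (hS : IsSqIntegrable P (signal A)) {u : Time T → Ω → ℝ}
    (hu : IsSqIntegrable P u) : MemLp (gradPath A φ ϱ q θ u) 2 P :=
  (hS.memLp_pathL2.add (memLp_const (linGain φ ϱ q))).sub
    ((opD φ ϱ θ ⊥).comp_memLp' hu.memLp_pathL2)

theorem norm_sq_Lp_eq (F : Lp (L2 T) 2 P) : ‖F‖ ^ 2 = ∫ ω, ‖F ω‖ ^ 2 ∂P := by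
  rw [← real_inner_self_eq_norm_sq, L2.inner_def]
  simp only [real_inner_self_eq_norm_sq]

theorem coercive_compLpL {D : L2 T →L[ℝ] L2 T} {c : ℝ}
    (h : ∀ f, c * ‖f‖ ^ 2 ≤ inner ℝ (D f) f) (F : Lp (L2 T) 2 P) :
    c * ‖F‖ ^ 2 ≤ inner ℝ (D.compLpL 2 P F) F := by
  have hi : Integrable (fun ω => ‖F ω‖ ^ 2) P := by
    have := L2.integrable_inner (𝕜 := ℝ) F F
    simpa only [real_inner_self_eq_norm_sq] using this
  rw [norm_sq_Lp_eq, L2.inner_def, ← integral_const_mul]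
  refine integral_mono_ae (hi.const_mul c) (L2.integrable_inner _ _) ?_
  filter_upwards [ContinuousLinearMap.coeFn_compLpL (p := 2) (μ := P) D F] with ω hω
  change c * ‖F ω‖ ^ 2 ≤ inner ℝ ((D.compLpL 2 P F) ω) (F ω)
  rw [hω]
  exact h _

/-- With `J` the isometric embedding of the strategies into `L²(Ω; L²([0,T]))`, the compression `J^*
D J` inherits coercivity. Solving `J^* D J x = J^* ℓ` says that `ℓ - D J x` is orthogonal to the
range of `J`. -/
theorem exists_isWeakSol (h : IsCoerciveModel φ ϱ L θ) (hS : IsSqIntegrable P (signal A)) (q : ℝ) :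
    ∃ u, Admissible P 𝓕 u ∧ IsWeakSol P 𝓕 A φ ϱ q θ u := by
  set J : Strategies P 𝓕 →L[ℝ] Lp (L2 T) 2 P := (strategyPath P 𝓕).toContinuousLinearMap
  set D := (opD φ ϱ θ ⊥).compLpL 2 P
  have hℓ : MemLp (fun ω => pathL2 (signal A) ω + linGain φ ϱ q) 2 P :=
    hS.memLp_pathL2.add (memLp_const (linGain φ ϱ q))
  obtain ⟨e, he⟩ := exists_equiv_of_coercive
    (ContinuousLinearMap.adjoint J ∘L D ∘L J) (inv_pos.2 h.pos) (fun x => by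
      have h1 := coercive_compLpL (P := P) (h.coercive ⊥) (J x)
      have h2 : ‖J x‖ = ‖x‖ := (strategyPath P 𝓕).norm_map x
      rw [h2] at h1
      rw [ContinuousLinearMap.comp_apply, ContinuousLinearMap.adjoint_inner_left]
      exact h1)
  set x := e.symm (ContinuousLinearMap.adjoint J hℓ.toLp) with hx
  have hx' : ContinuousLinearMap.adjoint J (D (J x)) = ContinuousLinearMap.adjoint J hℓ.toLp := by
    have : (e : Strategies P 𝓕 →L[ℝ] Strategies P 𝓕) x = ContinuousLinearMap.adjoint J hℓ.toLp :=
      e.apply_symm_apply _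
    rw [he] at this
    exact this
  refine ⟨strategyRep x, admissible_strategyRep x, fun v hv => ?_⟩
  obtain ⟨y, hy⟩ := exists_strategyPath_eq hv
  have h0 : inner ℝ (hℓ.toLp - D (J x)) (J y) = 0 := by
    rw [← ContinuousLinearMap.adjoint_inner_left, map_sub, hx', sub_self, inner_zero_left]
  rw [L2.inner_def] at h0
  rw [← h0]
  refine integral_congr_ae ?_
  filter_upwards [hy, coeFn_strategyPath x, Lp.coeFn_sub hℓ.toLp (D (J x)), hℓ.coeFn_toLp,
    ContinuousLinearMap.coeFn_compLpL (p := 2) (μ := P) (opD φ ϱ θ ⊥) (J x)] with ω h1 h2 h3 h4 h5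
  have h2' : (J x) ω = pathL2 (strategyRep x) ω := h2
  have h1' : (J y) ω = pathL2 v ω := h1
  rw [h3, Pi.sub_apply, h4, h5, h1', h2', gradPath]

/-! #### Consequences of the weak first order condition -/

theorem IsWeakSol.setIntegral_inner_cut {u : Time T → Ω → ℝ}
    (hw : IsWeakSol P 𝓕 A φ ϱ q θ u) {t : Time T} {F : Set Ω} (hF : MeasurableSet[𝓕 t] F)
    (w : L2 T) : ∫ ω in F, inner ℝ (gradPath A φ ϱ q θ u ω) (cut t w) ∂P = 0 := by
  rw [← hw _ (admissible_testStrategy hF w), ← integral_indicator (𝓕.le t F hF)]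
  refine integral_congr_ae (Eventually.of_forall fun ω => ?_)
  simp only [pathL2_testStrategy]
  by_cases hω : ω ∈ F
  · rw [Set.indicator_of_mem hω, Set.indicator_of_mem hω]
  · rw [Set.indicator_of_notMem hω, Set.indicator_of_notMem hω, inner_zero_right]

/-- Testing against `1_F cut_t w` for all `F ∈ 𝓕_t` and all `w` says that the future part of the
gradient has zero conditional expectation; this passes through bounded operators, here `D_0` and
truncation. -/
theorem IsWeakSol.cut_opD_condExp (hS : IsSqIntegrable P (signal A)) {u : Time T → Ω → ℝ}
    (hu : IsSqIntegrable P u) (hw : IsWeakSol P 𝓕 A φ ϱ q θ u) (t : Time T) :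
    ∀ᵐ ω ∂P, cut t (opD φ ϱ θ ⊥ ((P[pathL2 u | 𝓕 t]) ω))
      = cut t (condSignal P 𝓕 A t ω + (2 * ϱ * q) • constL2 1
          + (2 * φ * q) • opOneAdj ⊥ (constL2 1)) := by
  have hiS : Integrable (pathL2 (signal A)) P := hS.memLp_pathL2.integrable (by norm_num)
  have hiU : Integrable (pathL2 u) P := hu.memLp_pathL2.integrable (by norm_num)
  have hig : Integrable (gradPath A φ ϱ q θ u) P :=
    (memLp_gradPath hS hu).integrable (by norm_num)
  have h0 : (fun _ => (0 : L2 T)) =ᵐ[P] P[cutL t ∘ gradPath A φ ϱ q θ u | 𝓕 t] := by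
    refine ae_eq_condExp_of_forall_setIntegral_eq (𝓕.le t) ((cutL t).integrable_comp hig)
      (fun s _ _ => integrableOn_zero) (fun F hF _ => ?_) aestronglyMeasurable_const
    rw [integral_zero, eq_comm]
    refine ext_inner_left ℝ fun w => ?_
    have hic : Integrable (fun ω => cutL t (gradPath A φ ϱ q θ u ω)) P :=
      (cutL t).integrable_comp hig
    change inner ℝ w (∫ ω in F, cutL t (gradPath A φ ϱ q θ u ω) ∂P) = _
    rw [inner_zero_right, ← integral_inner hic.integrableOn, ← hw.setIntegral_inner_cut hF w]
    refine integral_congr_ae (Eventually.of_forall fun ω => ?_)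
    simp only [cutL_apply]
    rw [real_inner_comm, inner_cut_left]
  have e1 : P[gradPath A φ ϱ q θ u | 𝓕 t] =ᵐ[P] P[pathL2 (signal A) + fun _ => linGain φ ϱ q | 𝓕 t]
      - P[opD φ ϱ θ ⊥ ∘ pathL2 u | 𝓕 t] :=
    condExp_sub (hiS.add (integrable_const (linGain φ ϱ q)))
      ((opD φ ϱ θ ⊥).integrable_comp hiU) (𝓕 t)
  have e2 := condExp_add hiS (integrable_const (linGain φ ϱ q)) (𝓕 t) (μ := P)
  rw [condExp_const (𝓕.le t)] at e2
  filter_upwards [h0, (cutL t).comp_condExp_comm hig (m := 𝓕 t), e1, e2,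
    (opD φ ϱ θ ⊥).comp_condExp_comm hiU (m := 𝓕 t)] with ω a1 a2 a3 a4 a5
  rw [← a2, Function.comp_apply, a3, Pi.sub_apply, a4, ← a5, cutL_apply, cut_sub,
    eq_comm, sub_eq_zero] at a1
  rw [add_assoc]
  exact a1.symm

theorem measurable_past {m : MeasurableSpace Ω} {u : Time T → Ω → ℝ} {t : Time T}
    (h : Measurable fun p : Set.Iic t × Ω => u p.1 p.2) :
    Measurable (Function.uncurry fun s ω => if s < t then u s ω else 0) := by
  -- Progressive measurability speaks only of times in `Set.Iic t`; clamping the time at `t` extends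
  -- the process, and the values from `t` on are then discarded.
  have h1 : Measurable fun p : Time T × Ω =>
      ((⟨min p.1 t, Set.mem_Iic.2 (min_le_right _ _)⟩ : Set.Iic t), p.2) :=
    (measurable_fst.min measurable_const).subtype_mk.prodMk measurable_snd
  have h2 := (h.comp h1).indicator
    (measurableSet_lt measurable_fst (measurable_const (a := t)) : MeasurableSet
      {p : Time T × Ω | p.1 < t})
  refine (congrArg _ ?_).mp h2
  ext ⟨s, ω⟩
  simp only [Set.indicator_apply, Set.mem_ofPred_eq, Function.uncurry, Function.comp_apply]
  split_ifs with hs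
  · rw [min_eq_left hs.le]
  · rfl

theorem memLp_past {f : Time T → ℝ} (hf : MemLp f 2 volume) (t : Time T) :
    MemLp (fun s => if s < t then f s else 0) 2 volume := by
  have e : (fun s => if s < t then f s else 0) = (Set.Iio t).indicator f := by
    ext s; simp [Set.indicator_apply]
  rw [e]
  exact hf.indicator measurableSet_Iio

theorem toL2_past {f : Time T → ℝ} (hf : MemLp f 2 volume) (t : Time T) :
    toL2 f - cut t (toL2 f) = toL2 fun s => if s < t then f s else 0 := by
  refine Lp.ext ?_
  filter_upwards [Lp.coeFn_sub (toL2 f) (cut t (toL2 f)), coeFn_cut t (toL2 f),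
    coeFn_toL2 hf, coeFn_toL2 (memLp_past hf t)] with s h3 h4 h5 h6
  rw [h3, Pi.sub_apply, h4, h6, Set.indicator_apply]
  by_cases hs : s < t
  · rw [if_pos hs, if_neg (show s ∉ Set.Ici t from not_le.2 hs), sub_zero, h5]
  · rw [if_neg hs, if_pos (show s ∈ Set.Ici t from not_lt.1 hs), sub_self]

/-- The process killed at `t` is jointly measurable with respect to `𝓕 t` on `Ω`; its path in `L²`
is thus an `𝓕 t`-measurable version of the past. -/
theorem Admissible.past_aestronglyMeasurable {u : Time T → Ω → ℝ} (hu : Admissible P 𝓕 u)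
    (t : Time T) :
    AEStronglyMeasurable[𝓕 t] (fun ω => pathL2 u ω - cut t (pathL2 u ω)) P := by
  refine ⟨pathL2 fun s ω => if s < t then u s ω else 0,
    @stronglyMeasurable_pathL2 T _ Ω (𝓕 t) _ (measurable_past (hu.1 t)), ?_⟩
  filter_upwards [hu.isSqIntegrable.ae_memLp] with ω hω
  exact toL2_past hω t

theorem Admissible.condExp_past {u : Time T → Ω → ℝ} (hu : Admissible P 𝓕 u) (t : Time T) :
    ∀ᵐ ω ∂P, (P[pathL2 u | 𝓕 t]) ω - cut t ((P[pathL2 u | 𝓕 t]) ω)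
      = pathL2 u ω - cut t (pathL2 u ω) := by
  have hiU : Integrable (pathL2 u) P := hu.isSqIntegrable.memLp_pathL2.integrable (by norm_num)
  set R : L2 T →L[ℝ] L2 T := ContinuousLinearMap.id ℝ (L2 T) - cutL t
  filter_upwards [R.comp_condExp_comm hiU (m := 𝓕 t),
    condExp_of_aestronglyMeasurable' (𝓕.le t) (hu.past_aestronglyMeasurable t)
      (R.integrable_comp hiU)] with ω h1 h2
  exact h1.trans h2

end WeakSolution

/-! ### The weak solution is a greedy control -/

section Existence

variable {T : ℝ} [Fact (0 < T)] {Ω : Type*} {mΩ : MeasurableSpace Ω} {P : Measure Ω}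
  [IsProbabilityMeasure P] {𝓕 : Filtration (Time T) mΩ} {A : Time T → Ω → ℝ}
  {φ ϱ q L : ℝ} {θ : ℝ × L2 T}

theorem opD_bot_coeFn (φ ϱ : ℝ) (θ : ℝ × L2 T) (x : L2 T) :
    opD φ ϱ θ ⊥ x =ᵐ[volume] fun s => 2 * θ.1 * x s
      + (inner ℝ (tildeGRow ϱ θ.2 s) x + inner ℝ (tildeGCol ϱ θ.2 s) x)
      + 2 * φ * inner ℝ (cut s (constL2 1)) (opOne ⊥ x) := by
  rw [opD_bot_apply]
  filter_upwards [Lp.coeFn_add ((2 * θ.1) • x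
      + (opG ϱ θ.2 ⊥ x + ContinuousLinearMap.adjoint (opG ϱ θ.2 ⊥) x))
      ((2 * φ) • opOneAdj ⊥ (opOne ⊥ x)),
    Lp.coeFn_add ((2 * θ.1) • x) (opG ϱ θ.2 ⊥ x + ContinuousLinearMap.adjoint (opG ϱ θ.2 ⊥) x),
    Lp.coeFn_add (opG ϱ θ.2 ⊥ x) (ContinuousLinearMap.adjoint (opG ϱ θ.2 ⊥) x),
    Lp.coeFn_smul (2 * θ.1) x, Lp.coeFn_smul (2 * φ) (opOneAdj ⊥ (opOne ⊥ x)),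
    opG_bot_coeFn ϱ θ.2 x, adjoint_opG_bot_coeFn ϱ θ.2 x, opOneAdj_bot_coeFn (opOne ⊥ x)]
    with s h1 h2 h3 h4 h5 h6 h7 h8
  rw [h1, Pi.add_apply, h2, Pi.add_apply, h3, Pi.add_apply, h4, h5, Pi.smul_apply, Pi.smul_apply,
    h6, h7, h8, smul_eq_mul, smul_eq_mul]

theorem linGain_coeFn (φ ϱ q : ℝ) :
    (linGain φ ϱ q : L2 T) =ᵐ[volume] fun s => 2 * ϱ * q
      + 2 * φ * q * inner ℝ (cut s (constL2 1)) (constL2 1 : L2 T) := by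
  rw [linGain]
  filter_upwards [Lp.coeFn_add ((2 * ϱ * q) • (constL2 1 : L2 T))
      ((2 * φ * q) • opOneAdj ⊥ (constL2 1)),
    Lp.coeFn_smul (2 * ϱ * q) (constL2 1 : L2 T),
    Lp.coeFn_smul (2 * φ * q) (opOneAdj ⊥ (constL2 1 : L2 T)), coeFn_constL2 (T := T) 1,
    opOneAdj_bot_coeFn (constL2 1 : L2 T)] with s h1 h2 h3 h4 h5
  rw [h1, Pi.add_apply, h2, h3, Pi.smul_apply, Pi.smul_apply, h4, h5, smul_eq_mul, smul_eq_mul,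
    mul_one]

/-- The rows form a random path in which `t` takes the role of the sample point. -/
theorem stronglyMeasurable_tildeGRow (ϱ : ℝ) (G : L2 T) : StronglyMeasurable (tildeGRow ϱ G) := by
  have e : tildeGRow ϱ G = pathL2 fun s t => tildeG ϱ G t s := by
    ext1 t
    rw [pathL2, toL2_of_memLp (memLp_tildeG_row ϱ G t), tildeGRow]
  rw [e]
  exact stronglyMeasurable_pathL2 ((measurable_tildeG ϱ G).comp measurable_swap)

theorem stronglyMeasurable_tildeGCol (ϱ : ℝ) (G : L2 T) : StronglyMeasurable (tildeGCol ϱ G) := by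
  have e : tildeGCol ϱ G = pathL2 fun s t => tildeG ϱ G s t := by
    ext1 t
    rw [pathL2, toL2_of_memLp (memLp_tildeG_col ϱ G t), tildeGCol]
  rw [e]
  exact stronglyMeasurable_pathL2 (measurable_tildeG ϱ G)

theorem stronglyMeasurable_cut (f : L2 T) : StronglyMeasurable fun t => cut t f := by
  have e : (fun t => cut t f) = pathL2 fun s t => (Set.Ici t).indicator f s := by
    ext1 t
    rw [pathL2, toL2_of_memLp ((Lp.memLp f).indicator measurableSet_Ici), cut]
  rw [e]
  refine stronglyMeasurable_pathL2 ?_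
  have : (Function.uncurry fun s t => (Set.Ici t).indicator f s)
      = {p : Time T × Time T | p.2 ≤ p.1}.indicator fun p => f p.1 := by
    ext ⟨s, t⟩
    simp [Set.indicator_apply]
  rw [this]
  exact ((Lp.stronglyMeasurable f).measurable.comp measurable_fst).indicator
    (measurableSet_le measurable_snd measurable_fst)

/-- The gradient of the objective at time `t`. -/
def gradAt (A : Time T → Ω → ℝ) (φ ϱ q : ℝ) (θ : ℝ × L2 T) (u : Time T → Ω → ℝ) (t : Time T)
    (ω : Ω) : ℝ :=
  signal A t ω + (2 * ϱ * q + 2 * φ * q * inner ℝ (cut t (constL2 1)) (constL2 1 : L2 T))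
    - (2 * θ.1 * u t ω + (inner ℝ (tildeGRow ϱ θ.2 t) (pathL2 u ω)
        + inner ℝ (tildeGCol ϱ θ.2 t) (pathL2 u ω))
      + 2 * φ * inner ℝ (cut t (constL2 1)) (opOne ⊥ (pathL2 u ω)))

theorem measurable_gradAt (hS : IsSqIntegrable P (signal A)) {u : Time T → Ω → ℝ}
    (hu : IsSqIntegrable P u) : Measurable (Function.uncurry (gradAt A φ ϱ q θ u)) := by
  have hU := stronglyMeasurable_pathL2 hu.measurable
  have hOU : StronglyMeasurable fun ω => opOne ⊥ (pathL2 u ω) :=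
    (opOne ⊥ : L2 T →L[ℝ] L2 T).continuous.comp_stronglyMeasurable hU
  have h1 : ∀ {f : Time T → L2 T} {g : Ω → L2 T}, StronglyMeasurable f → StronglyMeasurable g →
      Measurable fun p : Time T × Ω => (inner ℝ (f p.1) (g p.2) : ℝ) := fun hf hg =>
    ((hf.comp_measurable measurable_fst).inner (hg.comp_measurable measurable_snd)).measurable
  have h2 : Measurable fun p : Time T × Ω => (inner ℝ (cut p.1 (constL2 1)) (constL2 1 : L2 T) : ℝ) :=
    h1 (stronglyMeasurable_cut _) (stronglyMeasurable_const (b := (constL2 1 : L2 T)))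
  exact (hS.measurable.add ((h2.const_mul _).const_add _)).sub
    (((hu.measurable.const_mul _).add ((h1 (stronglyMeasurable_tildeGRow ϱ θ.2) hU).add
      (h1 (stronglyMeasurable_tildeGCol ϱ θ.2) hU))).add
        ((h1 (stronglyMeasurable_cut _) hOU).const_mul _))

/-- `gradPath` is only a class in `L²`; `gradAt` is a jointly measurable version that may be
evaluated and conditioned at a fixed time. -/
theorem gradAt_ae_eq (hS : IsSqIntegrable P (signal A)) {u : Time T → Ω → ℝ}
    (hu : IsSqIntegrable P u) :
    ∀ᵐ ω ∂P, gradPath A φ ϱ q θ u ω =ᵐ[volume] fun t => gradAt A φ ϱ q θ u t ω := by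
  filter_upwards [hS.ae_memLp, hu.ae_memLp] with ω h1 h2
  filter_upwards [coeFn_toL2 h1, coeFn_toL2 h2, opD_bot_coeFn φ ϱ θ (pathL2 u ω),
    linGain_coeFn (T := T) φ ϱ q, Lp.coeFn_add (pathL2 (signal A) ω) (linGain φ ϱ q),
    Lp.coeFn_sub (pathL2 (signal A) ω + linGain φ ϱ q) (opD φ ϱ θ ⊥ (pathL2 u ω))]
    with t a1 a2 a3 a4 a5 a6
  have a1' : pathL2 (signal A) ω t = signal A t ω := a1
  have a2' : pathL2 u ω t = u t ω := a2
  rw [gradPath, a6, Pi.sub_apply, a5, Pi.add_apply, a3, a4, a1', a2', gradAt]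

theorem isSqIntegrable_gradAt (hS : IsSqIntegrable P (signal A)) {u : Time T → Ω → ℝ}
    (hu : IsSqIntegrable P u) : IsSqIntegrable P (gradAt A φ ϱ q θ u) := by
  refine ⟨measurable_gradAt hS hu, ?_⟩
  have h := (memLp_gradPath (φ := φ) (ϱ := ϱ) (q := q) (θ := θ) hS hu).2
  rw [eLpNorm_lt_top_iff_lintegral_rpow_enorm_lt_top (by norm_num) (by norm_num)] at h
  simp only [ENNReal.toReal_ofNat, ENNReal.rpow_ofNat] at h
  refine lt_of_eq_of_lt (lintegral_congr_ae ?_) h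
  filter_upwards [gradAt_ae_eq (φ := φ) (ϱ := ϱ) (q := q) (θ := θ) hS hu] with ω hω
  have h2 : MemLp (fun t => gradAt A φ ϱ q θ u t ω) 2 volume :=
    (memLp_congr_ae hω).1 (Lp.memLp _)
  rw [← enorm_toL2_sq h2]
  congr 2
  refine Lp.ext ((coeFn_toL2 h2).trans hω.symm)

theorem pathL2_gradAt (hS : IsSqIntegrable P (signal A)) {u : Time T → Ω → ℝ}
    (hu : IsSqIntegrable P u) :
    pathL2 (gradAt A φ ϱ q θ u) =ᵐ[P] gradPath A φ ϱ q θ u := by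
  filter_upwards [gradAt_ae_eq (φ := φ) (ϱ := ϱ) (q := q) (θ := θ) hS hu,
    (isSqIntegrable_gradAt (φ := φ) (ϱ := ϱ) (q := q) (θ := θ) hS hu).ae_memLp] with ω h1 h2
  exact Lp.ext ((coeFn_toL2 h2).trans h1.symm)

/-- The rate `u_t` and the row term are known at time `t`, the latter because a row only sees the
past. The column and inventory terms involve the future and are handled as one bounded functional
that commutes with conditioning. -/
theorem condExp_gradAt {u : Time T → Ω → ℝ} (hu : Admissible P 𝓕 u) {t : Time T}
    (hSt : Integrable (signal A t) P) (hut : Integrable (u t) P) :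
    ∀ᵐ ω ∂P, (P[gradAt A φ ϱ q θ u t | 𝓕 t]) ω = (P[signal A t | 𝓕 t]) ω
      + (2 * ϱ * q + 2 * φ * q * inner ℝ (cut t (constL2 1)) (constL2 1 : L2 T))
      - (2 * θ.1 * u t ω + (inner ℝ (tildeGRow ϱ θ.2 t) (pathL2 u ω)
          + inner ℝ (tildeGCol ϱ θ.2 t) ((P[pathL2 u | 𝓕 t]) ω))
        + 2 * φ * inner ℝ (cut t (constL2 1)) (opOne ⊥ ((P[pathL2 u | 𝓕 t]) ω))) := by
  have hiU : Integrable (pathL2 u) P := hu.isSqIntegrable.memLp_pathL2.integrable (by norm_num)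
  set c : ℝ := 2 * ϱ * q + 2 * φ * q * inner ℝ (cut t (constL2 1)) (constL2 1 : L2 T)
  set Λ : L2 T →L[ℝ] ℝ := innerSL ℝ (tildeGCol ϱ θ.2 t)
    + (2 * φ) • (innerSL ℝ (cut t (constL2 1))).comp (opOne ⊥)
  set b : Ω → ℝ := fun ω => c - 2 * θ.1 * u t ω - inner ℝ (tildeGRow ϱ θ.2 t) (pathL2 u ω)
  have hΛ : ∀ x, Λ x = inner ℝ (tildeGCol ϱ θ.2 t) x
      + 2 * φ * inner ℝ (cut t (constL2 1)) (opOne ⊥ x) := fun x => rfl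
  have hrow : ∀ x : L2 T, inner ℝ (tildeGRow ϱ θ.2 t) x
      = inner ℝ (tildeGRow ϱ θ.2 t) (x - cut t x) := fun x => by
    rw [inner_sub_right, ← inner_cut_left, cut_tildeGRow, inner_zero_left, sub_zero]
  have hbi : Integrable b P :=
    ((integrable_const c).sub (hut.const_mul _)).sub (hiU.const_inner _)
  have hbm : AEStronglyMeasurable[𝓕 t] b P := by
    have h1 : AEStronglyMeasurable[𝓕 t] (u t) P :=
      (hu.1.adapted t).stronglyMeasurable.aestronglyMeasurable
    have h2 : AEStronglyMeasurable[𝓕 t]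
        (fun ω => inner ℝ (tildeGRow ϱ θ.2 t) (pathL2 u ω)) P := by
      rw [funext fun ω => hrow (pathL2 u ω)]
      exact (innerSL ℝ (tildeGRow ϱ θ.2 t)).continuous.comp_aestronglyMeasurable
        (hu.past_aestronglyMeasurable t)
    exact (aestronglyMeasurable_const.sub (h1.const_mul _)).sub h2
  have e : gradAt A φ ϱ q θ u t = (signal A t + b) - Λ ∘ pathL2 u := by
    ext ω
    simp only [Pi.sub_apply, Pi.add_apply, Function.comp_apply, hΛ, b, gradAt]
    ring
  rw [e]
  filter_upwards [condExp_sub (hSt.add hbi) (Λ.integrable_comp hiU) (𝓕 t), condExp_add hSt hbi (𝓕 t),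
    condExp_of_aestronglyMeasurable' (𝓕.le t) hbm hbi, Λ.comp_condExp_comm hiU (m := 𝓕 t)]
    with ω h1 h2 h3 h4
  refine h1.trans ?_
  rw [Pi.sub_apply, h2, Pi.add_apply, h3]
  have h4' : (P[fun ω => Λ (pathL2 u ω) | 𝓕 t]) ω = Λ ((P[pathL2 u | 𝓕 t]) ω) := h4.symm
  rw [h4', hΛ]
  simp only [b]
  ring

theorem IsWeakSol.isGreedy (h : IsCoerciveModel φ ϱ L θ) (hS : IsSqIntegrable P (signal A))
    {u : Time T → Ω → ℝ} (hu : Admissible P 𝓕 u) (hw : IsWeakSol P 𝓕 A φ ϱ q θ u) :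
    IsGreedy P 𝓕 A φ ϱ q θ u := by
  refine ⟨hu, ?_⟩
  have hus := hu.isSqIntegrable
  have hg := isSqIntegrable_gradAt (φ := φ) (ϱ := ϱ) (q := q) (θ := θ) hS hus
  have h0 : ∀ t F, MeasurableSet[𝓕 t] F → ∀ w : L2 T,
      ∫ ω in F, inner ℝ (pathL2 (gradAt A φ ϱ q θ u) ω) (cut t w) ∂P = 0 := fun t F hF w => by
    rw [← hw.setIntegral_inner_cut hF w]
    refine integral_congr_ae (ae_restrict_of_ae ?_)
    filter_upwards [pathL2_gradAt (φ := φ) (ϱ := ϱ) (q := q) (θ := θ) hS hus] with ω hω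
    rw [hω]
  filter_upwards [ae_setIntegral_eq_zero hg h0, hS.integrable_uncurry.prod_right_ae,
    hus.integrable_uncurry.prod_right_ae] with t ht hSt hut
  have hz : (fun _ => (0 : ℝ)) =ᵐ[P] P[gradAt A φ ϱ q θ u t | 𝓕 t] := by
    refine ae_eq_condExp_of_forall_setIntegral_eq (𝓕.le t) ht.1
      (fun s _ _ => integrableOn_zero) (fun F hF _ => ?_) aestronglyMeasurable_const
    rw [integral_zero, ht.2 F hF]
  filter_upwards [hz, condExp_gradAt (φ := φ) (ϱ := ϱ) (q := q) (θ := θ) hu hSt hut,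
    hw.cut_opD_condExp hS hus t, hu.condExp_past t, hus.ae_memLp] with ω a1 a2 a3 a4 a5
  rw [setIntegral_kerB_of_memLp φ ϱ θ t a5]
  -- Here `m` is the conditional expectation of the path given `𝓕 t` at `ω`; `a4` identifies its
  -- past, `a3` its future.
  refine greedy_of_firstOrder h a4 a3 (α := (P[signal A t | 𝓕 t]) ω) ?_
  rw [a2] at a1
  change _ = _ + 2 * ϱ * q + _ - inner ℝ (tildeGRow ϱ θ.2 t) (pathL2 u ω) - _ - _
  linarith

end Existence

/-! ### Uniqueness by an exponentially weighted Gronwall argument -/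

section Uniqueness

variable {T : ℝ} [Fact (0 < T)]

/-! #### Uniqueness for the Volterra equation -/

theorem lintegral_exp_weight_le {κ : ℝ} (hκ : 0 < κ) (s : Time T) :
    ∫⁻ t in Set.Ici s, ENNReal.ofReal (Real.exp (-κ * t))
      ≤ ENNReal.ofReal (1 / κ) * ENNReal.ofReal (Real.exp (-κ * s)) := by
  have hi := integrableOn_exp_mul_Ioi (neg_neg_of_pos hκ) (s : ℝ)
  have h1 : ∫⁻ t in Set.Ici s, ENNReal.ofReal (Real.exp (-κ * t))
      = ∫⁻ t : Time T, (Set.Ici (s : ℝ)).indicator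
          (fun x => ENNReal.ofReal (Real.exp (-κ * x))) (t : ℝ) := by
    rw [← lintegral_indicator measurableSet_Ici]
    rfl
  rw [h1, lintegral_Time (fun x => (Set.Ici (s : ℝ)).indicator
          (fun x => ENNReal.ofReal (Real.exp (-κ * x))) x)]
  refine (setLIntegral_le_lintegral _ _).trans ?_
  rw [lintegral_indicator measurableSet_Ici, setLIntegral_congr Ioi_ae_eq_Ici.symm,
    ← ofReal_integral_eq_lintegral_ofReal hi (Eventually.of_forall fun x => (Real.exp_pos _).le),
    integral_exp_mul_Ioi (neg_neg_of_pos hκ), ← ENNReal.ofReal_mul (by positivity)]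
  refine le_of_eq (congrArg _ ?_)
  field_simp

theorem ae_eq_zero_of_volterra_le {e : Time T → ℝ≥0∞} (he : Measurable e)
    (hfin : ∫⁻ t, e t ≠ ∞) {β : ℝ} (hβ : 0 ≤ β)
    (h : ∀ᵐ t, e t ≤ ENNReal.ofReal β * ∫⁻ s in Set.Iic t, e s) : e =ᵐ[volume] 0 := by
  -- Any rate above `β` works: the weighted mass `N` then satisfies `N ≤ (β/κ) N` with `β/κ < 1`.
  -- The shift by one keeps `κ` positive when `β = 0`.
  set κ : ℝ := 2 * (β + 1) with hκ
  have hκ0 : 0 < κ := by positivity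
  set w : Time T → ℝ≥0∞ := fun t => ENNReal.ofReal (Real.exp (-κ * t)) with hw
  have hwm : Measurable w := by
    have : Measurable fun t : Time T => (t : ℝ) := measurable_subtype_coe
    fun_prop
  have hw1 : ∀ t, w t ≤ 1 := fun t => by
    rw [hw]
    simp only [ENNReal.ofReal_le_one, Real.exp_le_one_iff]
    nlinarith [t.2.1, mul_nonneg hκ0.le t.2.1]
  set N := ∫⁻ t, w t * e t with hN
  have hNfin : N ≠ ∞ := by
    refine ne_top_of_le_ne_top hfin (lintegral_mono fun t => ?_)
    exact mul_le_of_le_one_left (zero_le) (hw1 t)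
  have hmeas : Measurable fun p : Time T × Time T =>
      w p.1 * {p : Time T × Time T | p.2 ≤ p.1}.indicator (fun p => e p.2) p :=
    (hwm.comp measurable_fst).mul ((he.comp measurable_snd).indicator
      (measurableSet_le measurable_snd measurable_fst))
  have h1 : N ≤ ENNReal.ofReal (β / κ) * N := by
    calc N ≤ ∫⁻ t, w t * (ENNReal.ofReal β * ∫⁻ s in Set.Iic t, e s) := by
          refine lintegral_mono_ae ?_
          filter_upwards [h] with t ht
          gcongr
      _ = ENNReal.ofReal β * ∫⁻ t, ∫⁻ s,
            w t * {p : Time T × Time T | p.2 ≤ p.1}.indicator (fun p => e p.2) (t, s) := by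
          rw [← lintegral_const_mul' _ _ ENNReal.ofReal_ne_top]
          refine lintegral_congr fun t => ?_
          rw [lintegral_const_mul' _ _ ENNReal.ofReal_ne_top,
            ← lintegral_indicator measurableSet_Iic, mul_left_comm]
          rfl
      _ = ENNReal.ofReal β * ∫⁻ s, ∫⁻ t,
            w t * {p : Time T × Time T | p.2 ≤ p.1}.indicator (fun p => e p.2) (t, s) := by
          rw [lintegral_lintegral_swap hmeas.aemeasurable]
      _ = ENNReal.ofReal β * ∫⁻ s, (∫⁻ t in Set.Ici s, w t) * e s := by
          congr 1
          refine lintegral_congr fun s => ?_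
          rw [← lintegral_mul_const _ hwm, ← lintegral_indicator measurableSet_Ici]
          refine lintegral_congr fun t => ?_
          by_cases hst : s ≤ t
          · rw [Set.indicator_of_mem (show (t, s) ∈ {p : Time T × Time T | p.2 ≤ p.1} from hst),
              Set.indicator_of_mem (show t ∈ Set.Ici s from hst)]
          · rw [Set.indicator_of_notMem (show (t, s) ∉ {p : Time T × Time T | p.2 ≤ p.1} from hst),
              Set.indicator_of_notMem (show t ∉ Set.Ici s from hst), mul_zero]
      _ ≤ ENNReal.ofReal β * ∫⁻ s, ENNReal.ofReal (1 / κ) * (w s * e s) := by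
          refine mul_le_mul_right (lintegral_mono fun s => ?_) _
          rw [← mul_assoc]
          exact mul_le_mul_left (lintegral_exp_weight_le hκ0 s) _
      _ = ENNReal.ofReal (β / κ) * N := by
          rw [lintegral_const_mul' _ _ ENNReal.ofReal_ne_top, ← mul_assoc,
            ← ENNReal.ofReal_mul hβ, mul_one_div]
  have h2 : N = 0 := by
    by_contra hne
    have h3 : ENNReal.ofReal (β / κ) * N < 1 * N := by
      refine ENNReal.mul_lt_mul_left hne hNfin ?_
      rw [ENNReal.ofReal_lt_one, div_lt_one hκ0]
      linarith
    rw [one_mul] at h3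
    exact absurd h1 h3.not_ge
  replace h2 := (lintegral_eq_zero_iff (hwm.mul he)).1 h2
  filter_upwards [h2] with t ht
  have h4 : w t ≠ 0 := by
    rw [hw]
    simp [Real.exp_pos]
  exact (mul_eq_zero.1 ht).resolve_left h4

variable {Ω : Type*} {mΩ : MeasurableSpace Ω} {P : Measure Ω}
  [IsProbabilityMeasure P] {𝓕 : Filtration (Time T) mΩ} {A : Time T → Ω → ℝ}
  {φ ϱ q L : ℝ} {θ : ℝ × L2 T}

/-- The inhomogeneity is the same for both, so the difference solves the homogeneous Volterra
equation and its second moment at `t` is at most `β²` times the integral of its earlier second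
moments. -/
theorem IsGreedy.unique (hφ : 0 ≤ φ) (h : IsCoerciveModel φ ϱ L θ) {u v : Time T → Ω → ℝ}
    (hu : IsGreedy P 𝓕 A φ ϱ q θ u) (hv : IsGreedy P 𝓕 A φ ϱ q θ v) :
    ∀ᵐ t, ∀ᵐ ω ∂P, v t ω = u t ω := by
  obtain ⟨β, hβ0, hβ⟩ := exists_abs_volterraFun_le hφ h
  have hus := hu.1.isSqIntegrable
  have hvs := hv.1.isSqIntegrable
  have hws := hvs.sub hus
  set w : Time T → Ω → ℝ := fun t ω => v t ω - u t ω with hw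
  set e : Time T → ℝ≥0∞ := fun t => ∫⁻ ω, ‖w t ω‖ₑ ^ 2 ∂P with he
  have hwm : Measurable fun p : Time T × Ω => ‖w p.1 p.2‖ₑ ^ 2 :=
    hws.measurable.enorm.pow_const 2
  have hem : Measurable e := Measurable.lintegral_prod_right' hwm
  have hfin : ∫⁻ t, e t ≠ ∞ := by
    have : ∫⁻ t, e t = ∫⁻ ω, (∫⁻ t, ‖w t ω‖ₑ ^ 2) ∂P := lintegral_lintegral_swap hwm.aemeasurable
    rw [this]
    exact hws.lintegral_lt_top.ne
  have hle : ∀ᵐ t, e t ≤ ENNReal.ofReal (β ^ 2) * ∫⁻ s in Set.Iic t, e s := by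
    filter_upwards [hu.2, hv.2] with t hut hvt
    have h1 : ∀ᵐ ω ∂P, ‖w t ω‖ₑ ^ 2
        ≤ ENNReal.ofReal (β ^ 2) * ∫⁻ s in Set.Iic t, ‖w s ω‖ₑ ^ 2 := by
      filter_upwards [hut, hvt, hus.ae_memLp, hvs.ae_memLp, hws.ae_memLp, hvs.pathL2_sub hus]
        with ω a1 a2 a3 a4 a5 a6
      have b1 : w t ω = volterraFun φ ϱ θ t (pathL2 w ω) := by
        rw [setIntegral_kerB_of_memLp φ ϱ θ t a3] at a1
        rw [setIntegral_kerB_of_memLp φ ϱ θ t a4] at a2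
        rw [hw, a6, volterraFun_sub]
        simp only
        rw [a1, a2]
        simp only [pathL2]
        ring
      have b2 : ‖w t ω‖ₑ ≤ ENNReal.ofReal β * ‖pathL2 w ω - cut t (pathL2 w ω)‖ₑ := by
        rw [← ofReal_norm, ← ofReal_norm (pathL2 w ω - _), ← ENNReal.ofReal_mul hβ0, b1,
          Real.norm_eq_abs]
        exact ENNReal.ofReal_le_ofReal (hβ t _)
      have b3 : ‖pathL2 w ω - cut t (pathL2 w ω)‖ₑ ^ 2 ≤ ∫⁻ s in Set.Iic t, ‖w s ω‖ₑ ^ 2 := by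
        rw [pathL2, toL2_past a5, enorm_toL2_sq (memLp_past a5 t),
          ← lintegral_indicator measurableSet_Iic]
        refine lintegral_mono fun s => ?_
        by_cases hs : s < t
        · rw [if_pos hs, Set.indicator_of_mem (show s ∈ Set.Iic t from hs.le)]
        · simp [if_neg hs]
      calc ‖w t ω‖ₑ ^ 2 ≤ (ENNReal.ofReal β * ‖pathL2 w ω - cut t (pathL2 w ω)‖ₑ) ^ 2 := by
            gcongr
        _ = ENNReal.ofReal (β ^ 2) * ‖pathL2 w ω - cut t (pathL2 w ω)‖ₑ ^ 2 := by
            rw [mul_pow, ENNReal.ofReal_pow hβ0]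
        _ ≤ _ := by gcongr
    calc e t ≤ ∫⁻ ω, ENNReal.ofReal (β ^ 2) * (∫⁻ s in Set.Iic t, ‖w s ω‖ₑ ^ 2) ∂P :=
          lintegral_mono_ae h1
      _ = ENNReal.ofReal (β ^ 2) * ∫⁻ s in Set.Iic t, e s := by
          rw [lintegral_const_mul' _ _ ENNReal.ofReal_ne_top]
          congr 1
          exact (lintegral_lintegral_swap
            (μ := (volume : Measure (Time T)).restrict (Set.Iic t)) (ν := P)
            (f := fun s ω => ‖w s ω‖ₑ ^ 2) hwm.aemeasurable).symm
  filter_upwards [ae_eq_zero_of_volterra_le hem hfin (sq_nonneg β) hle] with t ht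
  replace ht := (lintegral_eq_zero_iff (hwm.comp measurable_prodMk_left)).1 ht
  filter_upwards [ht] with ω hω
  have : w t ω = 0 := by simpa using hω
  exact sub_eq_zero.1 this

end Uniqueness

/-! ### The payoff along one path as a quadratic form -/

section PathObjective

variable {T : ℝ} [Fact (0 < T)]

/-! #### The objective along a path -/

theorem setIntegral_gap_ae_eq (G : L2 T) {f : Time T → ℝ} (hf : MemLp f 2 volume) :
    -- Taking `ϱ = 0` isolates the transient impact kernel; the endpoint `s = t` is a null set.
    (fun t => ∫ s in Set.Iic t, G (gap t s) * f s) =ᵐ[volume] opG 0 G ⊥ (toL2 f) := by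
  filter_upwards [coeFn_opG 0 G ⊥ (toL2 f)] with t ht
  rw [ht, setIntegral_congr_set Iio_ae_eq_Iic.symm, ← integral_indicator measurableSet_Iio]
  refine integral_congr_ae ?_
  filter_upwards [coeFn_toL2 hf] with s hs
  rw [tildeGFrom_bot, tildeG, Set.indicator_apply, hs]
  simp only [Set.mem_Iio, mul_zero, zero_add, ite_mul, zero_mul]

theorem setIntegral_Iic_ae_eq {f : Time T → ℝ} (hf : MemLp f 2 volume) :
    (fun t => ∫ s in Set.Iic t, f s) =ᵐ[volume] opOne ⊥ (toL2 f) := by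
  filter_upwards [coeFn_opOne ⊥ (toL2 f)] with t ht
  rw [ht, ← integral_indicator measurableSet_Iic]
  refine integral_congr_ae ?_
  filter_upwards [coeFn_toL2 hf] with s hs
  rw [oneKer_bot, Set.indicator_apply, hs]
  simp only [Set.mem_Iic, ite_mul, one_mul, zero_mul]

theorem setIntegral_Iic_top {f : Time T → ℝ} (hf : MemLp f 2 volume) :
    ∫ s in Set.Iic (⊤ : Time T), f s = inner ℝ (toL2 f) (constL2 1) := by
  rw [Set.Iic_top, setIntegral_univ, inner_L2]
  refine integral_congr_ae ?_
  filter_upwards [coeFn_toL2 hf, coeFn_constL2 (T := T) 1] with s h1 h2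
  rw [h1, h2, mul_one]

theorem cut_bot (f : L2 T) : cut ⊥ f = f := by
  refine Lp.ext ?_
  filter_upwards [coeFn_cut ⊥ f] with s hs
  rw [hs, Set.Ici_bot, Set.indicator_univ]

/-- Here `c` stands for the terminal price, `a` for `A - A_T` and `n` for `M - M_T`. The terminal
liquidation value cancels `c ∫ f`, leaving `q c`; this is why only prices relative to the terminal
one matter. Expanding the inventory penalties yields `linGain` and the `ϱ` and `φ` parts of the
form. -/
theorem path_objective_eq (φ ϱ q c : ℝ) (θ : ℝ × L2 T) {f a n : Time T → ℝ}
    (hf : MemLp f 2 volume) (ha : MemLp a 2 volume) (hn : MemLp n 2 volume) :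
    (∫ t, (a t + n t + c - θ.1 * f t - ∫ s in Set.Iic t, θ.2 (gap t s) * f s) * f t)
      + (q - ∫ s in Set.Iic ⊤, f s) * c
      - φ * (∫ t, (q - ∫ s in Set.Iic t, f s) ^ 2)
      - ϱ * (q - ∫ s in Set.Iic ⊤, f s) ^ 2
    = inner ℝ (toL2 n) (toL2 f)
      + (inner ℝ (toL2 a + linGain φ ϱ q) (toL2 f)
        - 1 / 2 * inner ℝ (opD φ ϱ θ ⊥ (toL2 f)) (toL2 f))
      + (q * c - φ * q ^ 2 * ‖(constL2 1 : L2 T)‖ ^ 2 - ϱ * q ^ 2) := by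
  have e1 : (∫ t, (a t + n t + c - θ.1 * f t - ∫ s in Set.Iic t, θ.2 (gap t s) * f s) * f t)
      = inner ℝ (toL2 a + toL2 n + c • constL2 1 - θ.1 • toL2 f - opG 0 θ.2 ⊥ (toL2 f))
          (toL2 f) := by
    rw [inner_L2]
    refine integral_congr_ae ?_
    filter_upwards [coeFn_toL2 hf, coeFn_toL2 ha, coeFn_toL2 hn, coeFn_constL2 (T := T) 1,
      setIntegral_gap_ae_eq θ.2 hf,
      Lp.coeFn_sub (toL2 a + toL2 n + c • constL2 1 - θ.1 • toL2 f) (opG 0 θ.2 ⊥ (toL2 f)),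
      Lp.coeFn_sub (toL2 a + toL2 n + c • constL2 1) (θ.1 • toL2 f),
      Lp.coeFn_add (toL2 a + toL2 n) (c • constL2 1), Lp.coeFn_add (toL2 a) (toL2 n),
      Lp.coeFn_smul c (constL2 1 : L2 T), Lp.coeFn_smul θ.1 (toL2 f)]
      with t h1 h2 h3 h4 h5 h6 h7 h8 h9 h10 h11
    rw [h6, Pi.sub_apply, h7, Pi.sub_apply, h8, Pi.add_apply, h9, Pi.add_apply, h10,
      Pi.smul_apply, h11, Pi.smul_apply, h1, h2, h3, h4, ← h5]
    simp only [smul_eq_mul, mul_one]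
  have e2 : (∫ t, (q - ∫ s in Set.Iic t, f s) ^ 2)
      = ‖q • constL2 1 - opOne ⊥ (toL2 f)‖ ^ 2 := by
    rw [norm_sq_L2]
    refine integral_congr_ae ?_
    filter_upwards [coeFn_constL2 (T := T) 1, setIntegral_Iic_ae_eq hf,
      Lp.coeFn_sub (q • constL2 1) (opOne ⊥ (toL2 f)), Lp.coeFn_smul q (constL2 1 : L2 T)]
      with t h1 h2 h3 h4
    rw [h3, Pi.sub_apply, h4, Pi.smul_apply, h1, ← h2, smul_eq_mul, mul_one]
  have e3 : inner ℝ (opOneAdj ⊥ (constL2 1)) (toL2 f)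
      = inner ℝ (constL2 1) (opOne ⊥ (toL2 f)) :=
    ContinuousLinearMap.adjoint_inner_left _ _ _
  have e4 := two_inner_opG_bot 0 θ.2 (toL2 f)
  rw [e1, e2, setIntegral_Iic_top hf, norm_sub_sq_real, inner_opD, cut_bot, linGain]
  simp only [inner_add_left, inner_sub_left, real_inner_smul_left, e3, norm_smul, Real.norm_eq_abs,
    mul_pow, sq_abs, real_inner_self_eq_norm_sq, real_inner_comm (constL2 1 : L2 T) (toL2 f)]
  linarith

end PathObjective

/-! ### Measurability, square integrability and orthogonality of the martingale part -/

section Noise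

variable {T : ℝ} [Fact (0 < T)] {Ω : Type*} {mΩ : MeasurableSpace Ω} {P : Measure Ω}
  [IsProbabilityMeasure P] {𝓕 : Filtration (Time T) mΩ} {M V : Time T → Ω → ℝ}

/-! #### Joint measurability of right continuous processes -/

/-- The point `min T ((j+1)/(k+1))`. -/
def gridPoint (k j : ℕ) : Time T :=
  ⟨min T ((j + 1) / (k + 1)), le_min (Fact.out : 0 < T).le (by positivity), min_le_left _ _⟩

/-- The index of the first grid point of mesh `1/(k+1)` strictly after `t`. -/
def gridIndex (k : ℕ) (t : Time T) : ℕ := ⌊((k : ℝ) + 1) * t⌋₊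

theorem measurable_gridIndex (k : ℕ) : Measurable (gridIndex k : Time T → ℕ) :=
  Nat.measurable_floor.comp (measurable_subtype_coe.const_mul ((k : ℝ) + 1))

theorem tendsto_gridPoint (t : Time T) :
    Tendsto (fun k => gridPoint k (gridIndex k t)) atTop (𝓝[≥] t) := by
  have hlow : ∀ k : ℕ, (t : ℝ) ≤ (gridPoint k (gridIndex k t) : Time T) := fun k => by
    refine le_min t.2.2 ?_
    rw [le_div_iff₀ (by positivity), mul_comm]
    exact (Nat.lt_floor_add_one _).le
  have hup : ∀ k : ℕ, ((gridPoint k (gridIndex k t) : Time T) : ℝ) ≤ t + 1 / (k + 1) := fun k => by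
    refine (min_le_right _ _).trans ?_
    have h := Nat.floor_le (mul_nonneg (by positivity) t.2.1 : 0 ≤ ((k : ℝ) + 1) * t)
    rw [div_le_iff₀ (by positivity), add_mul, one_div_mul_cancel (by positivity)]
    rw [gridIndex]
    linarith
  refine tendsto_nhdsWithin_iff.2 ⟨tendsto_subtype_rng.2 ?_, Eventually.of_forall hlow⟩
  refine tendsto_of_tendsto_of_tendsto_of_le_of_le tendsto_const_nhds ?_ hlow hup
  simpa using tendsto_const_nhds.add (tendsto_one_div_add_atTop_nhds_zero_nat (𝕜 := ℝ))

/-- Approximation by the value at the next grid point on the right, which depends on time through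
countably many values only. -/
theorem measurable_uncurry_of_rightContinuous {X : Time T → Ω → ℝ} (hX : ∀ t, Measurable (X t))
    (hc : ∀ ω t, ContinuousWithinAt (fun t => X t ω) (Set.Ici t) t) :
    Measurable (Function.uncurry X) := by
  refine measurable_of_tendsto_metrizable
    (f := fun k (p : Time T × Ω) => X (gridPoint k (gridIndex k p.1)) p.2) (fun k => ?_)
    (tendsto_pi_nhds.2 fun p => (hc p.2 p.1).tendsto.comp (tendsto_gridPoint p.1))
  have h1 : Measurable fun p : ℕ × Ω => X (gridPoint k p.1) p.2 :=
    measurable_from_prod_countable_right fun j => hX (gridPoint k j)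
  exact h1.comp (((measurable_gridIndex k).comp measurable_fst).prodMk measurable_snd)

theorem exists_measurable_modification {X : Time T → Ω → ℝ} (hX : ∀ t, Measurable (X t))
    (hc : ∀ᵐ ω ∂P, IsCadlagPath fun t => X t ω) :
    ∃ Y : Time T → Ω → ℝ, Measurable (Function.uncurry Y) ∧ ∀ᵐ ω ∂P, ∀ t, Y t ω = X t ω := by
  classical
  -- The set of irregular paths need not be measurable; a measurable null superset is used to reset
  -- the process to zero.
  set S := toMeasurable P {ω | ¬ IsCadlagPath fun t => X t ω} with hS
  have hS0 : P S = 0 := by rw [hS, measure_toMeasurable]; exact hc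
  have hSm : MeasurableSet S := measurableSet_toMeasurable _ _
  refine ⟨fun t ω => if ω ∈ S then 0 else X t ω, ?_, ?_⟩
  · refine measurable_uncurry_of_rightContinuous
      (fun t => Measurable.ite hSm measurable_const (hX t)) fun ω t => ?_
    by_cases hω : ω ∈ S
    · simp only [if_pos hω]
      exact continuousWithinAt_const
    · simp only [if_neg hω]
      have : IsCadlagPath fun t => X t ω := by
        by_contra h
        exact hω (subset_toMeasurable P _ h)
      exact (this t).1
  · filter_upwards [measure_eq_zero_iff_ae_notMem.1 hS0] with ω hω t
    rw [if_neg hω]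

/-! #### Square integrability of the noise -/

theorem IsBracket.integrable (hV : IsBracket P 𝓕 M V) (hi : Integrable (V ⊤) P) (t : Time T) :
    Integrable (V t) P := by
  refine hi.mono ((hV.predictable.stronglyAdapted t).mono (𝓕.le t)).aestronglyMeasurable ?_
  filter_upwards [hV.zero, hV.mono] with ω h0 h1
  have h2 : V ⊥ ω ≤ V t ω := h1 bot_le
  have h3 : V t ω ≤ V ⊤ ω := h1 le_top
  rw [h0] at h2
  rw [Real.norm_of_nonneg h2, Real.norm_of_nonneg (h2.trans h3)]
  exact h3

theorem IsBracket.integrable_sq (hV : IsBracket P 𝓕 M V) (hi : Integrable (V ⊤) P) (t : Time T) :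
    Integrable (fun ω => (M t ω - M ⊥ ω) ^ 2) P := by
  refine ((hV.martingale.integrable t).add (hV.integrable hi t)).congr
    (Eventually.of_forall fun ω => ?_)
  simp

/-- The compensated square has constant mean, so the second moment grows with the mean of the
increasing bracket. -/
theorem IsBracket.integral_sq_le (hV : IsBracket P 𝓕 M V) (hi : Integrable (V ⊤) P) (t : Time T) :
    ∫ ω, (M t ω - M ⊥ ω) ^ 2 ∂P ≤ ∫ ω, (M ⊤ ω - M ⊥ ω) ^ 2 ∂P := by
  have e : ∀ s, ∫ ω, (M s ω - M ⊥ ω) ^ 2 ∂P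
      = ∫ ω, ((M s ω - M ⊥ ω) ^ 2 - V s ω) ∂P + ∫ ω, V s ω ∂P := fun s => by
    rw [← integral_add (hV.martingale.integrable s) (hV.integrable hi s)]
    simp
  have h1 := hV.martingale.setIntegral_eq (i := t) le_top (MeasurableSet.univ)
  simp only [setIntegral_univ] at h1
  rw [e t, e ⊤, h1]
  refine add_le_add le_rfl (integral_mono_ae (hV.integrable hi t) hi ?_)
  filter_upwards [hV.mono] with ω h
  exact h le_top

theorem IsBracket.lintegral_noise_le (hM : Martingale M 𝓕 P) (hV : IsBracket P 𝓕 M V)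
    (hi : Integrable (V ⊤) P) (t : Time T) :
    ∫⁻ ω, ‖M t ω - M ⊤ ω‖ₑ ^ 2 ∂P
      ≤ ENNReal.ofReal (4 * ∫ ω, (M ⊤ ω - M ⊥ ω) ^ 2 ∂P) := by
  have hs := hV.integrable_sq hi
  have hm : AEStronglyMeasurable (fun ω => M t ω - M ⊤ ω) P :=
    ((hM.integrable t).sub (hM.integrable ⊤)).aestronglyMeasurable
  have h0 : ∀ ω, (M t ω - M ⊤ ω) ^ 2 ≤ 2 * (M t ω - M ⊥ ω) ^ 2 + 2 * (M ⊤ ω - M ⊥ ω) ^ 2 :=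
    fun ω => by nlinarith [sq_nonneg ((M t ω - M ⊥ ω) + (M ⊤ ω - M ⊥ ω))]
  have hint : Integrable (fun ω => 2 * (M t ω - M ⊥ ω) ^ 2 + 2 * (M ⊤ ω - M ⊥ ω) ^ 2) P :=
    ((hs t).const_mul 2).add ((hs ⊤).const_mul 2)
  have e : ∀ ω, ‖M t ω - M ⊤ ω‖ₑ ^ 2 = ENNReal.ofReal ((M t ω - M ⊤ ω) ^ 2) := fun ω => by
    rw [Real.enorm_eq_ofReal_abs, ← ENNReal.ofReal_pow (abs_nonneg _), sq_abs]
  simp only [e]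
  refine (lintegral_mono fun ω => ENNReal.ofReal_le_ofReal (h0 ω)).trans ?_
  rw [← ofReal_integral_eq_lintegral_ofReal hint (Eventually.of_forall fun ω => by positivity)]
  refine ENNReal.ofReal_le_ofReal ?_
  rw [integral_add ((hs t).const_mul 2) ((hs ⊤).const_mul 2), integral_const_mul,
    integral_const_mul]
  linarith [hV.integral_sq_le hi t]

theorem integral_noise_mul_eq_zero (hM : Martingale M 𝓕 P) {t : Time T} {Y : Ω → ℝ}
    (hY : StronglyMeasurable[𝓕 t] Y) (hY2 : MemLp Y 2 P)
    (hn : MemLp (fun ω => M t ω - M ⊤ ω) 2 P) :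
    ∫ ω, (M t ω - M ⊤ ω) * Y ω ∂P = 0 := by
  have hi : Integrable (fun ω => M t ω - M ⊤ ω) P := hn.integrable (by norm_num)
  have h0 : P[fun ω => M t ω - M ⊤ ω | 𝓕 t] =ᵐ[P] 0 := by
    filter_upwards [condExp_sub (hM.integrable t) (hM.integrable ⊤) (𝓕 t),
      hM.condExp_ae_eq (le_refl t), hM.condExp_ae_eq (le_top : t ≤ ⊤)] with ω h1 h2 h3
    have h1' : (P[fun ω => M t ω - M ⊤ ω | 𝓕 t]) ω = _ := h1
    rw [h1', Pi.sub_apply, h2, h3, sub_self, Pi.zero_apply]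
  have h1 := condExp_mul_of_stronglyMeasurable_left hY (hY2.integrable_mul hn) hi
  calc ∫ ω, (M t ω - M ⊤ ω) * Y ω ∂P = ∫ ω, (Y * fun ω => M t ω - M ⊤ ω) ω ∂P :=
        integral_congr_ae (Eventually.of_forall fun ω => mul_comm _ _)
    _ = ∫ ω, (P[Y * fun ω => M t ω - M ⊤ ω | 𝓕 t]) ω ∂P := (integral_condExp (𝓕.le t)).symm
    _ = ∫ _, (0 : ℝ) ∂P := by
        refine integral_congr_ae ?_
        filter_upwards [h0, h1] with ω a b
        rw [b, Pi.mul_apply, a, Pi.zero_apply, mul_zero]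
    _ = 0 := integral_zero _ _

theorem IsSqIntegrable.ae_memLp_section {X : Time T → Ω → ℝ} (hX : IsSqIntegrable P X) :
    ∀ᵐ t : Time T, MemLp (X t) 2 P := by
  have h : ∫⁻ t, (∫⁻ ω, ‖X t ω‖ₑ ^ 2 ∂P) < ∞ := by
    have := hX.lintegral_lt_top
    rw [lintegral_lintegral_swap] at this
    · exact this
    · exact ((hX.measurable.comp measurable_swap).enorm.pow_const 2).aemeasurable
  have hm : Measurable fun t => ∫⁻ ω, ‖X t ω‖ₑ ^ 2 ∂P :=
    Measurable.lintegral_prod_right' (f := fun p => ‖X p.1 p.2‖ₑ ^ 2)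
      (hX.measurable.enorm.pow_const 2)
  filter_upwards [ae_lt_top hm h.ne] with t ht
  exact memLp_two_iff'.2 ⟨(hX.measurable.comp
    (measurable_const.prodMk measurable_id)).aestronglyMeasurable, ht⟩

theorem IsSqIntegrable.integral_inner_pathL2 {X Y : Time T → Ω → ℝ} (hX : IsSqIntegrable P X)
    (hY : IsSqIntegrable P Y) :
    ∫ ω, inner ℝ (pathL2 X ω) (pathL2 Y ω) ∂P = ∫ t, ∫ ω, X t ω * Y t ω ∂P := by
  have h1 : Integrable (fun p : Time T × Ω => X p.1 p.2 * Y p.1 p.2) (volume.prod P) :=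
    ((isSqIntegrable_iff_memLp hX.measurable).1 hX).integrable_mul
      ((isSqIntegrable_iff_memLp hY.measurable).1 hY)
  rw [← integral_prod _ h1, integral_prod_symm _ h1]
  refine integral_congr_ae ?_
  filter_upwards [hX.ae_memLp, hY.ae_memLp] with ω a b
  rw [inner_L2]
  refine integral_congr_ae ?_
  filter_upwards [coeFn_toL2 a, coeFn_toL2 b] with t c d
  rw [pathL2, pathL2, c, d]

/-- For almost every `t`, `u_t` is `𝓕_t`-measurable and square integrable, hence orthogonal to `M_t
- M_T`; Fubini integrates this over time. A jointly measurable modification of `M` is what permits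
Fubini. -/
theorem exists_noise (hM : Martingale M 𝓕 P) (hc : ∀ᵐ ω ∂P, IsCadlagPath fun t => M t ω)
    (hV : IsBracket P 𝓕 M V) (hi : Integrable (V ⊤) P) :
    ∃ X : Time T → Ω → ℝ, IsSqIntegrable P X ∧ (∀ᵐ ω ∂P, ∀ t, X t ω = M t ω - M ⊤ ω) ∧
      ∀ u, Admissible P 𝓕 u → ∫ ω, inner ℝ (pathL2 X ω) (pathL2 u ω) ∂P = 0 := by
  obtain ⟨Y, hYm, hY⟩ := exists_measurable_modification (P := P)
    (fun t => ((hM.stronglyAdapted t).mono (𝓕.le t)).measurable) hc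
  have hX : ∀ᵐ ω ∂P, ∀ t, Y t ω - Y ⊤ ω = M t ω - M ⊤ ω := by
    filter_upwards [hY] with ω h t
    rw [h, h]
  have hm : Measurable (Function.uncurry fun t ω => Y t ω - Y ⊤ ω) :=
    hYm.sub (hYm.comp (measurable_const.prodMk measurable_snd))
  have hb : ∀ t, ∫⁻ ω, ‖Y t ω - Y ⊤ ω‖ₑ ^ 2 ∂P
      ≤ ENNReal.ofReal (4 * ∫ ω, (M ⊤ ω - M ⊥ ω) ^ 2 ∂P) := fun t => by
    refine le_trans (le_of_eq (lintegral_congr_ae ?_)) (hV.lintegral_noise_le hM hi t)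
    filter_upwards [hX] with ω h
    rw [h]
  have hsq : IsSqIntegrable P fun t ω => Y t ω - Y ⊤ ω := by
    refine ⟨hm, ?_⟩
    rw [lintegral_lintegral_swap
      (((hm.comp measurable_swap).enorm.pow_const 2).aemeasurable)]
    refine (lintegral_mono hb).trans_lt ?_
    rw [lintegral_const]
    exact ENNReal.mul_lt_top ENNReal.ofReal_lt_top (measure_lt_top _ _)
  refine ⟨_, hsq, hX, fun u hu => ?_⟩
  rw [hsq.integral_inner_pathL2 hu.isSqIntegrable]
  have h0 : ∀ᵐ t : Time T, ∫ ω, (Y t ω - Y ⊤ ω) * u t ω ∂P = 0 := by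
    filter_upwards [hsq.ae_memLp_section, hu.isSqIntegrable.ae_memLp_section] with t h1 h2
    have hX' : (fun ω => Y t ω - Y ⊤ ω) =ᵐ[P] fun ω => M t ω - M ⊤ ω := by
      filter_upwards [hX] with ω h
      exact h t
    refine (integral_congr_ae ?_).trans (integral_noise_mul_eq_zero hM
      (hu.1.adapted t).stronglyMeasurable h2 ((memLp_congr_ae hX').1 h1))
    filter_upwards [hX] with ω h
    rw [h]
  rw [integral_congr_ae h0, integral_zero]

end Noise

/-! ### The quadratic objective and the regret bound -/

section Regret

variable {T : ℝ} [Fact (0 < T)] {Ω : Type*} {mΩ : MeasurableSpace Ω} {P : Measure Ω}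
  [IsProbabilityMeasure P] {𝓕 : Filtration (Time T) mΩ} {A M : Time T → Ω → ℝ}
  {φ ϱ q L : ℝ} {θ : ℝ × L2 T}

theorem integrable_inner_of_memLp {F G : Ω → L2 T} (hF : MemLp F 2 P) (hG : MemLp G 2 P) :
    Integrable (fun ω => inner ℝ (F ω) (G ω)) P := by
  refine (L2.integrable_inner (𝕜 := ℝ) hF.toLp hG.toLp).congr ?_
  filter_upwards [hF.coeFn_toLp, hG.coeFn_toLp] with ω h1 h2
  rw [h1, h2]

theorem inner_toLp_toLp {F G : Ω → L2 T} (hF : MemLp F 2 P) (hG : MemLp G 2 P) :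
    inner ℝ hF.toLp hG.toLp = ∫ ω, inner ℝ (F ω) (G ω) ∂P := by
  rw [L2.inner_def]
  refine integral_congr_ae ?_
  filter_upwards [hF.coeFn_toLp, hG.coeFn_toLp] with ω h1 h2
  rw [h1, h2]

theorem compLpL_toLp (D : L2 T →L[ℝ] L2 T) {F : Ω → L2 T} (hF : MemLp F 2 P) :
    D.compLpL 2 P hF.toLp = (D.comp_memLp' hF).toLp := by
  refine Lp.ext ?_
  filter_upwards [D.coeFn_compLpL (p := 2) (μ := P) hF.toLp, hF.coeFn_toLp,
    (D.comp_memLp' hF).coeFn_toLp] with ω h1 h2 h3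
  rw [h1, h2, h3, Function.comp_apply]

/-! #### The objective as a quadratic functional -/

theorem IsPriceModel.integrable_signal_top (h : IsPriceModel P 𝓕 A M) : Integrable (A ⊤) P := by
  have hm : ∀ t, Measurable (A t) := fun t =>
    ((h.signal_predictable.stronglyAdapted t).mono (𝓕.le t)).measurable
  have h1 : MemLp (fun ω => A ⊤ ω - A ⊥ ω) 2 P := by
    refine memLp_two_iff'.2 ⟨((hm ⊤).sub (hm ⊥)).aestronglyMeasurable,
      lt_of_le_of_lt (lintegral_mono fun ω => ?_) h.signal_moment⟩
    gcongr
    rw [← edist_eq_enorm_sub]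
    exact eVariationOn.edist_le (fun t => A t ω) (Set.mem_univ ⊤) (Set.mem_univ ⊥)
  refine ((h1.integrable (by norm_num)).add h.signal_initial).congr
    (Eventually.of_forall fun ω => ?_)
  simp

/-- The random linear functional in the objective. -/
def gainPath (A : Time T → Ω → ℝ) (φ ϱ q : ℝ) (ω : Ω) : L2 T :=
  pathL2 (signal A) ω + linGain φ ϱ q

theorem memLp_gainPath (hS : IsSqIntegrable P (signal A)) : MemLp (gainPath A φ ϱ q) 2 P :=
  hS.memLp_pathL2.add (memLp_const (linGain φ ϱ q))

/-- That one constant `K` serves all models and strategies, and that the linear term is free of `θ`,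
is what allows two controls to be compared under the same true model. -/
theorem exists_objective_eq (h : IsPriceModel P 𝓕 A M) (hS : IsSqIntegrable P (signal A))
    (φ ϱ q : ℝ) :
    ∃ K : ℝ, ∀ (θ : ℝ × L2 T) (u : Time T → Ω → ℝ) (hu : Admissible P 𝓕 u),
      objective P A M φ ϱ q θ u = K
        + (inner ℝ (memLp_gainPath (φ := φ) (ϱ := ϱ) (q := q) hS).toLp
            hu.isSqIntegrable.memLp_pathL2.toLp
          - 1 / 2 * inner ℝ ((opD φ ϱ θ ⊥).compLpL 2 P hu.isSqIntegrable.memLp_pathL2.toLp)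
            hu.isSqIntegrable.memLp_pathL2.toLp) := by
  obtain ⟨V, hV, hi⟩ := h.noise_moment
  obtain ⟨X, hX, hXM, hX0⟩ := exists_noise h.noise_martingale h.noise_cadlag hV hi
  have hc : Integrable (fun ω => q * (A ⊤ ω + M ⊤ ω) - φ * q ^ 2 * ‖(constL2 1 : L2 T)‖ ^ 2
      - ϱ * q ^ 2) P :=
    (((h.integrable_signal_top.add (h.noise_martingale.integrable ⊤)).const_mul q).sub
      (integrable_const _)).sub (integrable_const _)
  refine ⟨∫ ω, (q * (A ⊤ ω + M ⊤ ω) - φ * q ^ 2 * ‖(constL2 1 : L2 T)‖ ^ 2 - ϱ * q ^ 2) ∂P,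
    fun θ u hu => ?_⟩
  have hU := hu.isSqIntegrable.memLp_pathL2
  have hD := (opD φ ϱ θ ⊥).comp_memLp' hU
  have hℓ := memLp_gainPath (φ := φ) (ϱ := ϱ) (q := q) hS
  have i1 := integrable_inner_of_memLp hX.memLp_pathL2 hU
  have i2 := integrable_inner_of_memLp hℓ hU
  have i3 := (integrable_inner_of_memLp hD hU).const_mul (1 / 2)
  have e : objective P A M φ ϱ q θ u = ∫ ω, (inner ℝ (pathL2 X ω) (pathL2 u ω)
      + (inner ℝ (gainPath A φ ϱ q ω) (pathL2 u ω)
        - 1 / 2 * inner ℝ ((opD φ ϱ θ ⊥ ∘ pathL2 u) ω) (pathL2 u ω))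
      + (q * (A ⊤ ω + M ⊤ ω) - φ * q ^ 2 * ‖(constL2 1 : L2 T)‖ ^ 2 - ϱ * q ^ 2)) ∂P := by
    refine integral_congr_ae ?_
    filter_upwards [hu.isSqIntegrable.ae_memLp, hS.ae_memLp, hX.ae_memLp, hXM] with ω a b c d
    refine Eq.trans ?_ (path_objective_eq φ ϱ q (A ⊤ ω + M ⊤ ω) θ a b c)
    have e0 : (fun t => executionPrice A M θ u t ω * u t ω) = fun t =>
        (signal A t ω + X t ω + (A ⊤ ω + M ⊤ ω) - θ.1 * u t ω
          - ∫ s in Set.Iic t, θ.2 (gap t s) * u s ω) * u t ω := by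
      ext t
      rw [executionPrice, transientImpact, signal, d]
      ring
    rw [e0]
    rfl
  have i4 : Integrable (fun ω => inner ℝ (gainPath A φ ϱ q ω) (pathL2 u ω)
      - 1 / 2 * inner ℝ ((opD φ ϱ θ ⊥ ∘ pathL2 u) ω) (pathL2 u ω)) P := i2.sub i3
  have i5 : Integrable (fun ω => inner ℝ (pathL2 X ω) (pathL2 u ω)
      + (inner ℝ (gainPath A φ ϱ q ω) (pathL2 u ω)
        - 1 / 2 * inner ℝ ((opD φ ϱ θ ⊥ ∘ pathL2 u) ω) (pathL2 u ω))) P := i1.add i4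
  rw [e, integral_add i5 hc, integral_add i1 i4, integral_sub i2 i3,
    integral_const_mul, hX0 u hu, compLpL_toLp, inner_toLp_toLp hℓ hU, inner_toLp_toLp hD hU]
  ring

theorem IsWeakSol.inner_eq_zero (hS : IsSqIntegrable P (signal A)) {u v : Time T → Ω → ℝ}
    (hu : Admissible P 𝓕 u) (hw : IsWeakSol P 𝓕 A φ ϱ q θ u) (hv : Admissible P 𝓕 v) :
    inner ℝ ((memLp_gainPath (φ := φ) (ϱ := ϱ) (q := q) hS).toLp
        - (opD φ ϱ θ ⊥).compLpL 2 P hu.isSqIntegrable.memLp_pathL2.toLp)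
      hv.isSqIntegrable.memLp_pathL2.toLp = 0 := by
  rw [compLpL_toLp, ← MemLp.toLp_sub, inner_toLp_toLp]
  exact hw v hv

theorem IsWeakSol.congr {u v : Time T → Ω → ℝ} (hw : IsWeakSol P 𝓕 A φ ϱ q θ u)
    (h : pathL2 u =ᵐ[P] pathL2 v) : IsWeakSol P 𝓕 A φ ϱ q θ v := by
  intro w hw'
  rw [← hw w hw']
  refine integral_congr_ae ?_
  filter_upwards [h] with ω hω
  rw [gradPath, gradPath, hω]

/-- The feedback derivation need not be reversed: the weak solution is greedy, and greedy controls
are unique. -/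
theorem IsGreedy.isWeakSol (hφ : 0 ≤ φ) (h : IsCoerciveModel φ ϱ L θ)
    (hS : IsSqIntegrable P (signal A)) {u : Time T → Ω → ℝ}
    (hu : IsGreedy P 𝓕 A φ ϱ q θ u) : IsWeakSol P 𝓕 A φ ϱ q θ u := by
  obtain ⟨v, hv, hw⟩ := exists_isWeakSol (𝓕 := 𝓕) h hS q
  refine hw.congr (pathL2_ae_eq (ae_prod_of_ae_ae hv.isSqIntegrable.measurable
    hu.1.isSqIntegrable.measurable ?_))
  exact hu.unique hφ h (hw.isGreedy h hS hv)

/-! #### Stability of quadratic optimisation problems -/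

/-- Only orthogonality of the two gradients to `x` and `y` is required, because adapted strategies
form a proper subspace on which alone the gradients vanish. Testing with `x - y` gives `⟨D'(x - y),
x - y⟩ = -⟨(D - D')x, x - y⟩`, so coercivity of `D'` bounds `‖x - y‖` by `‖D - D'‖`. The loss is
exactly `½⟨D(x - y), x - y⟩`, since the first order term at `x` drops out. -/
theorem abs_quadratic_regret_le {H : Type*} [NormedAddCommGroup H] [InnerProductSpace ℝ H]
    {D D' : H →L[ℝ] H} {c : ℝ} (hc : 0 < c) (hsym : ∀ x y, inner ℝ (D x) y = inner ℝ x (D y))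
    (hD : ∀ x, c * ‖x‖ ^ 2 ≤ inner ℝ (D x) x) (hD' : ∀ x, c * ‖x‖ ^ 2 ≤ inner ℝ (D' x) x)
    {ℓ x y : H} (hxx : inner ℝ (ℓ - D x) x = 0) (hxy : inner ℝ (ℓ - D x) y = 0)
    (hyx : inner ℝ (ℓ - D' y) x = 0) (hyy : inner ℝ (ℓ - D' y) y = 0) :
    |(inner ℝ ℓ x - 1 / 2 * inner ℝ (D x) x) - (inner ℝ ℓ y - 1 / 2 * inner ℝ (D y) y)|
      ≤ 1 / 2 * ‖D‖ * (c⁻¹ * (‖D - D'‖ * (c⁻¹ * ‖ℓ‖))) ^ 2 := by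
  have hx : ‖x‖ ≤ c⁻¹ * ‖ℓ‖ := by
    refine norm_le_of_coercive hc ((hD x).trans (le_of_eq ?_))
    rw [inner_sub_left] at hxx
    linarith
  have hw : ‖x - y‖ ≤ c⁻¹ * ‖(D - D') x‖ := by
    rw [← norm_neg ((D - D') x)]
    refine norm_le_of_coercive hc ((hD' (x - y)).trans (le_of_eq ?_))
    simp only [inner_sub_left, inner_sub_right, map_sub, inner_neg_left,
      sub_apply] at *
    linarith
  have hw' : ‖x - y‖ ≤ c⁻¹ * (‖D - D'‖ * (c⁻¹ * ‖ℓ‖)) := by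
    refine hw.trans ?_
    have := (D - D').le_opNorm x
    gcongr
    exact this.trans (by gcongr)
  have e : (inner ℝ ℓ x - 1 / 2 * inner ℝ (D x) x) - (inner ℝ ℓ y - 1 / 2 * inner ℝ (D y) y)
      = 1 / 2 * inner ℝ (D (x - y)) (x - y) := by
    have h1 : inner ℝ (D y) x = inner ℝ (D x) y := by rw [hsym y x, real_inner_comm]
    simp only [inner_sub_left, inner_sub_right, map_sub] at *
    linarith
  have h2 : |inner ℝ (D (x - y)) (x - y)| ≤ ‖D‖ * ‖x - y‖ ^ 2 := by
    refine (abs_real_inner_le_norm _ _).trans ?_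
    rw [sq, ← mul_assoc]
    gcongr
    exact D.le_opNorm _
  rw [e, abs_mul, abs_of_pos (by norm_num : (0 : ℝ) < 1 / 2), mul_assoc]
  gcongr
  exact h2.trans (by gcongr)

theorem norm_gainPath_le (hS : IsSqIntegrable P (signal A)) {V : ℝ≥0}
    (hV : totalVariationMoment P A ≤ V) :
    ‖(memLp_gainPath (φ := φ) (ϱ := ϱ) (q := q) hS).toLp‖
      ≤ √((V * volume (Set.univ : Set (Time T))).toReal) + ‖(linGain φ ϱ q : L2 T)‖ := by
  have h1 : (memLp_gainPath (φ := φ) (ϱ := ϱ) (q := q) hS).toLp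
      = hS.memLp_pathL2.toLp + (memLp_const (linGain φ ϱ q : L2 T)).toLp :=
    MemLp.toLp_add hS.memLp_pathL2 (memLp_const (linGain φ ϱ q))
  rw [h1]
  refine (norm_add_le _ _).trans (add_le_add (Real.le_sqrt_of_sq_le ?_) ?_)
  · have h2 : ‖hS.memLp_pathL2.toLp‖ₑ ^ 2 ≤ V * volume (Set.univ : Set (Time T)) := by
      rw [Lp.enorm_toLp, eLpNorm_eq_lintegral_rpow_enorm_toReal (by norm_num) (by norm_num),
        ← ENNReal.rpow_natCast, ← ENNReal.rpow_mul]
      norm_num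
      rw [hS.lintegral_enorm_pathL2]
      exact (lintegral_signal_le A).trans (by gcongr)
    rw [← toReal_enorm, ← ENNReal.toReal_pow]
    exact ENNReal.toReal_mono (ENNReal.mul_lt_top ENNReal.coe_lt_top (measure_lt_top _ _)).ne h2
  · rw [Lp.norm_toLp, eLpNorm_const _ (by norm_num) (NeZero.ne P)]
    simp

theorem norm_opD_bot_le (φ ϱ : ℝ) (θ : ℝ × L2 T) :
    ‖opD φ ϱ θ ⊥‖ ≤ ‖(opD φ ϱ 0 ⊥ : L2 T →L[ℝ] L2 T)‖
      + (2 * |θ.1| + 2 * (‖(constL2 1 : L2 T)‖ * ‖θ.2‖)) := by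
  have h := norm_opD_bot_sub_le φ ϱ θ 0
  simp only [Prod.fst_zero, Prod.snd_zero, sub_zero] at h
  calc ‖opD φ ϱ θ ⊥‖ = ‖opD φ ϱ 0 ⊥ + (opD φ ϱ θ ⊥ - opD φ ϱ 0 ⊥)‖ := by rw [add_sub_cancel]
    _ ≤ _ := (norm_add_le _ _).trans (by gcongr)

theorem IsTrueModel.mem_admissibleModels {ε : ℝ} (hε : 0 < ε) (h : IsTrueModel L θ) :
    θ ∈ admissibleModels T L ε :=
  ⟨h.2.1.le, h.2.2.1.le, h.2.2.2.1.le, fun f =>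
    (by nlinarith [sq_nonneg ‖f‖] : -ε * ‖f‖ ^ 2 ≤ 0).trans (h.2.2.2.2 f)⟩

/-- The constant in the regret bound. -/
def regretConst (T : ℝ) [Fact (0 < T)] (φ ϱ q L : ℝ) (V : ℝ≥0) : ℝ :=
  1 / 2 * (‖(opD φ ϱ 0 ⊥ : L2 T →L[ℝ] L2 T)‖ + (2 * L + 2 * (‖(constL2 1 : L2 T)‖ * L)))
    * (L * (L * (√((V * volume (Set.univ : Set (Time T))).toReal)
        + ‖(linGain φ ϱ q : L2 T)‖))) ^ 2
    * (8 * (1 + ‖(constL2 1 : L2 T)‖ ^ 2))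

theorem regretConst_nonneg (φ ϱ q : ℝ) (hL : 0 < L) (V : ℝ≥0) :
    0 ≤ regretConst T φ ϱ q L V := by
  unfold regretConst
  positivity

theorem abs_objective_sub_le {θs : ℝ × L2 T} (h : IsPriceModel P 𝓕 A M) {V : ℝ≥0}
    (hV : totalVariationMoment P A ≤ V) (hφ : 0 ≤ φ) (hs : IsCoerciveModel φ ϱ L θs)
    (hθ : IsCoerciveModel φ ϱ L θ) (h1 : |θs.1| ≤ L) (h2 : ‖θs.2‖ ≤ L) {us u : Time T → Ω → ℝ}
    (hus : IsGreedy P 𝓕 A φ ϱ q θs us) (hu : IsGreedy P 𝓕 A φ ϱ q θ u) :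
    |objective P A M φ ϱ q θs us - objective P A M φ ϱ q θs u|
      ≤ regretConst T φ ϱ q L V * (|θs.1 - θ.1| ^ 2 + ‖θs.2 - θ.2‖ ^ 2) := by
  have hL := hs.pos
  have hS : IsSqIntegrable P (signal A) :=
    isSqIntegrable_signal h.signal_predictable h.signal_moment
  obtain ⟨K, hK⟩ := exists_objective_eq h hS φ ϱ q
  have ws := hus.isWeakSol hφ hs hS
  have w := hu.isWeakSol hφ hθ hS
  have key := abs_quadratic_regret_le (D := (opD φ ϱ θs ⊥).compLpL 2 P)
    (D' := (opD φ ϱ θ ⊥).compLpL 2 P) (inv_pos.2 hL) (fun F G => by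
      rw [L2.inner_def, L2.inner_def]
      refine integral_congr_ae ?_
      filter_upwards [(opD φ ϱ θs ⊥).coeFn_compLpL (p := 2) (μ := P) F,
        (opD φ ϱ θs ⊥).coeFn_compLpL (p := 2) (μ := P) G] with ω a b
      rw [a, b]
      exact opD_isSymm φ ϱ θs ⊥ _ _)
    (coercive_compLpL (hs.coercive ⊥)) (coercive_compLpL (hθ.coercive ⊥))
    (ws.inner_eq_zero hS hus.1 hus.1) (ws.inner_eq_zero hS hus.1 hu.1)
    (w.inner_eq_zero hS hu.1 hus.1) (w.inner_eq_zero hS hu.1 hu.1)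
  rw [hK θs us hus.1, hK θs u hu.1, add_sub_add_left_eq_sub]
  refine key.trans ?_
  have n1 : ‖(opD φ ϱ θs ⊥).compLpL 2 P‖
      ≤ ‖(opD φ ϱ 0 ⊥ : L2 T →L[ℝ] L2 T)‖ + (2 * L + 2 * (‖(constL2 1 : L2 T)‖ * L)) :=
    (ContinuousLinearMap.norm_compLpL_le _).trans ((norm_opD_bot_le φ ϱ θs).trans (by gcongr))
  have n2 : ‖(opD φ ϱ θs ⊥).compLpL 2 P - (opD φ ϱ θ ⊥).compLpL 2 P‖
      ≤ 2 * |θs.1 - θ.1| + 2 * (‖(constL2 1 : L2 T)‖ * ‖θs.2 - θ.2‖) := by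
    have e : (opD φ ϱ θs ⊥).compLpL 2 P - (opD φ ϱ θ ⊥).compLpL 2 P
        = (opD φ ϱ θs ⊥ - opD φ ϱ θ ⊥).compLpL 2 P := by
      rw [sub_eq_iff_eq_add, ← ContinuousLinearMap.add_compLpL, sub_add_cancel]
    rw [e]
    exact (ContinuousLinearMap.norm_compLpL_le _).trans (norm_opD_bot_sub_le φ ϱ θs θ)
  have n3 := norm_gainPath_le (φ := φ) (ϱ := ϱ) (q := q) hS hV
  -- From `(2a + 2b)² ≤ 8a² + 8b²`, enlarged to separate the distance of the models from `‖1‖`.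
  have n4 : (2 * |θs.1 - θ.1| + 2 * (‖(constL2 1 : L2 T)‖ * ‖θs.2 - θ.2‖)) ^ 2
      ≤ 8 * (1 + ‖(constL2 1 : L2 T)‖ ^ 2) * (|θs.1 - θ.1| ^ 2 + ‖θs.2 - θ.2‖ ^ 2) := by
    nlinarith [sq_nonneg (|θs.1 - θ.1| - ‖(constL2 1 : L2 T)‖ * ‖θs.2 - θ.2‖),
      sq_nonneg ‖θs.2 - θ.2‖, sq_nonneg (‖(constL2 1 : L2 T)‖ * |θs.1 - θ.1|)]
  rw [inv_inv, regretConst]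
  set N := ‖(opD φ ϱ 0 ⊥ : L2 T →L[ℝ] L2 T)‖ + (2 * L + 2 * (‖(constL2 1 : L2 T)‖ * L))
  set R := √((V * volume (Set.univ : Set (Time T))).toReal) + ‖(linGain φ ϱ q : L2 T)‖
  set δ := 2 * |θs.1 - θ.1| + 2 * (‖(constL2 1 : L2 T)‖ * ‖θs.2 - θ.2‖)
  calc _ ≤ 1 / 2 * N * (L * (δ * (L * R))) ^ 2 := by gcongr
    _ = 1 / 2 * N * (L * (L * R)) ^ 2 * δ ^ 2 := by ring
    _ ≤ 1 / 2 * N * (L * (L * R)) ^ 2 * (8 * (1 + ‖(constL2 1 : L2 T)‖ ^ 2)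
          * (|θs.1 - θ.1| ^ 2 + ‖θs.2 - θ.2‖ ^ 2)) := by
        have : 0 ≤ N := by positivity
        gcongr
    _ = _ := by ring

end Regret

end

end Propagator

theorem mainTheorem2 (T : ℝ) [Fact (0 < T)] (φ ϱ q L ε : ℝ) (hφ : 0 ≤ φ) (hϱ : 0 ≤ ϱ) (hq : 0 < q)
    (hL : 0 < L) (hε : ε ∈ Set.Ioo 0 (L⁻¹ / 2)) (V : ℝ≥0) :
    ∃ C : ℝ, 0 < C ∧
      ∀ (Ω : Type*) (mΩ : MeasurableSpace Ω) (P : Measure Ω) (𝓕 : Filtration (Propagator.Time T) mΩ)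
        (A M : Propagator.Time T → Ω → ℝ),
        IsProbabilityMeasure P →
        Propagator.UsualConditions P 𝓕 →
        Propagator.IsPriceModel P 𝓕 A M →
        Propagator.totalVariationMoment P A ≤ V →
        (∀ θ ∈ Propagator.admissibleModels T L ε,
          ∃ u, Propagator.IsGreedy P 𝓕 A φ ϱ q θ u ∧
            ∀ v, Propagator.IsGreedy P 𝓕 A φ ϱ q θ v → ∀ᵐ t, ∀ᵐ ω ∂P, v t ω = u t ω) ∧
        ∀ θstar : ℝ × Propagator.L2 T, Propagator.IsTrueModel L θstar →
          ∀ θ ∈ Propagator.admissibleModels T L ε,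
            ∀ ustar u, Propagator.IsGreedy P 𝓕 A φ ϱ q θstar ustar →
              Propagator.IsGreedy P 𝓕 A φ ϱ q θ u →
              |Propagator.objective P A M φ ϱ q θstar ustar
                  - Propagator.objective P A M φ ϱ q θstar u|
                ≤ C * (|θstar.1 - θ.1| ^ 2 + ‖θstar.2 - θ.2‖ ^ 2) := by
  -- The added one ensures strict positivity: `regretConst` is zero when, for instance, `V`, `φ` and
  -- `ϱ` all vanish.
  refine ⟨Propagator.regretConst T φ ϱ q L V + 1,
    by linarith [Propagator.regretConst_nonneg (T := T) φ ϱ q hL V], ?_⟩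
  intro Ω mΩ P 𝓕 A M hP _ hAM hV
  have hco : ∀ θ ∈ Propagator.admissibleModels T L ε, Propagator.IsCoerciveModel φ ϱ L θ :=
    fun θ hθ => ⟨hL, hθ.1, Propagator.opD_coercive hφ hϱ hε.1 hε.2 hθ⟩
  refine ⟨fun θ hθ => ?_, fun θstar hstar θ hθ ustar u hus hu => ?_⟩
  · have hS := Propagator.isSqIntegrable_signal hAM.signal_predictable hAM.signal_moment
    obtain ⟨u, hu, hw⟩ := Propagator.exists_isWeakSol (𝓕 := 𝓕) (hco θ hθ) hS q
    have hg := hw.isGreedy (hco θ hθ) hS hu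
    exact ⟨u, hg, fun v hv => hg.unique hφ (hco θ hθ) hv⟩
  · have hm := hstar.mem_admissibleModels hε.1
    refine (Propagator.abs_objective_sub_le hAM hV hφ (hco θstar hm) (hco θ hθ)
      ((abs_of_pos hstar.1).trans_le hstar.2.2.1.le) hstar.2.2.2.1.le hus hu).trans ?_
    gcongr
    linarith
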